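/- **Conventions.** A singular holomorphic foliation $\mathcal F$ on $(\mathbb C^3,0)$ is represented by a germ of holomorphic vector field $X$ whose components have no non-invertible common factor (equivalently, ${\rm Sing}(X)$ has codimension at least $2$); two representatives differ by an invertible factor. A formal separatrix $S$ of $\mathcal F$ is an irreducible formal curve with primitive parametrization $\varphi(t)=(\varphi_1,\varphi_2,\varphi_3)\in\mathbb C[[t]]^3$, $\varphi(0)=0$, such that $X\circ\varphi$ is parallel to $\varphi'$ and $X\circ\varphi\not\equiv 0$; the multiplicity ${\rm mult}(\mathcal F,S)$ is the order at $0$ of the series $g$ with $X\circ\varphi=g\,\varphi'$. A singular point is nilpotent if the linear part of a representative there is nilpotent and non-zero. Given $(\mathcal F_0,S_0)$ at $p_0$, consider the sequences of standard blow-ups $\mathcal F_0\leftarrow\mathcal F_1\leftarrow\cdots$ in which the center of each blow-up is contained in the singular set of $\mathcal F_k$, passes through $p_k$, and is either the point $p_k$ or a germ of smooth analytic curve; $\mathcal F_{k+1}$, $S_{k+1}$ are the transforms of $\mathcal F_k$, $S_k$, and $p_{k+1}$ is the point of the exceptional divisor selected by $S_{k+1}$. The origin is a *persistent nilpotent singularity*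 of $\mathcal F$, with corresponding formal separatrix $S$, if it is a nilpotent singular point and, for every such sequence starting at $(\mathcal F,S)$ (with $p_0$ the origin), all the points $p_k$ are nilpotent singular points of $\mathcal F_k$ and ${\rm mult}(\mathcal F_k,S_k)$ does not depend on $k$. It is a persistent nilpotent singularity if this holds for some formal separatrix $S$. **Theorem.** Let $\mathcal F$ be a singular holomorphic foliation on $(\mathbb C^3,0)$, assume that the origin is a persistent nilpotent singularity of $\mathcal F$, and let $S$ be the corresponding formal separatrix. Then there are a finite sequence of one-point blow-ups, centered at the singular points selected by the transforms of $S$ and leading to a foliation $\mathcal F'$ and a transform $S'$ of $S$ at a point $p'$, and an integer $n\ge 2$, such that for every $N\in\mathbb N$ there are local holomorphic coordinates $(x,y,z)$ centered at $p'$ in which $\mathcal F'$ is represented by $$(y+zf(x,y,z))\frac{\partial}{\partial x}+zg(x,y,z)\frac{\partial}{\partial y}+z^n\frac{\partial}{\partial z},$$ where $f,g$ are holomorphic, $f(0)=g(0)=0$, and (a) $S'$ is smooth and tangent to the $z$-axis, with contact order at least $N$, and the orders at $0$ of $f(0,0,z)$ and $g(0,0,z)$ are at least $N$; (b) $\dfrac{\partial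 g}{\partial x}(0,0,0)\neq 0$. Conversely, suppose that in suitable local holomorphic coordinates $(x,y,z)$ a foliation $\mathcal F$ on $(\mathbb C^3,0)$ is represented by a vector field of the above form, with $n\ge2$, $f,g$ holomorphic, $f(0)=g(0)=0$ and $\partial g/\partial x(0,0,0)\ne0$, and that $\mathcal F$ possesses a smooth formal separatrix $S$ tangent to the $z$-axis. Then the origin is a persistent nilpotent singularity of $\mathcal F$, with corresponding formal separatrix $S$. -/

import Mathlib

noncomputable section

namespace NilpotentFoliation

/-! ### Germs at the origin of `ℂ³` and formal curves

Germs of holomorphic functions on `(ℂ³, 0)` are convergent power series in `x = X 0`, `y = X 1`,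
`z = X 2`. -/

/-- Formal power series in `x, y, z`. -/
abbrev Ser := MvPowerSeries (Fin 3) ℂ

/-- The power series converges (absolutely) on some polydisc around the origin, that is, it is the
Taylor series of a germ of holomorphic function on `(ℂ³, 0)`. -/
def IsConvergent (f : Ser) : Prop :=
  ∃ r : ℝ, 0 < r ∧ Summable fun m : Fin 3 →₀ ℕ => ‖MvPowerSeries.coeff m f‖ * r ^ m.degree

/-- The first coordinate function. -/
def x : Ser := MvPowerSeries.X 0

/-- The second coordinate function. -/
def y : Ser := MvPowerSeries.X 1

/-- The third coordinate function. -/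
def z : Ser := MvPowerSeries.X 2

/-- A triple of power series: a vector field `F ∂x + G ∂y + H ∂z`, or a map `(ℂ³, 0) → (ℂ³, 0)`. -/
abbrev Triple := Fin 3 → Ser

/-- A triple of formal series in one variable `t` (a parametrized formal curve). -/
abbrev Curve := Fin 3 → PowerSeries ℂ

/-- The pull-back `f ∘ π` (used for `π` without constant terms). -/
def comp (f : Ser) (π : Triple) : Ser := MvPowerSeries.subst π f

/-- The one-variable series `f ∘ φ` (used for `φ` without constant terms). -/
def compCurve (f : Ser) (φ : Curve) : PowerSeries ℂ := MvPowerSeries.subst φ f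

/-- The formal curve `π ∘ φ`. -/
def mapCurve (π : Triple) (φ : Curve) : Curve := fun i => compCurve (π i) φ

/-- The curve is centered at the origin. -/
def Curve.Centered (φ : Curve) : Prop := ∀ i, PowerSeries.constantCoeff (φ i) = 0

/-- Irreducible formal curve at the origin, given by its (primitive) Puiseux parametrization:
`φ` is not of the form `ψ ∘ s` with `s` of order at least two. In particular `φ` is not zero. -/
def Curve.IsIrreducible (φ : Curve) : Prop :=
  φ.Centered ∧ ∀ (ψ : Curve) (s : PowerSeries ℂ), PowerSeries.constantCoeff s = 0 →
    (∀ i, φ i = PowerSeries.subst s (ψ i)) → PowerSeries.coeff 1 s ≠ 0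

/-- The `z`-axis, parametrized by `z`. -/
def zAxis : Curve := ![0, 0, PowerSeries.X]

/-- The smooth formal curves at the origin whose tangent line is the `z`-axis. -/
def Curve.TangentToZAxis (φ : Curve) : Prop :=
  φ.Centered ∧ PowerSeries.coeff 1 (φ 0) = 0 ∧ PowerSeries.coeff 1 (φ 1) = 0 ∧
    PowerSeries.coeff 1 (φ 2) ≠ 0

/-- Contact order with the `z`-axis of a smooth curve tangent to it. For the parametrization
`(a(z), b(z), z)` of the curve by `z` it is `min (ord a) (ord b)`, and these orders do not change
under reparametrization. -/
def Curve.contactZAxis (φ : Curve) : ℕ∞ := min (φ 0).order (φ 1).order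

/-! ### Foliations -/

/-- The convergent series `d` divides `f` in the ring of convergent power series. -/
def ConvDvd (d f : Ser) : Prop := ∃ q, IsConvergent q ∧ f = d * q

/-- `X` is a vector field representing a germ of one-dimensional holomorphic foliation: it is
holomorphic and its components have no common factor, that is, every holomorphic common factor is
a unit (equivalently, the singular set of `X` has codimension at least two). -/
def IsFoliation (X : Triple) : Prop :=
  (∀ i, IsConvergent (X i)) ∧
    ∀ d, IsConvergent d → (∀ i, ConvDvd d (X i)) → MvPowerSeries.constantCoeff d ≠ 0

/-- `X` vanishes at the origin. -/
def IsSingularAt (X : Triple) : Prop := ∀ i, MvPowerSeries.constantCoeff (X i) = 0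

/-- The Jacobian matrix at the origin. -/
def linearPart (X : Triple) : Matrix (Fin 3) (Fin 3) ℂ :=
  Matrix.of fun i j => MvPowerSeries.coeff (Finsupp.single j 1) (X i)

/-- The origin is a nilpotent singular point: the linear part is nilpotent and not zero. -/
def IsNilpotentSingularity (X : Triple) : Prop :=
  IsSingularAt X ∧ linearPart X ≠ 0 ∧ IsNilpotent (linearPart X)

/-- The irreducible formal curve `φ` is a formal separatrix of `X`: `X ∘ φ` is parallel to `φ'`, and
`X ∘ φ` is not identically zero. -/
def IsFormalSeparatrix (X : Triple) (φ : Curve) : Prop :=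
  φ.IsIrreducible ∧
  (∀ i j, PowerSeries.derivative ℂ (φ i) * compCurve (X j) φ =
    PowerSeries.derivative ℂ (φ j) * compCurve (X i) φ) ∧
  ∃ i, compCurve (X i) φ ≠ 0

/-- The multiplicity of `X` along `φ` is `m`: the restriction of `X` to the curve is the vector field
`g(t) d/dt` with `X ∘ φ = g φ'`, and `g` has order `m`. -/
def HasMultiplicity (X : Triple) (φ : Curve) (m : ℕ) : Prop :=
  ∃ g : PowerSeries ℂ, (∀ i, compCurve (X i) φ = g * PowerSeries.derivative ℂ (φ i)) ∧ g.order = m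

/-! ### Coordinate changes and blow-ups -/

/-- The vector `Dπ · V`, where `V` is a vector field on the source of `π`. -/
def pushTangent (π V : Triple) : Triple := fun i => ∑ j, MvPowerSeries.pderiv ℂ j (π i) * V j

/-- Germs of biholomorphisms of `(ℂ³, 0)`, that is, (the inverses of) local coordinate systems. -/
def IsBiholomorphism (H : Triple) : Prop :=
  (∀ i, IsConvergent (H i)) ∧ (∀ i, MvPowerSeries.constantCoeff (H i) = 0) ∧
    (linearPart H).det ≠ 0

/-- In the local coordinates given by `H`, the foliation of `X` is represented by `Y`: up to an
invertible factor, `Y` is the vector field `X` written in these coordinates. -/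
def RepresentedIn (H X Y : Triple) : Prop :=
  ∃ u, IsConvergent u ∧ MvPowerSeries.constantCoeff u ≠ 0 ∧
    ∀ i, u * pushTangent H Y i = comp (X i) H

/-- `X'` represents the transform, under the (birational) map germ `π`, of the foliation of `X`:
it represents a foliation, and `Dπ · X'` is proportional to `X ∘ π`. -/
def IsTransform (π X X' : Triple) : Prop :=
  IsFoliation X' ∧ ∃ a b, IsConvergent a ∧ IsConvergent b ∧ a ≠ 0 ∧ b ≠ 0 ∧
    ∀ i, a * pushTangent π X' i = b * comp (X i) π

/-- The chart `(x, y, z) ↦ (xz, yz, z)` of the blow-up of the origin. -/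
def pointChart : Triple := ![x * z, y * z, z]

/-- The chart `(x, y, z) ↦ (x, yz, z)` of the blow-up of the curve `{y = z = 0}`. -/
def curveChart : Triple := ![x, y * z, z]

/-- A germ of foliation together with a formal curve. -/
abbrev FolCurve := Triple × Curve

/-- `p' = (X', φ')` is obtained from `p = (X, φ)` by the blow-up of the origin, a singular point:
in suitable coordinates `H`, the curve `φ` lifts in the chart `pointChart` to a curve `φ'` through the
origin of the chart, and `X'` represents the transform of `X` at this point. -/
def PointBlowup (p p' : FolCurve) : Prop :=
  IsSingularAt p.1 ∧ ∃ H, IsBiholomorphism H ∧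
    IsTransform (fun i => comp (H i) pointChart) p.1 p'.1 ∧
    p'.2.Centered ∧ p.2 = mapCurve (fun i => comp (H i) pointChart) p'.2

/-- `p' = (X', φ')` is obtained from `p = (X, φ)` by the blow-up of a germ of smooth analytic curve
contained in the singular set of `X`. The center is `{y = z = 0}` in the coordinates `H`, hence it is
parametrized by `t ↦ H(t, 0, 0)`. -/
def CurveBlowup (p p' : FolCurve) : Prop :=
  ∃ H, IsBiholomorphism H ∧
    (∀ i, compCurve (p.1 i) (mapCurve H ![PowerSeries.X, 0, 0]) = 0) ∧
    IsTransform (fun i => comp (H i) curveChart) p.1 p'.1 ∧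
    p'.2.Centered ∧ p.2 = mapCurve (fun i => comp (H i) curveChart) p'.2

/-- One blow-up of the foliation with center in its singular set, followed at the point of the
exceptional divisor selected by the transform of the curve. -/
def Blowup (p p' : FolCurve) : Prop := PointBlowup p p' ∨ CurveBlowup p p'

/-! ### Persistent nilpotent singularities and the normal form -/

/-- The foliation of `X` has a persistent nilpotent singularity at the origin, with corresponding
formal separatrix `φ`: for every sequence of blow-ups, all the points selected by the transforms of
`φ` are nilpotent singular points, and the multiplicity along the transform of `φ` is constant. -/
def IsPersistentNilpotentAlong (X : Triple) (φ : Curve) : Prop :=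
  IsFoliation X ∧ IsNilpotentSingularity X ∧ IsFormalSeparatrix X φ ∧
    ∃ m : ℕ, ∀ X' φ', Relation.ReflTransGen Blowup (X, φ) (X', φ') →
      IsNilpotentSingularity X' ∧ HasMultiplicity X' φ' m

/-- The foliation of `X` has a persistent nilpotent singularity at the origin. -/
def IsPersistentNilpotent (X : Triple) : Prop := ∃ φ, IsPersistentNilpotentAlong X φ

/-- The vector field `(y + z f) ∂x + z g ∂y + z ^ n ∂z`. -/
def normalForm (n : ℕ) (f g : Ser) : Triple := ![y + z * f, z * g, z ^ n]

/-- The conditions on the data of the normal form: `n ≥ 2`, `f` and `g` are holomorphic of order at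
least one, and `∂g/∂x(0) ≠ 0`. -/
def IsNormalFormData (n : ℕ) (f g : Ser) : Prop :=
  2 ≤ n ∧ IsConvergent f ∧ IsConvergent g ∧
    MvPowerSeries.constantCoeff f = 0 ∧ MvPowerSeries.constantCoeff g = 0 ∧
    MvPowerSeries.constantCoeff (MvPowerSeries.pderiv ℂ 0 g) ≠ 0

end NilpotentFoliation

end

open NilpotentFoliation

/-!
The theorem has a direct part (persistence implies the normal form) and a converse. Both are proved
with convergent power series, without any general theory of blow-ups.

**Direct part.** The constancy of the multiplicity is used through `PersistsAlong.transform`: if `Y`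
is the pull-back of the vector field by the chart of a blow-up, then the saturation of `Y` has the same
multiplicity along the curve as the original vector field, so the common factor of the components of
`Y` restricts to a unit on the curve and is a unit. Thus transforms are plain pull-backs, and they
never have to be saturated. Point blow-ups then make the curve smooth (`hasSmoothTransform`): its order
cannot stay constant for ever, because all coordinates would be power series in one of them, against
the primitivity of the parametrization. In coordinates in which the curve is transverse to `{z = 0}`
the charts are `(x, y, z) ↦ ((x + a) z, (y + b) z, z)`. Each blow-up multiplies the `x`- and
`y`-derivatives of the last component by `z`, so that this component becomes `z ^ m` times a unit,
where `m` is the multiplicity; nilpotency of the linear part gives `m ≥ 2`. One more blow-up makes the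
first two components linear in `x, y` modulo `z` (`PersistsAlong.exists_isPrepared`). The matrix of this
linear part is nilpotent and not zero, hence a linear change of `x, y` puts it in Jordan form, and a
translation by polynomials in `z` gives the curve any prescribed contact with the `z`-axis; after
division by the unit this is the normal form (`IsPrepared.exists_normalForm`), and the orders of `f` and
`g` on the axis follow from the invariance of the curve. Finally, if `∂g/∂x(0)` were zero, the blow-up
of the `x`-axis, which is contained in the singular set, would have zero linear part at the selected
point (`PersistsAlong.constantCoeff_pderiv_ne_zero`).

**Converse.** The vector fields `(y u + z f) ∂x + z g ∂y + z ^ n ∂z` with `u(0) ≠ 0` and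
`∂g/∂x(0) ≠ 0`, with an invariant curve transverse to `{z = 0}`, always have a nilpotent non-zero linear
part and multiplicity `n` along the curve. Their singular set is the `x`-axis, so that the only blow-ups
are those of the origin and of the `x`-axis, and both lead to vector fields of the same kind: the
second one exchanges the roles of `u` and `∂g/∂x` (`IsModel.exists_pointTransform`,
`IsModel.exists_curveTransform`). A blow-up in arbitrary coordinates is compared with these explicit
ones by lifting the coordinate change to the charts, and two proportional vector fields without common
factor differ by a unit (`IsModelLike.of_lift`).

The analytic input is that convergent series are stable under the operations involved, including
inversion of units and of biholomorphisms (`exists_inverse`). It is obtained from the weighted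
`ℓ¹` norms `nrm`.
-/

noncomputable section

namespace NilpotentFoliation

open scoped NNReal ENNReal
open MvPowerSeries (X C coeff constantCoeff HasSubst subst pderiv order)

/-! ### Weighted `ℓ¹` norms and convergent series -/

/-- The weighted `ℓ¹` norm `∑ |f_m| r ^ |m|`, with values in `[0, ∞]`; it is finite for some
positive `r` exactly when the series is convergent. -/
def nrm (r : ℝ≥0) (f : Ser) : ℝ≥0∞ := ∑' m : Fin 3 →₀ ℕ, ‖coeff m f‖ₑ * (r : ℝ≥0∞) ^ m.degree

lemma isConvergent_iff {f : Ser} : IsConvergent f ↔ ∃ r : ℝ≥0, 0 < r ∧ nrm r f ≠ ⊤ := by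
  have key : ∀ r : ℝ≥0, nrm r f ≠ ⊤ ↔
      Summable fun m : Fin 3 →₀ ℕ => ‖coeff m f‖ * (r : ℝ) ^ m.degree := by
    intro r
    have : nrm r f = ∑' m : Fin 3 →₀ ℕ, ((‖coeff m f‖₊ * r ^ m.degree : ℝ≥0) : ℝ≥0∞) := by
      simp [nrm, enorm_eq_nnnorm]
    rw [this, ENNReal.tsum_coe_ne_top_iff_summable, ← NNReal.summable_coe]
    simp
  constructor
  · rintro ⟨r, hr, h⟩
    exact ⟨⟨r, hr.le⟩, hr, (key _).2 h⟩
  · rintro ⟨r, hr, h⟩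
    exact ⟨r, hr, (key r).1 h⟩

lemma nrm_mono {r s : ℝ≥0} (h : r ≤ s) (f : Ser) : nrm r f ≤ nrm s f := by
  refine ENNReal.tsum_le_tsum fun m => ?_
  gcongr

lemma nrm_add_le (r : ℝ≥0) (f g : Ser) : nrm r (f + g) ≤ nrm r f + nrm r g := by
  rw [nrm, nrm, nrm, ← ENNReal.tsum_add]
  refine ENNReal.tsum_le_tsum fun m => ?_
  rw [← add_mul, map_add]
  gcongr
  exact enorm_add_le _ _

lemma nrm_neg (r : ℝ≥0) (f : Ser) : nrm r (-f) = nrm r f := by simp [nrm]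

lemma nrm_mul_le (r : ℝ≥0) (f g : Ser) : nrm r (f * g) ≤ nrm r f * nrm r g := by
  classical
  have h1 : ∀ m : Fin 3 →₀ ℕ, ‖coeff m (f * g)‖ₑ * (r : ℝ≥0∞) ^ m.degree ≤
      ∑ p ∈ Finset.HasAntidiagonal.antidiagonal m, (‖coeff p.1 f‖ₑ * (r : ℝ≥0∞) ^ p.1.degree) *
        (‖coeff p.2 g‖ₑ * (r : ℝ≥0∞) ^ p.2.degree) := by
    intro m
    rw [MvPowerSeries.coeff_mul]
    calc _ ≤ (∑ p ∈ Finset.HasAntidiagonal.antidiagonal m, ‖coeff p.1 f * coeff p.2 g‖ₑ) *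
          (r : ℝ≥0∞) ^ m.degree := by gcongr; exact enorm_sum_le _ _
      _ = _ := by
        rw [Finset.sum_mul]
        refine Finset.sum_congr rfl fun p hp => ?_
        rw [← Finset.HasAntidiagonal.mem_antidiagonal.1 hp, map_add, pow_add, enorm_mul]
        ring
  refine (ENNReal.tsum_le_tsum h1).trans (le_of_eq ?_)
  rw [nrm, nrm, ← ENNReal.tsum_mul_right]
  simp_rw [← ENNReal.tsum_mul_left]
  rw [← ENNReal.tsum_prod, ← Finset.HasAntidiagonal.sigmaAntidiagonalEquivProd.tsum_eq, ENNReal.tsum_sigma']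
  refine tsum_congr fun m => ?_
  rw [← Finset.tsum_subtype]
  rfl

lemma nrm_monomial (r : ℝ≥0) (m : Fin 3 →₀ ℕ) (c : ℂ) :
    nrm r (MvPowerSeries.monomial m c) = ‖c‖ₑ * (r : ℝ≥0∞) ^ m.degree := by
  classical
  rw [nrm, tsum_eq_single m]
  · simp
  · intro b hb
    simp [MvPowerSeries.coeff_monomial, hb]

lemma nrm_C (r : ℝ≥0) (c : ℂ) : nrm r (C c) = ‖c‖ₑ := by
  rw [← MvPowerSeries.monomial_zero_eq_C_apply, nrm_monomial]; simp

lemma nrm_one (r : ℝ≥0) : nrm r 1 = 1 := by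
  rw [← map_one (C (σ := Fin 3) (R := ℂ)), nrm_C]; simp

lemma nrm_X (r : ℝ≥0) (i : Fin 3) : nrm r (X i) = r := by
  rw [MvPowerSeries.X, nrm_monomial]; simp

lemma nrm_pow_le (r : ℝ≥0) (f : Ser) (n : ℕ) : nrm r (f ^ n) ≤ nrm r f ^ n := by
  induction n with
  | zero => simp [nrm_one]
  | succ n ih =>
    rw [pow_succ, pow_succ]
    exact (nrm_mul_le _ _ _).trans (by gcongr)

lemma nrm_prod_le {ι : Type*} (r : ℝ≥0) (s : Finset ι) (f : ι → Ser) :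
    nrm r (∏ i ∈ s, f i) ≤ ∏ i ∈ s, nrm r (f i) := by
  classical
  induction s using Finset.induction_on with
  | empty => simp [nrm_one]
  | insert a s ha ih =>
    rw [Finset.prod_insert ha, Finset.prod_insert ha]
    exact (nrm_mul_le _ _ _).trans (by gcongr)

lemma hasSubst_of_zero {τ : Type*} {π : Fin 3 → MvPowerSeries τ ℂ}
    (h : ∀ i, constantCoeff (π i) = 0) : HasSubst π :=
  MvPowerSeries.hasSubst_of_constantCoeff_zero h

lemma nrm_comp_le {r s : ℝ≥0} (f : Ser) {π : Triple} (hπ : ∀ i, constantCoeff (π i) = 0)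
    (hs : ∀ i, nrm r (π i) ≤ s) : nrm r (comp f π) ≤ nrm s f := by
  have h1 : ∀ e : Fin 3 →₀ ℕ, ‖coeff e (comp f π)‖ₑ ≤
      ∑' d : Fin 3 →₀ ℕ, ‖coeff d f‖ₑ * ‖coeff e (d.prod fun s e => (π s) ^ e)‖ₑ := by
    intro e
    have hfin := MvPowerSeries.coeff_subst_finite (hasSubst_of_zero hπ) f e
    rw [comp, MvPowerSeries.coeff_subst (hasSubst_of_zero hπ), finsum_eq_sum _ hfin]
    refine (enorm_sum_le _ _).trans ?_
    simp_rw [smul_eq_mul, enorm_mul]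
    exact ENNReal.sum_le_tsum _
  calc nrm r (comp f π) ≤ ∑' e : Fin 3 →₀ ℕ, ∑' d : Fin 3 →₀ ℕ,
        ‖coeff d f‖ₑ * (‖coeff e (d.prod fun s e => (π s) ^ e)‖ₑ * (r : ℝ≥0∞) ^ e.degree) := by
        refine ENNReal.tsum_le_tsum fun e => ?_
        simp_rw [← mul_assoc]
        rw [ENNReal.tsum_mul_right]
        gcongr
        exact h1 e
    _ = ∑' d : Fin 3 →₀ ℕ, ‖coeff d f‖ₑ * nrm r (d.prod fun s e => (π s) ^ e) := by
        rw [ENNReal.tsum_comm]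
        simp_rw [ENNReal.tsum_mul_left]
        rfl
    _ ≤ nrm s f := by
        refine ENNReal.tsum_le_tsum fun d => ?_
        gcongr
        refine (nrm_prod_le _ _ _).trans ?_
        rw [Finsupp.degree_apply, ← Finset.prod_pow_eq_pow_sum]
        refine Finset.prod_le_prod' fun i _ => ?_
        refine (nrm_pow_le _ _ _).trans ?_
        gcongr
        exact hs i

/-- A series without constant term has small norm on small polydiscs. -/
lemma nrm_mul_le_of_constantCoeff_zero {r R : ℝ≥0} (h : r ≤ R) {f : Ser}
    (hf : constantCoeff f = 0) : R * nrm r f ≤ r * nrm R f := by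
  rw [nrm, nrm, ← ENNReal.tsum_mul_left, ← ENNReal.tsum_mul_left]
  refine ENNReal.tsum_le_tsum fun m => ?_
  by_cases hm : m = 0
  · subst hm; simp [hf]
  · obtain ⟨k, hk⟩ : ∃ k, m.degree = k + 1 :=
      Nat.exists_eq_succ_of_ne_zero (by rwa [Ne, Finsupp.degree_eq_zero_iff])
    rw [hk, pow_succ, pow_succ]
    have : (r : ℝ≥0∞) ^ k ≤ (R : ℝ≥0∞) ^ k := by gcongr
    calc (R : ℝ≥0∞) * (‖coeff m f‖ₑ * ((r : ℝ≥0∞) ^ k * r))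
        = (r * R) * ‖coeff m f‖ₑ * (r : ℝ≥0∞) ^ k := by ring
      _ ≤ (r * R) * ‖coeff m f‖ₑ * (R : ℝ≥0∞) ^ k := by gcongr
      _ = _ := by ring

lemma exists_nrm_le {f : Ser} (hf : IsConvergent f) (h0 : constantCoeff f = 0) {s : ℝ≥0}
    (hs : 0 < s) : ∃ r : ℝ≥0, 0 < r ∧ nrm r f ≤ s := by
  obtain ⟨R, hR, hfin⟩ := isConvergent_iff.1 hf
  lift nrm R f to ℝ≥0 using hfin with M hM
  refine ⟨min R (s * R / (M + 1)), by positivity, ?_⟩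
  have h1 := nrm_mul_le_of_constantCoeff_zero (min_le_left R (s * R / (M + 1))) h0
  rw [← hM] at h1
  have h2 : ((min R (s * R / (M + 1)) : ℝ≥0) : ℝ≥0∞) * M ≤ R * s := by
    norm_cast
    calc _ ≤ s * R / (M + 1) * M := by gcongr; exact min_le_right _ _
      _ ≤ s * R / (M + 1) * (M + 1) := by gcongr; simp
      _ = R * s := by field_simp
  exact (ENNReal.mul_le_mul_iff_right (by simpa using hR.ne') (by simp)).1 (h1.trans h2)

lemma IsConvergent.add {f g : Ser} (hf : IsConvergent f) (hg : IsConvergent g) :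
    IsConvergent (f + g) := by
  obtain ⟨r, hr, h1⟩ := isConvergent_iff.1 hf
  obtain ⟨s, hs, h2⟩ := isConvergent_iff.1 hg
  refine isConvergent_iff.2 ⟨min r s, by positivity, ne_top_of_le_ne_top ?_ (nrm_add_le _ _ _)⟩
  exact ENNReal.add_ne_top.2 ⟨ne_top_of_le_ne_top h1 (nrm_mono (min_le_left _ _) _),
    ne_top_of_le_ne_top h2 (nrm_mono (min_le_right _ _) _)⟩

lemma IsConvergent.mul {f g : Ser} (hf : IsConvergent f) (hg : IsConvergent g) :
    IsConvergent (f * g) := by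
  obtain ⟨r, hr, h1⟩ := isConvergent_iff.1 hf
  obtain ⟨s, hs, h2⟩ := isConvergent_iff.1 hg
  refine isConvergent_iff.2 ⟨min r s, by positivity, ne_top_of_le_ne_top ?_ (nrm_mul_le _ _ _)⟩
  exact ENNReal.mul_ne_top (ne_top_of_le_ne_top h1 (nrm_mono (min_le_left _ _) _))
    (ne_top_of_le_ne_top h2 (nrm_mono (min_le_right _ _) _))

lemma IsConvergent.neg {f : Ser} (hf : IsConvergent f) : IsConvergent (-f) := by
  obtain ⟨r, hr, h1⟩ := isConvergent_iff.1 hf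
  exact isConvergent_iff.2 ⟨r, hr, by rwa [nrm_neg]⟩

lemma isConvergent_C (c : ℂ) : IsConvergent (C c) :=
  isConvergent_iff.2 ⟨1, one_pos, by simp [nrm_C]⟩

lemma isConvergent_X (i : Fin 3) : IsConvergent (X i) :=
  isConvergent_iff.2 ⟨1, one_pos, by simp [nrm_X]⟩

/-- The ring of convergent power series. -/
def convSubring : Subring Ser where
  carrier := {f | IsConvergent f}
  mul_mem' := IsConvergent.mul
  one_mem' := by simpa using isConvergent_C 1
  add_mem' := IsConvergent.add
  zero_mem' := by simpa using isConvergent_C 0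
  neg_mem' := IsConvergent.neg

lemma isConvergent_zero : IsConvergent 0 := convSubring.zero_mem

lemma isConvergent_one : IsConvergent 1 := convSubring.one_mem

lemma IsConvergent.sub {f g : Ser} (hf : IsConvergent f) (hg : IsConvergent g) :
    IsConvergent (f - g) := convSubring.sub_mem hf hg

lemma IsConvergent.pow {f : Ser} (hf : IsConvergent f) (n : ℕ) : IsConvergent (f ^ n) :=
  convSubring.pow_mem hf n

lemma IsConvergent.sum {ι : Type*} {s : Finset ι} {f : ι → Ser}
    (h : ∀ i ∈ s, IsConvergent (f i)) : IsConvergent (∑ i ∈ s, f i) :=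
  convSubring.sum_mem h

lemma IsConvergent.comp {f : Ser} (hf : IsConvergent f) {π : Triple}
    (hπ : ∀ i, IsConvergent (π i)) (h0 : ∀ i, constantCoeff (π i) = 0) :
    IsConvergent (comp f π) := by
  obtain ⟨s, hs, h1⟩ := isConvergent_iff.1 hf
  choose r hr h2 using fun i => exists_nrm_le (hπ i) (h0 i) hs
  obtain ⟨r', hr', hle⟩ : ∃ r' : ℝ≥0, 0 < r' ∧ ∀ i, r' ≤ r i :=
    ⟨Finset.univ.inf' Finset.univ_nonempty r, by simpa [Finset.lt_inf'_iff] using hr,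
      fun i => Finset.inf'_le _ (Finset.mem_univ i)⟩
  exact isConvergent_iff.2 ⟨r', hr', ne_top_of_le_ne_top h1
    (nrm_comp_le f h0 fun i => (nrm_mono (hle i) _).trans (h2 i))⟩

lemma IsConvergent.pderiv {f : Ser} (hf : IsConvergent f) (j : Fin 3) :
    IsConvergent (pderiv ℂ j f) := by
  obtain ⟨R, hR, h1⟩ := isConvergent_iff.1 hf
  refine isConvergent_iff.2 ⟨R / 2, by positivity, ?_⟩
  have hR' : (R : ℝ≥0∞) ≠ 0 := by simpa using hR.ne'
  suffices h : R * nrm (R / 2) (MvPowerSeries.pderiv ℂ j f) ≤ nrm R f by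
    intro htop
    rw [htop, ENNReal.mul_top hR'] at h
    exact h1 (top_le_iff.1 h)
  rw [nrm, nrm, ← ENNReal.tsum_mul_left]
  refine (ENNReal.tsum_le_tsum fun m => ?_).trans
    (ENNReal.tsum_comp_le_tsum_of_injective (add_left_injective (Finsupp.single j 1)) _)
  rw [MvPowerSeries.coeff_pderiv, enorm_mul]
  have h2 : ‖((m j : ℂ) + 1)‖ₑ ≤ 2 ^ m.degree := by
    have h3 : m j + 1 ≤ 2 ^ m.degree := Nat.lt_two_pow_self.trans_le
      (Nat.pow_le_pow_right two_pos (Finsupp.le_degree j m))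
    have : ‖((m j : ℂ) + 1)‖ₑ = ((m j + 1 : ℕ) : ℝ≥0∞) := by
      rw [← Nat.cast_succ, enorm_eq_nnnorm, RCLike.nnnorm_natCast]
      simp
    rw [this]
    exact_mod_cast h3
  have h4 : (2 : ℝ≥0∞) ^ m.degree * ((R / 2 : ℝ≥0) : ℝ≥0∞) ^ m.degree = R ^ m.degree := by
    rw [← mul_pow]
    congr 1
    norm_cast
    field_simp
  calc (R : ℝ≥0∞) * (‖coeff (m + Finsupp.single j 1) f‖ₑ * ‖((m j : ℂ) + 1)‖ₑ *
        ((R / 2 : ℝ≥0) : ℝ≥0∞) ^ m.degree)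
      ≤ R * (‖coeff (m + Finsupp.single j 1) f‖ₑ * 2 ^ m.degree *
        ((R / 2 : ℝ≥0) : ℝ≥0∞) ^ m.degree) := by gcongr
    _ = ‖coeff (m + Finsupp.single j 1) f‖ₑ * (2 ^ m.degree *
        ((R / 2 : ℝ≥0) : ℝ≥0∞) ^ m.degree * R) := by ring
    _ = _ := by rw [h4, map_add, pow_add]; simp

/-- Exact division by a coordinate preserves convergence. -/
lemma isConvergent_of_X_mul {j : Fin 3} {q : Ser} (h : IsConvergent (X j * q)) :
    IsConvergent q := by
  obtain ⟨R, hR, h1⟩ := isConvergent_iff.1 h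
  refine isConvergent_iff.2 ⟨R, hR, ?_⟩
  have hR' : (R : ℝ≥0∞) ≠ 0 := by simpa using hR.ne'
  suffices h : R * nrm R q ≤ nrm R (X j * q) by
    intro htop
    rw [htop, ENNReal.mul_top hR'] at h
    exact h1 (top_le_iff.1 h)
  rw [nrm, nrm, ← ENNReal.tsum_mul_left]
  refine (ENNReal.tsum_le_tsum fun m => ?_).trans
    (ENNReal.tsum_comp_le_tsum_of_injective (add_left_injective (Finsupp.single j 1)) _)
  rw [map_add, pow_add, add_comm m, MvPowerSeries.X, MvPowerSeries.coeff_add_monomial_mul]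
  simp only [one_mul, Finsupp.degree_single, pow_one]
  exact le_of_eq (by ring)

/-- The geometric series converges, and so does its composition with a series without constant
term; hence the inverse of a convergent unit is convergent. -/
lemma IsConvergent.inv {f : Ser} (hf : IsConvergent f) (h0 : constantCoeff f ≠ 0) :
    IsConvergent f⁻¹ := by
  have hgeo : IsConvergent (1 - X 0 : Ser)⁻¹ := by
    have hinv : (1 - X 0 : Ser)⁻¹ * (1 - X 0) = 1 := MvPowerSeries.inv_mul_cancel _ (by simp)
    set G := (1 - X 0 : Ser)⁻¹ with hG
    -- `G` is the explicit series of the powers of the first variable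
    set E : Ser := fun m => if m 1 = 0 ∧ m 2 = 0 then 1 else 0 with hE
    have hcoeff : ∀ m : Fin 3 →₀ ℕ, coeff m E = if m 1 = 0 ∧ m 2 = 0 then 1 else 0 := fun m => rfl
    have hE1 : E * (1 - X 0) = 1 := by
      classical
      ext m
      rw [mul_sub, mul_one, map_sub, MvPowerSeries.X, MvPowerSeries.coeff_mul_monomial, hcoeff,
        MvPowerSeries.coeff_one, hcoeff, mul_one]
      by_cases h00 : m 0 = 0
      · have h2 : ¬ (Finsupp.single (0 : Fin 3) 1 ≤ m) := by
          intro h; have := h 0; simp [h00] at this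
        rw [if_neg h2]
        have : m = 0 ↔ m 1 = 0 ∧ m 2 = 0 := by
          constructor
          · rintro rfl; simp
          · rintro ⟨h1, h2⟩; ext i; fin_cases i <;> simp [h00, h1, h2]
        simp [this]
      · have h2 : Finsupp.single (0 : Fin 3) 1 ≤ m := by
          rw [Finsupp.single_le_iff]; omega
        rw [if_pos h2, if_neg (show m ≠ 0 by rintro rfl; simp at h00)]
        simp [Finsupp.tsub_apply]
    have hEG : G = E := by
      have : G * (1 - X 0) = E * (1 - X 0) := by rw [hinv, hE1]
      have hne : (1 - X 0 : Ser) ≠ 0 := by rintro h; rw [h, mul_zero] at hE1; exact zero_ne_one hE1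
      exact mul_right_cancel₀ hne this
    rw [hEG]
    refine isConvergent_iff.2 ⟨1 / 2, by positivity, ?_⟩
    have hinj : Function.Injective fun k : ℕ => Finsupp.single (0 : Fin 3) k :=
      Finsupp.single_injective _
    have hsupp : Function.support (fun m : Fin 3 →₀ ℕ =>
        ‖coeff m E‖ₑ * (((1 / 2 : ℝ≥0)) : ℝ≥0∞) ^ m.degree) ⊆ Set.range fun k : ℕ =>
          Finsupp.single (0 : Fin 3) k := by
      intro m hm
      refine ⟨m 0, ?_⟩
      by_contra hne
      apply hm
      have : ¬ (m 1 = 0 ∧ m 2 = 0) := by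
        rintro ⟨h1, h2⟩
        apply hne
        ext i; fin_cases i <;> simp [h1, h2]
      simp [hcoeff, this]
    rw [nrm, ← hinj.tsum_eq hsupp]
    simp only [hcoeff]
    have : ∀ c : ℕ, ‖(if (Finsupp.single (0 : Fin 3) c) 1 = 0 ∧ (Finsupp.single (0 : Fin 3) c) 2 = 0
        then (1 : ℂ) else 0)‖ₑ * (((1 / 2 : ℝ≥0)) : ℝ≥0∞) ^ (Finsupp.single (0 : Fin 3) c).degree =
        (((1 / 2 : ℝ≥0)) : ℝ≥0∞) ^ c := by
      intro c; simp
    simp_rw [this]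
    rw [ENNReal.tsum_geometric]
    simp
  set c := constantCoeff f with hc
  set h : Ser := 1 - C c⁻¹ * f with hh
  have hh0 : constantCoeff h = 0 := by simp [hh, ← hc, h0]
  have hhc : IsConvergent h := isConvergent_one.sub ((isConvergent_C _).mul hf)
  have hπ : ∀ i : Fin 3, constantCoeff ((![h, 0, 0] : Triple) i) = 0 := by
    intro i; fin_cases i <;> simp [hh0]
  have hπc : ∀ i : Fin 3, IsConvergent ((![h, 0, 0] : Triple) i) := by
    intro i; fin_cases i <;> simp [hhc, isConvergent_zero]
  have hS := hasSubst_of_zero hπ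
  have key : NilpotentFoliation.comp ((1 - X 0 : Ser)⁻¹) ![h, 0, 0] * (1 - h) = 1 := by
    have e1 : (1 - X 0 : Ser)⁻¹ * (1 - X 0) = 1 := MvPowerSeries.inv_mul_cancel _ (by simp)
    have e2 := congrArg (MvPowerSeries.substAlgHom hS) e1
    rw [map_mul, map_sub, map_one, MvPowerSeries.substAlgHom_X] at e2
    simpa [NilpotentFoliation.comp] using e2
  have h1 : f⁻¹ = C c⁻¹ * NilpotentFoliation.comp ((1 - X 0 : Ser)⁻¹) ![h, 0, 0] := by
    rw [MvPowerSeries.inv_eq_iff_mul_eq_one h0]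
    rw [hh] at key ⊢
    linear_combination key
  rw [h1]
  exact (isConvergent_C _).mul (hgeo.comp hπc hπ)

/-! ### Composition of series: chain rule and congruences -/

section Composition

variable {τ : Type*}

lemma coeff_single_eq (f : MvPowerSeries τ ℂ) (t : τ) :
    coeff (Finsupp.single t 1) f = constantCoeff (pderiv ℂ t f) := by
  rw [← MvPowerSeries.coeff_zero_eq_constantCoeff_apply, MvPowerSeries.coeff_pderiv]
  simp

lemma X_ne_zero (i : Fin 3) : (X i : Ser) ≠ 0 := by
  intro h
  have := congrArg (coeff (Finsupp.single i 1)) h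
  simp [MvPowerSeries.coeff_X] at this

/-- A series is its constant term plus a combination of the coordinates, with convergent
coefficients if the series is convergent; the first variable is not needed if the series vanishes
on the first axis. -/
lemma exists_eq_C_add_sum_X_mul (f : Ser) : ∃ g : Fin 3 → Ser,
    f = C (constantCoeff f) + ∑ i, X i * g i ∧ (IsConvergent f → ∀ i, IsConvergent (g i)) ∧
      ((∀ k, coeff (Finsupp.single 0 k) f = 0) → g 0 = 0) := by
  classical
  -- sort the monomials by the last variable that occurs in them
  set a : Fin 3 → Ser := fun i m => if m i ≠ 0 ∧ ∀ j > i, m j = 0 then coeff m f else 0 with ha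
  have hac : ∀ i m, coeff m (a i) = if m i ≠ 0 ∧ ∀ j > i, m j = 0 then coeff m f else 0 :=
    fun i m => rfl
  have hdvd : ∀ i, (X i : Ser) ∣ a i := by
    intro i
    rw [MvPowerSeries.X_dvd_iff]
    intro m hm
    simp [hac, hm]
  choose g hg using hdvd
  have hconv : IsConvergent f → ∀ i, IsConvergent (a i) := by
    intro h i
    obtain ⟨r, hr, hfin⟩ := isConvergent_iff.1 h
    refine isConvergent_iff.2 ⟨r, hr, ne_top_of_le_ne_top hfin ?_⟩
    refine ENNReal.tsum_le_tsum fun m => ?_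
    gcongr
    rw [hac]
    split_ifs <;> simp
  refine ⟨g, ?_, fun h i => isConvergent_of_X_mul (j := i) ((hg i) ▸ hconv h i), fun h => ?_⟩
  · simp_rw [← hg]
    ext m
    rw [map_add, map_sum, MvPowerSeries.coeff_C]
    simp_rw [hac]
    rw [Fin.sum_univ_three]
    by_cases hm : m = 0
    · subst hm; simp
    · rw [if_neg hm]
      by_cases h2 : m 2 = 0
      · by_cases h1 : m 1 = 0
        · have h0 : m 0 ≠ 0 := by
            intro h0; apply hm; ext i; fin_cases i <;> simp [h0, h1, h2]
          have : ∀ j > (0 : Fin 3), m j = 0 := by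
            intro j hj; fin_cases j <;> simp_all
          rw [if_pos ⟨h0, this⟩, if_neg (by simp [h1]), if_neg (by simp [h2])]
          simp
        · have e0 : ¬ ∀ j > (0 : Fin 3), m j = 0 := fun h => h1 (h 1 (by decide))
          have e1 : ∀ j > (1 : Fin 3), m j = 0 := by
            intro j hj; fin_cases j <;> simp_all
          rw [if_neg (by simp [e0]), if_pos ⟨h1, e1⟩, if_neg (by simp [h2])]
          simp
      · have e0 : ¬ ∀ j > (0 : Fin 3), m j = 0 := fun h => h2 (h 2 (by decide))
        have e1 : ¬ ∀ j > (1 : Fin 3), m j = 0 := fun h => h2 (h 2 (by decide))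
        have e2 : ∀ j > (2 : Fin 3), m j = 0 := by
          intro j hj; fin_cases j <;> simp_all
        rw [if_neg (by simp [e0]), if_neg (by simp [e1]), if_pos ⟨h2, e2⟩]
        simp
  · have h0 : a 0 = 0 := by
      ext m
      rw [hac, (coeff m).map_zero, ite_eq_right_iff]
      rintro ⟨-, hm⟩
      have : m = Finsupp.single 0 (m 0) := by
        ext i; fin_cases i
        · simp
        · simpa using hm 1 (by decide)
        · simpa using hm 2 (by decide)
      rw [this, h]
    rw [hg] at h0
    exact (mul_eq_zero.1 h0).resolve_left (X_ne_zero 0)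

lemma constantCoeff_of_eq_C_add_sum_X_mul {f : Ser} {g : Fin 3 → Ser} {c : ℂ}
    (hf : f = C c + ∑ i, X i * g i) (k : Fin 3) :
    constantCoeff (g k) = coeff (Finsupp.single k 1) f := by
  rw [coeff_single_eq, hf, Fin.sum_univ_three]
  fin_cases k <;> simp [MvPowerSeries.pderiv_X_of_ne, Derivation.leibniz]

lemma eq_zero_of_forall_le_order {f : MvPowerSeries τ ℂ} (h : ∀ n : ℕ, (n : ℕ∞) ≤ f.order) :
    f = 0 := by
  rw [← MvPowerSeries.order_eq_top_iff]
  exact ENat.eq_top_iff_forall_ge.2 h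

lemma le_order_sum {ι : Type*} {s : Finset ι} {f : ι → MvPowerSeries τ ℂ} {n : ℕ∞}
    (h : ∀ i ∈ s, n ≤ (f i).order) : n ≤ (∑ i ∈ s, f i).order := by
  classical
  induction s using Finset.induction_on with
  | empty => simp
  | insert a s ha ih =>
    rw [Finset.sum_insert ha]
    exact (le_min (h a (by simp)) (ih fun i hi => h i (by simp [hi]))).trans
      MvPowerSeries.min_order_le_add

lemma le_order_add {f g : MvPowerSeries τ ℂ} {n : ℕ∞} (hf : n ≤ f.order) (hg : n ≤ g.order) :
    n ≤ (f + g).order :=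
  (le_min hf hg).trans MvPowerSeries.min_order_le_add

lemma one_le_order {f : MvPowerSeries τ ℂ} (h : constantCoeff f = 0) : 1 ≤ f.order :=
  MvPowerSeries.one_le_order_iff_constCoeff_eq_zero.2 h

lemma le_order_mul_add {f g : MvPowerSeries τ ℂ} {a b : ℕ∞} (hf : a ≤ f.order) (hg : b ≤ g.order) :
    a + b ≤ (f * g).order :=
  (add_le_add hf hg).trans MvPowerSeries.le_order_mul

variable {π ρ : Fin 3 → MvPowerSeries τ ℂ}

/-- Composition with `π`, as a homomorphism of algebras. -/
def substHom (π : Fin 3 → MvPowerSeries τ ℂ) (hπ : ∀ i, constantCoeff (π i) = 0) :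
    Ser →ₐ[ℂ] MvPowerSeries τ ℂ := MvPowerSeries.substAlgHom (hasSubst_of_zero hπ)

lemma substHom_apply (hπ : ∀ i, constantCoeff (π i) = 0) (f : Ser) :
    substHom π hπ f = subst π f := by
  rw [substHom, MvPowerSeries.coe_substAlgHom]

lemma substHom_X (hπ : ∀ i, constantCoeff (π i) = 0) (i : Fin 3) : substHom π hπ (X i) = π i :=
  MvPowerSeries.substAlgHom_X _ _

lemma substHom_C (hπ : ∀ i, constantCoeff (π i) = 0) (c : ℂ) : substHom π hπ (C c) = C c :=
  (substHom π hπ).commutes c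

lemma substHom_decomp (hπ : ∀ i, constantCoeff (π i) = 0) {f : Ser} {g : Fin 3 → Ser}
    (hf : f = C (constantCoeff f) + ∑ i, X i * g i) :
    substHom π hπ f = C (constantCoeff f) + ∑ i, π i * substHom π hπ (g i) := by
  conv_lhs => rw [hf]
  rw [map_add, map_sum, substHom_C]
  simp_rw [map_mul, substHom_X]

lemma constantCoeff_substHom (hπ : ∀ i, constantCoeff (π i) = 0) (f : Ser) :
    constantCoeff (substHom π hπ f) = constantCoeff f := by
  obtain ⟨g, hg, -, -⟩ := exists_eq_C_add_sum_X_mul f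
  rw [substHom_decomp hπ hg, map_add, map_sum]
  simp [hπ]

/-- The chain rule. -/
lemma pderiv_substHom (hπ : ∀ i, constantCoeff (π i) = 0) (t : τ) (f : Ser) :
    pderiv ℂ t (substHom π hπ f) = ∑ k, substHom π hπ (pderiv ℂ k f) * pderiv ℂ t (π k) := by
  -- the difference of the two sides is a derivation along `substHom` which kills the coordinates;
  -- by the decomposition of `f` its values have arbitrarily high order
  suffices h : ∀ (n : ℕ) (f : Ser), (n : ℕ∞) ≤ (pderiv ℂ t (substHom π hπ f) -
      ∑ k, substHom π hπ (pderiv ℂ k f) * pderiv ℂ t (π k)).order from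
    sub_eq_zero.1 (eq_zero_of_forall_le_order fun n => h n f)
  intro n
  induction n with
  | zero => intro f; simp
  | succ n ih =>
    intro f
    obtain ⟨g, hg, -, -⟩ := exists_eq_C_add_sum_X_mul f
    have e1 : pderiv ℂ t (substHom π hπ f) -
        ∑ k, substHom π hπ (pderiv ℂ k f) * pderiv ℂ t (π k) =
        ∑ i, π i * (pderiv ℂ t (substHom π hπ (g i)) -
          ∑ k, substHom π hπ (pderiv ℂ k (g i)) * pderiv ℂ t (π k)) := by
      rw [substHom_decomp hπ hg]
      conv_lhs => rw [hg]
      have e2 : ∀ k, pderiv ℂ k (C (constantCoeff f) + ∑ i, X i * g i) =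
          g k + ∑ i, X i * pderiv ℂ k (g i) := by
        intro k
        simp only [map_add, MvPowerSeries.pderiv_C, map_sum, Derivation.leibniz, smul_eq_mul,
          zero_add, MvPowerSeries.pderiv_X, Finset.sum_add_distrib, Pi.single_apply]
        simp [add_comm]
      simp_rw [e2]
      simp only [map_add, MvPowerSeries.pderiv_C, Derivation.leibniz, smul_eq_mul,
          zero_add, map_mul, substHom_X, Fin.sum_univ_three]
      ring
    rw [e1]
    refine le_order_sum fun i _ => ?_
    rw [Nat.cast_succ, add_comm]
    exact le_order_mul_add (one_le_order (hπ i)) (ih (g i))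

/-- Substitutions which agree up to order `n` have results which agree up to order `n`. -/
lemma le_order_substHom_sub (hπ : ∀ i, constantCoeff (π i) = 0) (hρ : ∀ i, constantCoeff (ρ i) = 0)
    {n : ℕ∞} (h : ∀ i, n ≤ (π i - ρ i).order) (f : Ser) :
    n ≤ (substHom π hπ f - substHom ρ hρ f).order := by
  have key : ∀ (m : ℕ) (f : Ser), min (m : ℕ∞) n ≤ (substHom π hπ f - substHom ρ hρ f).order := by
    intro m
    induction m with
    | zero => intro f; simp
    | succ m ih =>
      intro f
      obtain ⟨g, hg, -, -⟩ := exists_eq_C_add_sum_X_mul f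
      have e : substHom π hπ f - substHom ρ hρ f = ∑ i, (π i * (substHom π hπ (g i) -
          substHom ρ hρ (g i)) + (π i - ρ i) * substHom ρ hρ (g i)) := by
        rw [substHom_decomp hπ hg, substHom_decomp hρ hg]
        simp only [Fin.sum_univ_three]
        ring
      rw [e]
      refine le_order_sum fun i _ => le_order_add ?_ ?_
      · refine le_trans ?_ (le_order_mul_add (one_le_order (hπ i)) (ih (g i)))
        rcases le_total (m : ℕ∞) n with hmn | hmn
        · rw [min_eq_left hmn, add_comm]; exact_mod_cast min_le_left _ _
        · rw [min_eq_right hmn]; exact (min_le_right _ _).trans le_add_self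
      · refine (min_le_right _ _).trans ((h i).trans ?_)
        exact le_self_add.trans MvPowerSeries.le_order_mul
  cases n with
  | top => exact (ENat.eq_top_iff_forall_ge.2 fun m => by simpa using key m f).ge
  | coe n => simpa using key n f

end Composition

/-! ### The inverse function theorem for convergent series -/

lemma comp_eq_substHom {π : Triple} (hπ : ∀ i, constantCoeff (π i) = 0) (f : Ser) :
    comp f π = substHom π hπ f := (substHom_apply hπ f).symm

/-- The Jacobian matrix. -/
def jac (π : Triple) : Matrix (Fin 3) (Fin 3) Ser := Matrix.of fun i j => pderiv ℂ j (π i)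

lemma linearPart_eq_map_jac (π : Triple) : linearPart π = (jac π).map constantCoeff := by
  ext i j
  simp [linearPart, jac, coeff_single_eq]

lemma jac_comp {π ρ : Triple} (hρ : ∀ i, constantCoeff (ρ i) = 0) :
    jac (fun i => comp (π i) ρ) = (jac π).map (substHom ρ hρ) * jac ρ := by
  ext1 i j
  simp only [jac, Matrix.of_apply, comp_eq_substHom hρ, pderiv_substHom, Matrix.mul_apply,
    Matrix.map_apply]

lemma constantCoeff_comp {π : Triple} (hπ : ∀ i, constantCoeff (π i) = 0) (f : Ser) :
    constantCoeff (comp f π) = constantCoeff f := by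
  rw [comp_eq_substHom hπ, constantCoeff_substHom]

lemma linearPart_comp {π ρ : Triple} (hρ : ∀ i, constantCoeff (ρ i) = 0) :
    linearPart (fun i => comp (π i) ρ) = linearPart π * linearPart ρ := by
  rw [linearPart_eq_map_jac, jac_comp hρ, Matrix.map_mul, ← linearPart_eq_map_jac ρ, Matrix.map_map,
    linearPart_eq_map_jac π]
  congr 1
  ext i j
  simp [constantCoeff_substHom]

lemma comp_comp {π ρ : Triple} (hπ : ∀ i, constantCoeff (π i) = 0)
    (hρ : ∀ i, constantCoeff (ρ i) = 0) (f : Ser) :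
    comp (comp f π) ρ = comp f (fun i => comp (π i) ρ) := by
  simp only [comp]
  exact MvPowerSeries.subst_comp_subst_apply (hasSubst_of_zero hπ) (hasSubst_of_zero hρ) f

lemma comp_X {π : Triple} (hπ : ∀ i, constantCoeff (π i) = 0) (i : Fin 3) :
    comp (X i) π = π i := by
  rw [comp_eq_substHom hπ, substHom_X]

lemma comp_id (f : Ser) : comp f (fun i => X i) = f := by
  have : (fun i => X i : Triple) = X := rfl
  rw [comp, this, MvPowerSeries.subst_self, id]

/-- Without linear terms, composition gains one order of agreement. -/
lemma le_order_comp_sub_of_coeff_eq_zero {R : Ser}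
    (h1 : ∀ j, coeff (Finsupp.single j 1) R = 0) {π ρ : Triple}
    (hπ : ∀ i, constantCoeff (π i) = 0) (hρ : ∀ i, constantCoeff (ρ i) = 0)
    {n : ℕ∞} (h : ∀ i, n ≤ (π i - ρ i).order) : n + 1 ≤ (comp R π - comp R ρ).order := by
  obtain ⟨g, hg, -, -⟩ := exists_eq_C_add_sum_X_mul R
  have hg0 : ∀ k, constantCoeff (g k) = 0 := fun k => by
    rw [constantCoeff_of_eq_C_add_sum_X_mul hg, h1]
  have e : comp R π - comp R ρ = ∑ i, (π i * (substHom π hπ (g i) -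
      substHom ρ hρ (g i)) + (π i - ρ i) * substHom ρ hρ (g i)) := by
    rw [comp_eq_substHom hπ, comp_eq_substHom hρ, substHom_decomp hπ hg, substHom_decomp hρ hg]
    simp only [Fin.sum_univ_three]
    ring
  rw [e]
  refine le_order_sum fun i _ => le_order_add ?_ ?_
  · rw [add_comm]
    exact le_order_mul_add (one_le_order (hπ i)) (le_order_substHom_sub hπ hρ h _)
  · exact le_order_mul_add (h i) (one_le_order (by rw [constantCoeff_substHom, hg0]))

/-- A convergent perturbation of the identity by terms of order two has a convergent right inverse:
the fixed point of `G ↦ id - R ∘ G`, whose iterates stabilize in each degree and are uniformly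
bounded in a weighted `ℓ¹` norm. -/
lemma exists_right_inverse_of_linearPart_eq_one {H : Triple} (hc : ∀ i, IsConvergent (H i))
    (h0 : ∀ i, constantCoeff (H i) = 0) (h1 : linearPart H = 1) :
    ∃ G : Triple, (∀ i, IsConvergent (G i)) ∧ (∀ i, constantCoeff (G i) = 0) ∧
      ∀ i, comp (H i) G = X i := by
  set R : Triple := fun i => H i - X i with hR
  have hR0 : ∀ i, constantCoeff (R i) = 0 := by intro i; simp [hR, h0]
  have hR1 : ∀ i j, coeff (Finsupp.single j 1) (R i) = 0 := by
    intro i j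
    have := congrFun (congrFun h1 i) j
    simp only [linearPart, Matrix.of_apply] at this
    rw [hR, map_sub, this, Matrix.one_apply, MvPowerSeries.coeff_X]
    simp [Finsupp.single_left_inj, eq_comm]
  have hRc : ∀ i, IsConvergent (R i) := fun i => (hc i).sub (isConvergent_X i)
  obtain ⟨G, hG00, hGs⟩ : ∃ G : ℕ → Triple, (∀ i, G 0 i = 0) ∧
      ∀ k i, G (k + 1) i = X i - comp (R i) (G k) :=
    ⟨fun k => Nat.rec (fun _ => 0) (fun _ F i => X i - comp (R i) F) k, fun _ => rfl,
      fun _ _ => rfl⟩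
  have hG0 : ∀ k i, constantCoeff (G k i) = 0 := by
    intro k
    induction k with
    | zero => intro i; rw [hG00, map_zero]
    | succ k ih => intro i; rw [hGs, map_sub, constantCoeff_comp ih, hR0]; simp
  have hstep : ∀ k i, ((k + 1 : ℕ) : ℕ∞) ≤ (G (k + 1) i - G k i).order := by
    intro k
    induction k with
    | zero =>
      intro i
      exact_mod_cast one_le_order (by rw [map_sub, hG0, hG0, sub_zero])
    | succ k ih =>
      intro i
      have : G (k + 1 + 1) i - G (k + 1) i = -(comp (R i) (G (k + 1)) - comp (R i) (G k)) := by
        rw [hGs (k + 1), hGs k]; ring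
      rw [this, MvPowerSeries.order_neg]
      exact_mod_cast le_order_comp_sub_of_coeff_eq_zero (hR1 i) (hG0 _) (hG0 _) ih
  -- the radius: on a polydisc of radius `s` the perturbation `R` has norm at most `s / 2`
  obtain ⟨s, hs, hsR⟩ : ∃ s : ℝ≥0, 0 < s ∧ ∀ i, nrm s (R i) ≤ (s / 2 : ℝ≥0) := by
    choose g hg hgc _ using fun i => exists_eq_C_add_sum_X_mul (R i)
    have hg0 : ∀ i k, constantCoeff (g i k) = 0 := fun i k => by
      rw [constantCoeff_of_eq_C_add_sum_X_mul (hg i), hR1]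
    choose r hr hrle using fun p : Fin 3 × Fin 3 =>
      exists_nrm_le (hgc p.1 (hRc p.1) p.2) (hg0 p.1 p.2) (show (0 : ℝ≥0) < 1 / 6 by positivity)
    refine ⟨Finset.univ.inf' Finset.univ_nonempty r, by simpa [Finset.lt_inf'_iff] using hr, ?_⟩
    set s := Finset.univ.inf' Finset.univ_nonempty r with hsdef
    intro i
    have e : R i = ∑ k, X k * g i k := by
      conv_lhs => rw [hg i, hR0]
      simp
    have hk : ∀ k, nrm s (X k * g i k) ≤ (s * (1 / 6) : ℝ≥0) := by
      intro k
      refine (nrm_mul_le _ _ _).trans ?_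
      rw [nrm_X, ENNReal.coe_mul]
      gcongr
      exact (nrm_mono (Finset.inf'_le _ (Finset.mem_univ (i, k))) _).trans (hrle (i, k))
    rw [e, Fin.sum_univ_three]
    refine (nrm_add_le _ _ _).trans ((add_le_add ((nrm_add_le _ _ _).trans
      (add_le_add (hk 0) (hk 1))) (hk 2)).trans (le_of_eq ?_))
    norm_cast
    ring
  have hbound : ∀ k i, nrm (s / 2) (G k i) ≤ s := by
    intro k
    induction k with
    | zero => intro i; simp [hG00, nrm]
    | succ k ih =>
      intro i
      rw [hGs, sub_eq_add_neg]
      refine (nrm_add_le _ _ _).trans ?_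
      rw [nrm_neg, nrm_X]
      refine (add_le_add le_rfl ((nrm_comp_le (R i) (hG0 k) ih).trans (hsR i))).trans
        (le_of_eq ?_)
      norm_cast
      exact add_halves s
  have hstab : ∀ (m : Fin 3 →₀ ℕ) (i : Fin 3) (k : ℕ), m.degree ≤ k →
      coeff m (G k i) = coeff m (G m.degree i) := by
    intro m i k hk
    induction k, hk using Nat.le_induction with
    | base => rfl
    | succ k hk ih =>
      rw [← ih, ← sub_eq_zero, ← map_sub]
      exact MvPowerSeries.coeff_of_lt_order (lt_of_lt_of_le (by exact_mod_cast Nat.lt_succ_of_le hk)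
        (hstep k i))
  set F : Triple := fun i m => coeff m (G m.degree i) with hF
  have hFc : ∀ i m, coeff m (F i) = coeff m (G m.degree i) := fun i m => rfl
  have hFG : ∀ (k : ℕ) i, (k : ℕ∞) ≤ (F i - G k i).order := by
    intro k i
    refine MvPowerSeries.nat_le_order fun m hm => ?_
    rw [map_sub, hFc, hstab m i k hm.le, sub_self]
  have hF0 : ∀ i, constantCoeff (F i) = 0 := by
    intro i
    rw [← MvPowerSeries.coeff_zero_eq_constantCoeff_apply, hFc,
      MvPowerSeries.coeff_zero_eq_constantCoeff_apply, hG0]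
  refine ⟨F, fun i => isConvergent_iff.2 ⟨s / 2, by positivity, ?_⟩, hF0, fun i => ?_⟩
  · refine ne_top_of_le_ne_top ENNReal.coe_ne_top (b := s) ?_
    rw [nrm, ENNReal.tsum_eq_iSup_sum]
    refine iSup_le fun t => ?_
    have : ∀ m ∈ t, coeff m (F i) = coeff m (G (t.sup Finsupp.degree) i) := by
      intro m hm
      rw [hFc, hstab m i _ (Finset.le_sup (f := Finsupp.degree) hm)]
    rw [Finset.sum_congr rfl fun m hm => by rw [this m hm]]
    exact (ENNReal.sum_le_tsum t).trans (hbound _ i)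
  · have e : comp (H i) F = F i + comp (R i) F := by
      rw [comp_eq_substHom hF0, comp_eq_substHom hF0, hR, map_sub, substHom_X]; ring
    rw [e, ← sub_eq_zero]
    refine eq_zero_of_forall_le_order fun k => ?_
    have e2 : F i + comp (R i) F - X i = (F i - G (k + 1) i) +
        (comp (R i) F - comp (R i) (G k)) := by
      rw [hGs]; ring
    rw [e2]
    refine le_order_add (le_trans (Nat.cast_le.2 k.le_succ) (hFG (k + 1) i)) ?_
    exact le_self_add.trans (le_order_comp_sub_of_coeff_eq_zero (hR1 i) hF0 (hG0 k) (hFG k))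

lemma exists_right_inverse {H : Triple} (hH : IsBiholomorphism H) :
    ∃ G : Triple, IsBiholomorphism G ∧ ∀ i, comp (H i) G = X i := by
  obtain ⟨hc, h0, hdet⟩ := hH
  set L := linearPart H with hL
  have hLu : IsUnit L.det := isUnit_iff_ne_zero.2 hdet
  have lin : ∀ (M : Matrix (Fin 3) (Fin 3) ℂ) (V : Triple) (i j), coeff (Finsupp.single j 1)
      (∑ k, C (M i k) * V k) = ∑ k, M i k * coeff (Finsupp.single j 1) (V k) := by
    intro M V i j
    rw [map_sum]
    exact Finset.sum_congr rfl fun k _ => MvPowerSeries.coeff_C_mul _ _ _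
  obtain ⟨G, hGc, hG0, hG⟩ := exists_right_inverse_of_linearPart_eq_one
    (H := fun i => ∑ k, C (L⁻¹ i k) * H k)
    (fun i => IsConvergent.sum fun k _ => (isConvergent_C _).mul (hc k))
    (fun i => by simp [h0]) (by
      ext i j
      rw [linearPart, Matrix.of_apply, lin, ← Matrix.nonsing_inv_mul L hLu, Matrix.mul_apply]
      rfl)
  set A : Triple := fun i => ∑ k, C (L⁻¹ i k) * X k with hA
  have hA0 : ∀ i, constantCoeff (A i) = 0 := fun i => by simp [hA]
  have hAc : ∀ i, IsConvergent (A i) :=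
    fun i => IsConvergent.sum fun k _ => (isConvergent_C _).mul (isConvergent_X k)
  have hHG : ∀ i, comp (H i) G = ∑ k, C (L i k) * X k := by
    intro i
    have e : ∀ k, (X k : Ser) = ∑ l, C (L⁻¹ k l) * comp (H l) G := by
      intro k
      rw [← hG k, comp_eq_substHom hG0, map_sum]
      simp_rw [map_mul, substHom_C, comp_eq_substHom hG0]
    simp_rw [e, Finset.mul_sum]
    rw [Finset.sum_comm]
    simp_rw [← mul_assoc, ← map_mul, ← Finset.sum_mul, ← map_sum, ← Matrix.mul_apply,
      Matrix.mul_nonsing_inv L hLu]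
    simp [Matrix.one_apply]
  have hR : ∀ i, comp (H i) (fun i => comp (G i) A) = X i := by
    intro i
    rw [← comp_comp hG0 hA0, hHG, comp_eq_substHom hA0, map_sum]
    simp_rw [map_mul, substHom_C, substHom_X, hA, Finset.mul_sum]
    rw [Finset.sum_comm]
    simp_rw [← mul_assoc, ← map_mul, ← Finset.sum_mul, ← map_sum, ← Matrix.mul_apply,
      Matrix.mul_nonsing_inv L hLu]
    simp [Matrix.one_apply]
  have hGA0 : ∀ i, constantCoeff (comp (G i) A) = 0 := fun i => by rw [constantCoeff_comp hA0, hG0]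
  refine ⟨fun i => comp (G i) A, ⟨fun i => (hGc i).comp hAc hA0, hGA0, ?_⟩, hR⟩
  have h2 := linearPart_comp (π := H) hGA0
  simp_rw [hR] at h2
  have h3 : linearPart (fun i => X i : Triple) = 1 := by
    ext i j
    simp [linearPart, MvPowerSeries.coeff_X, Finsupp.single_left_inj, Matrix.one_apply, eq_comm]
  rw [h3] at h2
  have h4 := congrArg Matrix.det h2
  rw [Matrix.det_mul, Matrix.det_one] at h4
  exact right_ne_zero_of_mul (h4 ▸ one_ne_zero)

lemma exists_inverse {H : Triple} (hH : IsBiholomorphism H) :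
    ∃ G : Triple, IsBiholomorphism G ∧ (∀ i, comp (H i) G = X i) ∧ ∀ i, comp (G i) H = X i := by
  obtain ⟨G, hG, hHG⟩ := exists_right_inverse hH
  obtain ⟨K, hK, hGK⟩ := exists_right_inverse hG
  refine ⟨G, hG, hHG, ?_⟩
  -- `K = (H ∘ G) ∘ K = H ∘ (G ∘ K) = H`
  have : K = H := by
    funext i
    rw [← comp_X hK.2.1 i, ← hHG i, comp_comp hG.2.1 hK.2.1]
    simp_rw [hGK]
    exact comp_id _
  rwa [this] at hGK

/-! ### Divisibility by a coordinate -/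

lemma prime_X (j : Fin 3) : Prime (X j : Ser) := by
  classical
  refine ⟨X_ne_zero j, ?_, ?_⟩
  · intro h
    have h1 : constantCoeff (X j : Ser) ≠ 0 :=
      (h.map (constantCoeff (σ := Fin 3) (R := ℂ))).ne_zero
    simp at h1
  · intro f g hfg
    by_contra! hcon
    -- `f₀`, `g₀` are the restrictions of `f`, `g` to the coordinate plane
    have split : ∀ f : Ser, ∃ f₀ : Ser, (∀ m, m j ≠ 0 → coeff m f₀ = 0) ∧ X j ∣ f - f₀ := by
      intro f
      let f₀ : Ser := fun m => if m j = 0 then coeff m f else 0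
      have h0 : ∀ m, coeff m f₀ = if m j = 0 then coeff m f else 0 := fun m => rfl
      refine ⟨f₀, fun m hm => by simp [h0, hm], MvPowerSeries.X_dvd_iff.2 fun m hm => ?_⟩
      rw [map_sub, h0, if_pos hm, sub_self]
    obtain ⟨f₀, hf, hf'⟩ := split f
    obtain ⟨g₀, hg, hg'⟩ := split g
    have h1 : X j ∣ f₀ * g₀ := by
      have : f₀ * g₀ = f * g - (f - f₀) * g - (g - g₀) * f₀ := by ring
      rw [this]
      exact dvd_sub (dvd_sub hfg (Dvd.dvd.mul_right hf' _)) (Dvd.dvd.mul_right hg' _)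
    have h2 : f₀ * g₀ = 0 := by
      ext m
      rw [(coeff m).map_zero]
      by_cases hm : m j = 0
      · exact MvPowerSeries.X_dvd_iff.1 h1 m hm
      · rw [MvPowerSeries.coeff_mul]
        refine Finset.sum_eq_zero fun p hp => ?_
        have hp' := Finset.HasAntidiagonal.mem_antidiagonal.1 hp
        have : p.1 j + p.2 j ≠ 0 := by rw [← Finsupp.add_apply, hp']; exact hm
        by_cases h3 : p.1 j = 0
        · rw [hg p.2 (by omega), mul_zero]
        · rw [hf p.1 h3, zero_mul]
    rcases mul_eq_zero.1 h2 with h | h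
    · exact hcon.1 (by simpa [h] using hf')
    · exact hcon.2 (by simpa [h] using hg')

lemma not_X_dvd_of_constantCoeff_ne_zero {f : Ser} (j : Fin 3) (h : constantCoeff f ≠ 0) :
    ¬ X j ∣ f := by
  rintro ⟨q, rfl⟩
  simp at h

lemma ne_zero_of_constantCoeff {f : Ser} (h : constantCoeff f ≠ 0) : f ≠ 0 := by
  rintro rfl; simp at h

lemma isConvergent_of_X_pow_mul {j : Fin 3} {q : Ser} {n : ℕ} (h : IsConvergent (X j ^ n * q)) :
    IsConvergent q := by
  induction n with
  | zero => simpa using h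
  | succ n ih =>
    rw [pow_succ', mul_assoc] at h
    exact ih (isConvergent_of_X_mul h)

/-- Let `V`, `W` be proportional vector fields. If a component of `W` is a power of a coordinate, up
to a unit, and this coordinate does not divide another component, then `V` is a multiple of `W`. -/
lemma exists_eq_mul_of_proportional {V W : Triple} {a b k : Ser} {n : ℕ} {i₀ : Fin 3}
    (hV : IsConvergent (V 2)) (hkc : IsConvergent k) (hk : constantCoeff k ≠ 0)
    (hW2 : W 2 = (X 2 * k) ^ n) (hi₀ : ¬ X 2 ∣ W i₀) (ha : a ≠ 0)
    (h : ∀ i, a * V i = b * W i) : ∃ w, IsConvergent w ∧ ∀ i, V i = w * W i := by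
  have hkk : k * k⁻¹ = 1 := MvPowerSeries.mul_inv_cancel _ hk
  have h1 : V i₀ * W 2 = V 2 * W i₀ := by
    apply mul_left_cancel₀ ha
    linear_combination W 2 * h i₀ - W i₀ * h 2
  have h2 : (X 2 : Ser) ^ n ∣ V 2 := by
    refine (prime_X 2).pow_dvd_of_dvd_mul_right n hi₀ ⟨V i₀ * k ^ n, ?_⟩
    rw [← h1, hW2]; ring
  obtain ⟨v, hv⟩ := h2
  have hvc : IsConvergent v := isConvergent_of_X_pow_mul (hv ▸ hV)
  have hw : V 2 = v * k⁻¹ ^ n * W 2 := by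
    rw [hv, hW2, mul_pow]
    calc X 2 ^ n * v = X 2 ^ n * v * (k * k⁻¹) ^ n := by rw [hkk]; ring
      _ = _ := by ring
  have hW0 : W 2 ≠ 0 := by
    rw [hW2]
    exact pow_ne_zero _ (mul_ne_zero (X_ne_zero 2) (ne_zero_of_constantCoeff hk))
  have hb : b = a * (v * k⁻¹ ^ n) := by
    apply mul_right_cancel₀ hW0
    rw [← h 2, hw]; ring
  refine ⟨v * k⁻¹ ^ n, hvc.mul ((hkc.inv hk).pow n), fun i => ?_⟩
  apply mul_left_cancel₀ ha
  rw [h i, hb]; ring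

/-! ### Convergent matrices -/

lemma isConvergent_det {M : Matrix (Fin 3) (Fin 3) Ser} (hM : ∀ i j, IsConvergent (M i j)) :
    IsConvergent M.det := by
  rw [Matrix.det_fin_three]
  refine ((((((hM _ _).mul (hM _ _)).mul (hM _ _)).sub (((hM _ _).mul (hM _ _)).mul (hM _ _))).sub
    (((hM _ _).mul (hM _ _)).mul (hM _ _))).add (((hM _ _).mul (hM _ _)).mul (hM _ _))).add
    (((hM _ _).mul (hM _ _)).mul (hM _ _)) |>.sub (((hM _ _).mul (hM _ _)).mul (hM _ _))

lemma exists_inverse_matrix {M : Matrix (Fin 3) (Fin 3) Ser} (hM : ∀ i j, IsConvergent (M i j))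
    (hdet : constantCoeff M.det ≠ 0) :
    ∃ N : Matrix (Fin 3) (Fin 3) Ser, (∀ i j, IsConvergent (N i j)) ∧ N * M = 1 ∧ M * N = 1 := by
  have hinv : M.det⁻¹ * M.det = 1 := MvPowerSeries.inv_mul_cancel _ hdet
  refine ⟨M.det⁻¹ • M.adjugate, fun i j => ?_, ?_, ?_⟩
  · refine IsConvergent.mul ((isConvergent_det hM).inv hdet) ?_
    rw [Matrix.adjugate_apply]
    refine isConvergent_det fun k l => ?_
    rw [Matrix.updateRow_apply]
    split_ifs
    · rw [Pi.single_apply]; split_ifs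
      exacts [isConvergent_one, isConvergent_zero]
    · exact hM k l
  · rw [Matrix.smul_mul, Matrix.adjugate_mul, smul_smul, hinv, one_smul]
  · rw [Matrix.mul_smul, Matrix.mul_adjugate, smul_smul, hinv, one_smul]

lemma isConvergent_jac {π : Triple} (hπ : ∀ i, IsConvergent (π i)) (i j : Fin 3) :
    IsConvergent (jac π i j) := (hπ i).pderiv j

lemma constantCoeff_det_jac (π : Triple) :
    constantCoeff (jac π).det = (linearPart π).det := by
  rw [linearPart_eq_map_jac, RingHom.map_det]
  rfl

lemma pushTangent_eq (π V : Triple) : pushTangent π V = (jac π).mulVec V := rfl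

lemma isConvergent_mulVec {M : Matrix (Fin 3) (Fin 3) Ser} {V : Triple}
    (hM : ∀ i j, IsConvergent (M i j)) (hV : ∀ i, IsConvergent (V i)) (i : Fin 3) :
    IsConvergent (M.mulVec V i) :=
  IsConvergent.sum fun j _ => (hM i j).mul (hV j)

/-! ### Transport of vector fields along maps -/

lemma pushTangent_comp {π ρ : Triple} (hρ : ∀ i, constantCoeff (ρ i) = 0) (V : Triple) :
    pushTangent (fun i => comp (π i) ρ) V =
      ((jac π).map (substHom ρ hρ)).mulVec (pushTangent ρ V) := by
  rw [pushTangent_eq, jac_comp hρ, ← Matrix.mulVec_mulVec, ← pushTangent_eq]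

lemma comp_pushTangent {π ρ : Triple} (hρ : ∀ i, constantCoeff (ρ i) = 0) (V : Triple) (i : Fin 3) :
    comp (pushTangent π V i) ρ =
      ((jac π).map (substHom ρ hρ)).mulVec (fun k => comp (V k) ρ) i := by
  simp only [pushTangent, comp_eq_substHom hρ, map_sum, map_mul, Matrix.mulVec, dotProduct,
    Matrix.map_apply, jac, Matrix.of_apply]

/-- Proportionality of vector fields along `ρ` and along `π` composes. -/
lemma pushTangent_comp_eq {π ρ X₂ X₁ X₀ : Triple} {a b a' b' : Ser}
    (hπ : ∀ i, constantCoeff (π i) = 0) (hρ : ∀ i, constantCoeff (ρ i) = 0)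
    (h1 : ∀ i, a * pushTangent ρ X₂ i = b * comp (X₁ i) ρ)
    (h0 : ∀ i, a' * pushTangent π X₁ i = b' * comp (X₀ i) π) (i : Fin 3) :
    a * comp a' ρ * pushTangent (fun i => comp (π i) ρ) X₂ i =
      b * comp b' ρ * comp (X₀ i) (fun i => comp (π i) ρ) := by
  rw [pushTangent_comp hρ, ← comp_comp hπ hρ]
  have e1 : (a • pushTangent ρ X₂) = b • fun i => comp (X₁ i) ρ := funext h1
  have e2 := congrArg (fun V => ((jac π).map (substHom ρ hρ)).mulVec V i) e1
  simp only [Matrix.mulVec_smul, Pi.smul_apply, smul_eq_mul] at e2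
  rw [← comp_pushTangent hρ] at e2
  have e3 := congrArg (substHom ρ hρ) (h0 i)
  simp only [map_mul, ← comp_eq_substHom] at e3
  linear_combination comp a' ρ * e2 + b * e3

/-- A vector field which is proportional to `X₀` along `π ∘ ρ` is proportional along `ρ` to the
pull-back `X₁` of `X₀` by `π`. -/
lemma pushTangent_eq_of_comp {π ρ X₂ X₁ X₀ : Triple} {a b : Ser}
    (hπ : ∀ i, constantCoeff (π i) = 0) (hρ : ∀ i, constantCoeff (ρ i) = 0)
    (hdet : comp (jac π).det ρ ≠ 0)
    (h : ∀ i, a * pushTangent (fun i => comp (π i) ρ) X₂ i =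
      b * comp (X₀ i) (fun i => comp (π i) ρ))
    (h0 : ∀ i, pushTangent π X₁ i = comp (X₀ i) π) (i : Fin 3) :
    a * pushTangent ρ X₂ i = b * comp (X₁ i) ρ := by
  have key : ((jac π).map (substHom ρ hρ)).mulVec
      (a • pushTangent ρ X₂ - b • fun k => comp (X₁ k) ρ) = 0 := by
    ext1 j
    rw [Matrix.mulVec_sub, Matrix.mulVec_smul, Matrix.mulVec_smul, ← pushTangent_comp hρ]
    simp only [Pi.sub_apply, Pi.smul_apply, smul_eq_mul, Pi.zero_apply]
    rw [← comp_pushTangent hρ, h j, h0, comp_comp hπ hρ, sub_self]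
  have hd : ((jac π).map (substHom ρ hρ)).det ≠ 0 := by
    rw [comp_eq_substHom hρ] at hdet
    rwa [← AlgHom.mapMatrix_apply, ← AlgHom.map_det]
  exact sub_eq_zero.1 (congrFun (Matrix.eq_zero_of_mulVec_eq_zero hd key) i)

/-! ### Curves -/

lemma compCurve_eq_substHom {φ : Curve} (hφ : φ.Centered) (f : Ser) :
    compCurve f φ = substHom φ hφ f := (substHom_apply hφ f).symm

lemma substHom_X_curve {φ : Curve} (hφ : φ.Centered) (i : Fin 3) : substHom φ hφ (X i) = φ i :=
  substHom_X hφ i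

lemma substHom_C_curve {φ : Curve} (hφ : φ.Centered) (c : ℂ) :
    substHom φ hφ (C c) = PowerSeries.C c :=
  substHom_C hφ c

lemma compCurve_X {φ : Curve} (hφ : φ.Centered) (i : Fin 3) : compCurve (X i) φ = φ i := by
  rw [compCurve_eq_substHom hφ]
  exact substHom_X hφ i

lemma constantCoeff_compCurve {φ : Curve} (hφ : φ.Centered) (f : Ser) :
    PowerSeries.constantCoeff (compCurve f φ) = constantCoeff f := by
  rw [compCurve_eq_substHom hφ]
  exact constantCoeff_substHom hφ f

lemma centered_mapCurve {π : Triple} {φ : Curve} (hφ : φ.Centered)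
    (hπ : ∀ i, constantCoeff (π i) = 0) : (mapCurve π φ).Centered := fun i => by
  rw [mapCurve, constantCoeff_compCurve hφ, hπ]

lemma compCurve_comp {π : Triple} {φ : Curve} (hφ : φ.Centered)
    (hπ : ∀ i, constantCoeff (π i) = 0) (f : Ser) :
    compCurve (comp f π) φ = compCurve f (mapCurve π φ) :=
  MvPowerSeries.subst_comp_subst_apply (hasSubst_of_zero hπ) (hasSubst_of_zero hφ) f

lemma mapCurve_comp {π ρ : Triple} {φ : Curve} (hφ : φ.Centered)
    (hρ : ∀ i, constantCoeff (ρ i) = 0) :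
    mapCurve (fun i => comp (π i) ρ) φ = mapCurve π (mapCurve ρ φ) :=
  funext fun i => compCurve_comp hφ hρ (π i)

lemma mapCurve_id {φ : Curve} (hφ : φ.Centered) : mapCurve (fun i => X i) φ = φ :=
  funext fun i => compCurve_X hφ i

lemma derivative_mapCurve {π : Triple} {φ : Curve} (hφ : φ.Centered) :
    (fun i => PowerSeries.derivative ℂ (mapCurve π φ i)) =
      ((jac π).map (substHom φ hφ)).mulVec fun k => PowerSeries.derivative ℂ (φ k) := by
  funext i
  rw [mapCurve, compCurve_eq_substHom hφ]
  exact pderiv_substHom hφ () (π i)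

lemma compCurve_pushTangent {π : Triple} {φ : Curve} (hφ : φ.Centered) (V : Triple) (i : Fin 3) :
    compCurve (pushTangent π V i) φ =
      ((jac π).map (substHom φ hφ)).mulVec (fun k => compCurve (V k) φ) i := by
  simp only [pushTangent, compCurve_eq_substHom hφ, map_sum, map_mul, Matrix.mulVec, dotProduct,
    Matrix.map_apply, jac, Matrix.of_apply]

lemma coeff_one_eq (f : PowerSeries ℂ) :
    PowerSeries.coeff 1 f = PowerSeries.constantCoeff (PowerSeries.derivative ℂ f) := by
  rw [← PowerSeries.coeff_zero_eq_constantCoeff_apply, PowerSeries.coeff_derivative]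
  simp

lemma coeff_one_mul (f g : PowerSeries ℂ) : PowerSeries.coeff 1 (f * g) =
    PowerSeries.constantCoeff f * PowerSeries.coeff 1 g +
      PowerSeries.constantCoeff g * PowerSeries.coeff 1 f := by
  simp [coeff_one_eq, Derivation.leibniz]

/-- If `g` is the restriction of `X'` to the curve `φ`, and `X'` is proportional to `X₀` along `π`,
then the restriction of `X₀` to the curve `π ∘ φ` is proportional to `g`. -/
lemma compCurve_of_pushTangent {π X' X₀ : Triple} {φ : Curve} (hφ : φ.Centered)
    (hπ : ∀ i, constantCoeff (π i) = 0) {a b : Ser} {g : PowerSeries ℂ}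
    (h : ∀ i, a * pushTangent π X' i = b * comp (X₀ i) π)
    (hg : ∀ i, compCurve (X' i) φ = g * PowerSeries.derivative ℂ (φ i)) (i : Fin 3) :
    compCurve b φ * compCurve (X₀ i) (mapCurve π φ) =
      compCurve a φ * g * PowerSeries.derivative ℂ (mapCurve π φ i) := by
  have e1 := congrArg (substHom φ hφ) (h i)
  simp only [map_mul, ← compCurve_eq_substHom] at e1
  rw [compCurve_pushTangent hφ, compCurve_comp hφ hπ] at e1
  have e2 : (fun k => compCurve (X' k) φ) = g • fun k => PowerSeries.derivative ℂ (φ k) :=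
    funext hg
  rw [e2, Matrix.mulVec_smul, ← derivative_mapCurve hφ] at e1
  rw [← e1]
  simp only [Pi.smul_apply, smul_eq_mul]
  ring

/-- Converse of `compCurve_of_pushTangent`, for maps `π` with non-degenerate Jacobian matrix along
the curve. -/
lemma compCurve_of_mapCurve {π X' X₀ : Triple} {φ : Curve} (hφ : φ.Centered)
    (hπ : ∀ i, constantCoeff (π i) = 0) (hdet : compCurve (jac π).det φ ≠ 0) {b : Ser}
    {g : PowerSeries ℂ} (h : ∀ i, pushTangent π X' i = b * comp (X₀ i) π)
    (hg : ∀ i, compCurve (X₀ i) (mapCurve π φ) = g * PowerSeries.derivative ℂ (mapCurve π φ i))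
    (i : Fin 3) :
    compCurve (X' i) φ = compCurve b φ * g * PowerSeries.derivative ℂ (φ i) := by
  have key : ((jac π).map (substHom φ hφ)).mulVec
      ((fun k => compCurve (X' k) φ) - (compCurve b φ * g) • fun k => PowerSeries.derivative ℂ (φ k))
        = 0 := by
    ext1 j
    rw [Matrix.mulVec_sub, Matrix.mulVec_smul, ← derivative_mapCurve hφ]
    simp only [Pi.sub_apply, Pi.smul_apply, smul_eq_mul, Pi.zero_apply]
    have e := congrArg (substHom φ hφ) (h j)
    simp only [map_mul, ← compCurve_eq_substHom] at e
    rw [← compCurve_pushTangent hφ, e, compCurve_comp hφ hπ, hg]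
    ring
  have hd : ((jac π).map (substHom φ hφ)).det ≠ 0 := by
    rw [compCurve_eq_substHom hφ] at hdet
    rwa [← AlgHom.mapMatrix_apply, ← AlgHom.map_det]
  exact sub_eq_zero.1 (congrFun (Matrix.eq_zero_of_mulVec_eq_zero hd key) i)

lemma order_eq_zero_iff {f : PowerSeries ℂ} :
    f.order = 0 ↔ PowerSeries.constantCoeff f ≠ 0 := by
  rw [← not_iff_not, not_not]
  exact PowerSeries.order_ne_zero_iff_constCoeff_eq_zero

lemma order_eq_one {f : PowerSeries ℂ} (h0 : PowerSeries.constantCoeff f = 0)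
    (h1 : PowerSeries.coeff 1 f ≠ 0) : f.order = 1 := by
  have : f.order = (1 : ℕ) := PowerSeries.order_eq_nat.2 ⟨h1, fun i hi => by
    obtain rfl : i = 0 := by omega
    simpa using h0⟩
  exact_mod_cast this

lemma Curve.IsIrreducible.of_mapCurve {π : Triple} {φ : Curve} (hφ : φ.Centered)
    (h : (mapCurve π φ).IsIrreducible) : φ.IsIrreducible := by
  refine ⟨hφ, fun ψ s hs hψ => h.2 (mapCurve π ψ) s hs fun i => ?_⟩
  have hψ0 : ψ.Centered := fun i => by
    have h1 : PowerSeries.constantCoeff (PowerSeries.subst s (ψ i)) =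
        PowerSeries.constantCoeff (ψ i) := by
      rw [← sub_add_cancel (ψ i) (PowerSeries.C (PowerSeries.constantCoeff (ψ i))),
        PowerSeries.subst_add (PowerSeries.HasSubst.of_constantCoeff_zero' hs), map_add,
        PowerSeries.subst_C]
      have := PowerSeries.constantCoeff_subst_eq_zero (a := s) hs
        (ψ i - PowerSeries.C (PowerSeries.constantCoeff (ψ i))) (by simp)
      simp only [PowerSeries.constantCoeff_eq] at this ⊢
      rw [this]
      simp
    rw [← h1, ← hψ, hφ]
  have hφs : φ = fun i => PowerSeries.subst s (ψ i) := funext hψ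
  rw [mapCurve, mapCurve, compCurve, compCurve, hφs]
  exact (MvPowerSeries.subst_comp_subst_apply (hasSubst_of_zero hψ0)
    (PowerSeries.HasSubst.of_constantCoeff_zero' hs).const (π i)).symm

lemma Curve.IsIrreducible.ne_zero {φ : Curve} (h : φ.IsIrreducible) : ∃ i, φ i ≠ 0 := by
  by_contra! hcon
  refine h.2 φ 0 (by simp) (fun i => ?_) (by simp)
  rw [hcon, PowerSeries.subst_zero_of_constantCoeff_zero (by simp)]

lemma Curve.IsIrreducible.derivative_ne_zero {φ : Curve} (h : φ.IsIrreducible) :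
    ∃ i, PowerSeries.derivative ℂ (φ i) ≠ 0 := by
  obtain ⟨i, hi⟩ := h.ne_zero
  refine ⟨i, fun h0 => hi ?_⟩
  exact PowerSeries.derivative.ext (by rw [h0, map_zero]) (by rw [h.1 i, map_zero])

/-! ### A class of vector fields stable under blow-up -/

/-- The vector field `(y u + z f) ∂x + z g ∂y + z ^ n ∂z`. With `u = 1` it is `normalForm n f g`. -/
def modelField (n : ℕ) (u f g : Ser) : Triple := ![y * u + z * f, z * g, z ^ n]

/-- The conditions on a model field together with an invariant curve `ψ` which is smooth and
transverse to `{z = 0}`. They are kept by blow-ups, whereas the normalization `u = 1` would not be: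
the blow-up of the `x`-axis exchanges the roles of `y u` and of the linear part of `g`. -/
structure IsModel (n : ℕ) (u f g : Ser) (ψ : Curve) : Prop where
  two_le : 2 ≤ n
  conv_u : IsConvergent u
  conv_f : IsConvergent f
  conv_g : IsConvergent g
  unit_u : constantCoeff u ≠ 0
  lin_g : constantCoeff (pderiv ℂ 0 g) ≠ 0
  centered : ψ.Centered
  transverse : PowerSeries.coeff 1 (ψ 2) ≠ 0
  invariant : ∃ h : PowerSeries ℂ, ∀ i,
    compCurve (modelField n u f g i) ψ = h * PowerSeries.derivative ℂ (ψ i)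

lemma z_eq : (z : Ser) = X 2 := rfl

lemma y_eq : (y : Ser) = X 1 := rfl

lemma x_eq : (x : Ser) = X 0 := rfl

lemma order_of_pow_eq {n : ℕ} {s h : PowerSeries ℂ} (h0 : PowerSeries.constantCoeff s = 0)
    (h1 : PowerSeries.coeff 1 s ≠ 0) (h2 : s ^ n = h * PowerSeries.derivative ℂ s) :
    h.order = n := by
  have e := congrArg PowerSeries.order h2
  have h3 : (PowerSeries.derivative ℂ s).order = 0 :=
    order_eq_zero_iff.2 (by rwa [← coeff_one_eq])
  rw [PowerSeries.order_pow, PowerSeries.order_mul, order_eq_one h0 h1, h3, add_zero] at e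
  rw [← e]; simp

namespace IsModel

variable {n : ℕ} {u f g : Ser} {ψ : Curve}

lemma exists_invariant (hM : IsModel n u f g ψ) : ∃ h : PowerSeries ℂ, h.order = n ∧
    ∀ i, compCurve (modelField n u f g i) ψ = h * PowerSeries.derivative ℂ (ψ i) := by
  obtain ⟨h, hh⟩ := hM.invariant
  refine ⟨h, order_of_pow_eq (hM.centered 2) hM.transverse ?_, hh⟩
  rw [← hh 2, compCurve_eq_substHom hM.centered]
  change _ = substHom ψ hM.centered (X 2 ^ n)
  rw [map_pow, substHom_X_curve]

/-- The linear part kills the tangent vector of the invariant curve. -/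
lemma linear_relations (hM : IsModel n u f g ψ) :
    PowerSeries.coeff 1 (ψ 1) * constantCoeff u + PowerSeries.coeff 1 (ψ 2) * constantCoeff f = 0 ∧
      constantCoeff g = 0 := by
  obtain ⟨h, hord, hh⟩ := hM.exists_invariant
  have hn := hM.two_le
  have hc : ∀ i, PowerSeries.coeff 1 (h * PowerSeries.derivative ℂ (ψ i)) = 0 := by
    intro i
    refine PowerSeries.coeff_of_lt_order _ ?_
    rw [PowerSeries.order_mul, hord]
    exact lt_of_lt_of_le (by exact_mod_cast hn) le_self_add
  have e : ∀ (i : Fin 3) (f : Ser), PowerSeries.coeff 1 (compCurve (X i * f) ψ) =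
      PowerSeries.coeff 1 (ψ i) * constantCoeff f := by
    intro i f
    rw [compCurve_eq_substHom hM.centered, map_mul, ← compCurve_eq_substHom,
      ← compCurve_eq_substHom, coeff_one_mul, compCurve_X hM.centered,
      constantCoeff_compCurve hM.centered, hM.centered i]
    ring
  constructor
  · have h0 := hc 0
    rw [← hh 0] at h0
    change PowerSeries.coeff 1 (compCurve (X 1 * u + X 2 * f) ψ) = 0 at h0
    rw [compCurve_eq_substHom hM.centered, map_add, map_add, ← compCurve_eq_substHom,
      ← compCurve_eq_substHom, e, e] at h0
    exact h0
  · have h0 := hc 1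
    rw [← hh 1] at h0
    change PowerSeries.coeff 1 (compCurve (X 2 * g) ψ) = 0 at h0
    rw [e] at h0
    exact (mul_eq_zero.1 h0).resolve_left hM.transverse

lemma isSingularAt (hM : IsModel n u f g ψ) : IsSingularAt (modelField n u f g) := by
  have hn := hM.two_le
  intro i
  fin_cases i
  · simp [modelField, y_eq, z_eq]
  · simp [modelField, z_eq]
  · simp [modelField, z_eq, show n ≠ 0 by omega]

lemma linearPart_eq (hM : IsModel n u f g ψ) : linearPart (modelField n u f g) =
    !![0, constantCoeff u, constantCoeff f; 0, 0, constantCoeff g; 0, 0, 0] := by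
  have hn := hM.two_le
  ext i j
  rw [linearPart, Matrix.of_apply, coeff_single_eq]
  fin_cases i <;> fin_cases j <;>
    simp [modelField, y_eq, z_eq, Derivation.leibniz, Derivation.leibniz_pow,
      MvPowerSeries.pderiv_X_of_ne, show n - 1 ≠ 0 by omega]

end IsModel

lemma linearPart_mul_of_pushTangent {K X₀ Y : Triple} {w : Ser}
    (hK : ∀ i, constantCoeff (K i) = 0) (hX : IsSingularAt X₀) (hY : IsSingularAt Y)
    (h : ∀ i, pushTangent K X₀ i = w * comp (Y i) K) :
    linearPart K * linearPart X₀ = (constantCoeff w • linearPart Y) * linearPart K := by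
  ext i j
  have e := congrArg (fun f => constantCoeff (pderiv ℂ j f)) (h i)
  simp only [pushTangent, map_sum, Derivation.leibniz, smul_eq_mul, map_add, map_mul,
    hX _, hY _, comp_eq_substHom hK, pderiv_substHom hK,
    constantCoeff_substHom, zero_mul, add_zero] at e
  simp only [Matrix.mul_apply, linearPart, Matrix.of_apply, coeff_single_eq, Matrix.smul_apply,
    smul_eq_mul, mul_assoc, ← Finset.mul_sum]
  exact e

lemma isSingularAt_of_pushTangent {K X₀ Y : Triple} {w : Ser}
    (hK : IsBiholomorphism K) (hY : IsSingularAt Y)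
    (h : ∀ i, pushTangent K X₀ i = w * comp (Y i) K) : IsSingularAt X₀ := by
  have key : (linearPart K).mulVec (fun k => constantCoeff (X₀ k)) = 0 := by
    ext1 i
    have e := congrArg constantCoeff (h i)
    simp only [pushTangent, map_sum, map_mul, constantCoeff_comp hK.2.1, hY _, mul_zero] at e
    simp only [Matrix.mulVec, dotProduct, linearPart, Matrix.of_apply, coeff_single_eq,
      Pi.zero_apply]
    exact e
  exact fun i => congrFun (Matrix.eq_zero_of_mulVec_eq_zero hK.2.2 key) i

/-- A foliation and a curve that are, in suitable coordinates, a model field and its invariant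
curve. -/
def IsModelLike (n : ℕ) (X₀ : Triple) (φ : Curve) : Prop :=
  IsFoliation X₀ ∧ φ.Centered ∧ ∃ (u f g w : Ser) (K : Triple),
    IsModel n u f g (mapCurve K φ) ∧ IsBiholomorphism K ∧ IsConvergent w ∧ constantCoeff w ≠ 0 ∧
      ∀ i, pushTangent K X₀ i = w * comp (modelField n u f g i) K

lemma compCurve_ne_zero {φ : Curve} (hφ : φ.Centered) {f : Ser} (hf : constantCoeff f ≠ 0) :
    compCurve f φ ≠ 0 := by
  intro h
  have := constantCoeff_compCurve hφ f
  rw [h, map_zero] at this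
  exact hf this.symm

lemma comp_ne_zero {π : Triple} (hπ : ∀ i, constantCoeff (π i) = 0) {f : Ser}
    (hf : constantCoeff f ≠ 0) : comp f π ≠ 0 :=
  ne_zero_of_constantCoeff (by rwa [constantCoeff_comp hπ])

lemma IsModelLike.isNilpotentSingularity {n : ℕ} {X₀ : Triple} {φ : Curve}
    (h : IsModelLike n X₀ φ) : IsNilpotentSingularity X₀ := by
  obtain ⟨-, hφ, u, f, g, w, K, hM, hK, hwc, hw, hrel⟩ := h
  have hX := isSingularAt_of_pushTangent hK hM.isSingularAt hrel
  have hL := linearPart_mul_of_pushTangent hK.2.1 hX hM.isSingularAt hrel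
  have hKu : IsUnit (linearPart K) :=
    (Matrix.isUnit_iff_isUnit_det _).2 (isUnit_iff_ne_zero.2 hK.2.2)
  have hLY := hM.linearPart_eq
  refine ⟨hX, fun h0 => ?_, 3, ?_⟩
  · rw [h0, mul_zero] at hL
    have h1 := hKu.mul_left_eq_zero.1 hL.symm
    have h2 := congrFun (congrFun h1 0) 1
    rw [hLY] at h2
    simp [hw, hM.unit_u] at h2
  · have h1 : SemiconjBy (linearPart K) (linearPart X₀)
      (constantCoeff w • linearPart (modelField n u f g)) := hL
    have h2 := h1.pow_right 3
    have h3 : (constantCoeff w • linearPart (modelField n u f g)) ^ 3 = 0 := by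
      rw [smul_pow, hLY]
      have : (!![0, constantCoeff u, constantCoeff f; 0, 0, constantCoeff g; 0, 0, 0] :
          Matrix (Fin 3) (Fin 3) ℂ) ^ 3 = 0 := by
        ext i j
        fin_cases i <;> fin_cases j <;>
          simp [pow_succ, Matrix.mul_apply, Fin.sum_univ_three]
      rw [this, smul_zero]
    rw [SemiconjBy, h3, zero_mul] at h2
    exact hKu.mul_right_eq_zero.1 h2

lemma IsModelLike.hasMultiplicity {n : ℕ} {X₀ : Triple} {φ : Curve} (h : IsModelLike n X₀ φ) :
    HasMultiplicity X₀ φ n := by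
  obtain ⟨-, hφ, u, f, g, w, K, hM, hK, hwc, hw, hrel⟩ := h
  obtain ⟨h, hord, hh⟩ := hM.exists_invariant
  refine ⟨compCurve w φ * h, compCurve_of_mapCurve hφ hK.2.1 ?_ hrel hh, ?_⟩
  · exact compCurve_ne_zero hφ (by rw [constantCoeff_det_jac]; exact hK.2.2)
  · rw [PowerSeries.order_mul, hord, order_eq_zero_iff.2, zero_add]
    rwa [constantCoeff_compCurve hφ]

/-- The step common to both kinds of blow-up. The map `π` is a chart of the blow-up of the foliation
`X₀`, the map `σ` a chart of the blow-up of the model field, and `K'` a lift of `K` to these charts;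
`modelField n u' f' g'` is the transform of the model. -/
lemma IsModelLike.of_lift {n : ℕ} {X₀ X' : Triple} {φ' : Curve} {π σ K K' : Triple} {k c : Ser}
    {e : ℕ} {u f g w u' f' g' : Ser}
    (hM : IsModel n u f g (mapCurve K (mapCurve π φ')))
    (hK : IsBiholomorphism K)
    (hrel : ∀ i, pushTangent K X₀ i = w * comp (modelField n u f g i) K)
    (hπ0 : ∀ i, constantCoeff (π i) = 0)
    (hπdet : (jac π).det = c * X 2 ^ e) (hc : constantCoeff c ≠ 0)
    (hT : IsTransform π X₀ X') (hφ' : φ'.Centered)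
    (hσ0 : ∀ i, constantCoeff (σ i) = 0) {c' : Ser} (hc' : constantCoeff c' ≠ 0)
    (hσdet : (jac σ).det = c' * X 2 ^ e) (hσ2 : σ 2 = X 2)
    (hK'c : ∀ i, IsConvergent (K' i)) (hK'0 : ∀ i, constantCoeff (K' i) = 0)
    (hk : constantCoeff k ≠ 0) (hkc : IsConvergent k) (hK'2 : K' 2 = X 2 * k)
    (hlift : ∀ i, comp (K i) π = comp (σ i) K')
    (hu' : IsConvergent u') (hf' : IsConvergent f') (hg' : IsConvergent g')
    (hu'0 : constantCoeff u' ≠ 0) (hg'0 : constantCoeff (pderiv ℂ 0 g') ≠ 0)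
    (hY : ∀ i, pushTangent σ (modelField n u' f' g') i = comp (modelField n u f g i) σ) :
    IsModelLike n X' φ' := by
  obtain ⟨hX', a, b, hac, hbc, ha, hb, hab⟩ := hT
  have hn := hM.two_le
  have hfun : (fun i => comp (K i) π) = fun i => comp (σ i) K' := funext hlift
  -- the lift is a biholomorphism: compare the determinants of the Jacobian matrices
  have hK' : IsBiholomorphism K' := by
    refine ⟨hK'c, hK'0, ?_⟩
    have e1 := congrArg Matrix.det (congrArg jac hfun)
    rw [jac_comp hπ0, jac_comp hK'0, Matrix.det_mul, Matrix.det_mul, ← AlgHom.mapMatrix_apply,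
      ← AlgHom.map_det, ← AlgHom.mapMatrix_apply, ← AlgHom.map_det, hπdet, hσdet, map_mul, map_pow,
      substHom_X, hK'2] at e1
    have e2 : substHom π hπ0 (jac K).det * c = substHom K' hK'0 c' * k ^ e * (jac K').det := by
      apply mul_right_cancel₀ (pow_ne_zero e (X_ne_zero 2))
      linear_combination e1
    have e3 := congrArg constantCoeff e2
    rw [map_mul, constantCoeff_substHom, constantCoeff_det_jac, map_mul,
      constantCoeff_det_jac] at e3
    intro h0
    rw [h0, mul_zero] at e3
    exact mul_ne_zero hK.2.2 hc e3
  have hK'u : IsUnit (linearPart K').det := isUnit_iff_ne_zero.2 hK'.2.2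
  set Y := modelField n u f g with hYdef
  set Y' := modelField n u' f' g' with hY'def
  have hrel2 : ∀ i, (a * comp 1 π) * pushTangent (fun i => comp (K i) π) X' i =
      (b * comp w π) * comp (Y i) (fun i => comp (K i) π) :=
    pushTangent_comp_eq hK.2.1 hπ0 hab (by simpa using hrel)
  have h1π : comp 1 π = 1 := by rw [comp_eq_substHom hπ0, map_one]
  rw [hfun, h1π, mul_one] at hrel2
  have hdet : comp (jac σ).det K' ≠ 0 := by
    rw [hσdet, comp_eq_substHom hK'0, map_mul, map_pow, substHom_X, hK'2, ← comp_eq_substHom]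
    exact mul_ne_zero (comp_ne_zero hK'0 hc')
      (pow_ne_zero _ (mul_ne_zero (X_ne_zero 2) (ne_zero_of_constantCoeff hk)))
  have hrel3 := pushTangent_eq_of_comp hσ0 hK'0 hdet hrel2 hY
  have hY'c : ∀ i, IsConvergent (Y' i) := by
    intro i
    fin_cases i
    · exact ((isConvergent_X 1).mul hu').add ((isConvergent_X 2).mul hf')
    · exact (isConvergent_X 2).mul hg'
    · exact (isConvergent_X 2).pow n
  have hY'Kc : ∀ i, IsConvergent (comp (Y' i) K') := fun i => (hY'c i).comp hK'c hK'0
  -- the exceptional divisor is not contained in the singular set of the transform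
  have hnd : ¬ X 2 ∣ comp (Y' 0) K' := by
    intro hd
    have e1 : comp (Y' 0) K' = K' 1 * comp u' K' + X 2 * (k * comp f' K') := by
      change comp (X 1 * u' + X 2 * f') K' = _
      rw [comp_eq_substHom hK'0, map_add, map_mul, map_mul, substHom_X, substHom_X, hK'2,
        comp_eq_substHom hK'0, comp_eq_substHom hK'0]
      ring
    rw [e1] at hd
    have h2 : X 2 ∣ K' 1 := ((prime_X 2).dvd_or_dvd ((dvd_add_left ⟨_, rfl⟩).1 hd)).resolve_right
      (not_X_dvd_of_constantCoeff_ne_zero 2 (by rwa [constantCoeff_comp hK'0]))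
    obtain ⟨q, hq⟩ := h2
    apply hK'.2.2
    rw [Matrix.det_fin_three]
    simp only [linearPart, Matrix.of_apply, coeff_single_eq, hq, hK'2, Derivation.leibniz]
    simp [MvPowerSeries.pderiv_X_of_ne]
  obtain ⟨w', hw'c, hw'⟩ := exists_eq_mul_of_proportional (n := n) (k := k)
    (isConvergent_mulVec (isConvergent_jac hK'c) hX'.1 2) hkc hk (by
      change comp (X 2 ^ n) K' = _
      rw [comp_eq_substHom hK'0, map_pow, substHom_X, hK'2]) hnd ha hrel3
  have hw'0 : constantCoeff w' ≠ 0 := by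
    refine hX'.2 w' hw'c fun i => ?_
    obtain ⟨N, hNc, hN, -⟩ := exists_inverse_matrix (isConvergent_jac hK'c)
      (by rw [constantCoeff_det_jac]; exact hK'.2.2)
    refine ⟨N.mulVec (fun i => comp (Y' i) K') i, isConvergent_mulVec hNc hY'Kc i, ?_⟩
    have e1 : (jac K').mulVec X' = w' • fun i => comp (Y' i) K' := funext hw'
    have e2 := congrArg N.mulVec e1
    rw [Matrix.mulVec_mulVec, hN, Matrix.one_mulVec, Matrix.mulVec_smul] at e2
    exact congrFun e2 i
  have hψ0 : (mapCurve K' φ').Centered := centered_mapCurve hφ' hK'0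
  have hψ : mapCurve K (mapCurve π φ') = mapCurve σ (mapCurve K' φ') := by
    rw [← mapCurve_comp hφ' hπ0, hfun, mapCurve_comp hφ' hK'0]
  have hψ2 : mapCurve K (mapCurve π φ') 2 = mapCurve K' φ' 2 := by
    rw [hψ]
    change compCurve (σ 2) _ = _
    rw [hσ2, compCurve_X hψ0]
  have htrans := hM.transverse
  rw [hψ2] at htrans
  refine ⟨hX', hφ', u', f', g', w', K', ⟨hn, hu', hf', hg', hu'0, hg'0, hψ0, htrans, ?_⟩, hK',
    hw'c, hw'0, hw'⟩
  obtain ⟨h, hh⟩ := hM.invariant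
  rw [hψ] at hh
  refine ⟨compCurve 1 (mapCurve K' φ') * h, compCurve_of_mapCurve hψ0 hσ0 ?_ (b := 1)
    (by simpa using hY) hh⟩
  rw [hσdet, compCurve_eq_substHom hψ0, map_mul, map_pow, ← compCurve_eq_substHom,
    ← compCurve_eq_substHom, compCurve_X hψ0]
  refine mul_ne_zero (compCurve_ne_zero hψ0 hc') (pow_ne_zero _ fun h0 => htrans ?_)
  rw [h0, map_zero]

/-! ### Charts of blow-ups -/

lemma coeff_compCurve_single (j : Fin 3) (f : Ser) (k : ℕ) :
    PowerSeries.coeff k (compCurve f (Pi.single j PowerSeries.X)) =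
      coeff (Finsupp.single j k) f := by
  have hc : Curve.Centered (Pi.single j PowerSeries.X) := by
    intro i; rw [Pi.single_apply]; split_ifs <;> simp
  induction k generalizing f with
  | zero => simpa using constantCoeff_compCurve hc f
  | succ k ih =>
    obtain ⟨g, hg, -, -⟩ := exists_eq_C_add_sum_X_mul f
    have e1 : compCurve f (Pi.single j PowerSeries.X) =
        PowerSeries.C (constantCoeff f) + PowerSeries.X * compCurve (g j)
          (Pi.single j PowerSeries.X) := by
      rw [compCurve_eq_substHom hc, compCurve_eq_substHom hc, substHom_decomp hc hg,
        Finset.sum_eq_single j]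
      · rw [Pi.single_eq_same]; rfl
      · intro i _ hij; rw [Pi.single_eq_of_ne hij, zero_mul]
      · simp
    have e2 : coeff (Finsupp.single j (k + 1)) f = coeff (Finsupp.single j k) (g j) := by
      conv_lhs => rw [hg]
      rw [map_add, map_sum, Finset.sum_eq_single j]
      · rw [MvPowerSeries.coeff_C, if_neg (by simp), zero_add, add_comm k, Finsupp.single_add,
          MvPowerSeries.X, MvPowerSeries.coeff_add_monomial_mul, one_mul]
      · intro i _ hij
        refine MvPowerSeries.X_dvd_iff.1 ⟨g i, rfl⟩ _ ?_
        rw [Finsupp.single_eq_of_ne hij]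
      · simp
    rw [e1, e2, map_add, PowerSeries.coeff_succ_X_mul, ih, PowerSeries.coeff_C]
    simp

lemma pointChart_centered (i : Fin 3) : constantCoeff (pointChart i) = 0 := by
  fin_cases i <;> simp [pointChart, z_eq]

lemma curveChart_centered (i : Fin 3) : constantCoeff (curveChart i) = 0 := by
  fin_cases i <;> simp [curveChart, z_eq, x_eq]

lemma isConvergent_pointChart (i : Fin 3) : IsConvergent (pointChart i) := by
  fin_cases i
  · exact (isConvergent_X 0).mul (isConvergent_X 2)
  · exact (isConvergent_X 1).mul (isConvergent_X 2)
  · exact isConvergent_X 2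

lemma isConvergent_curveChart (i : Fin 3) : IsConvergent (curveChart i) := by
  fin_cases i
  · exact isConvergent_X 0
  · exact (isConvergent_X 1).mul (isConvergent_X 2)
  · exact isConvergent_X 2

lemma det_jac_pointChart : (jac pointChart).det = X 2 ^ 2 := by
  rw [Matrix.det_fin_three]
  simp [jac, pointChart, x_eq, y_eq, z_eq, Derivation.leibniz, MvPowerSeries.pderiv_X_of_ne]
  ring

lemma det_jac_curveChart : (jac curveChart).det = X 2 ^ 1 := by
  rw [Matrix.det_fin_three]
  simp [jac, curveChart, x_eq, y_eq, z_eq, Derivation.leibniz, MvPowerSeries.pderiv_X_of_ne]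

/-- A chart of the blow-up of the origin, centered at the point of the exceptional divisor that
corresponds to the direction `(a, b, 1)`. -/
def pointChartAt (a b : ℂ) : Triple := ![(X 0 + C a) * X 2, (X 1 + C b) * X 2, X 2]

/-- A chart of the blow-up of `{y = z = 0}`, centered at the point of the exceptional divisor over
the origin that corresponds to the direction `(0, b, 1)`. The first two coordinates are exchanged. -/
def curveChartAt (b : ℂ) : Triple := ![X 1, (X 0 + C b) * X 2, X 2]

lemma pointChartAt_centered (a b : ℂ) (i : Fin 3) : constantCoeff (pointChartAt a b i) = 0 := by
  fin_cases i <;> simp [pointChartAt]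

lemma curveChartAt_centered (b : ℂ) (i : Fin 3) : constantCoeff (curveChartAt b i) = 0 := by
  fin_cases i <;> simp [curveChartAt]

lemma isConvergent_pointChartAt (a b : ℂ) (i : Fin 3) : IsConvergent (pointChartAt a b i) := by
  fin_cases i
  · exact ((isConvergent_X 0).add (isConvergent_C a)).mul (isConvergent_X 2)
  · exact ((isConvergent_X 1).add (isConvergent_C b)).mul (isConvergent_X 2)
  · exact isConvergent_X 2

lemma isConvergent_curveChartAt (b : ℂ) (i : Fin 3) : IsConvergent (curveChartAt b i) := by
  fin_cases i
  · exact isConvergent_X 1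
  · exact ((isConvergent_X 0).add (isConvergent_C b)).mul (isConvergent_X 2)
  · exact isConvergent_X 2

lemma det_jac_pointChartAt (a b : ℂ) : (jac (pointChartAt a b)).det = X 2 ^ 2 := by
  rw [Matrix.det_fin_three]
  simp [jac, pointChartAt, Derivation.leibniz, MvPowerSeries.pderiv_X_of_ne]
  ring

lemma det_jac_curveChartAt (b : ℂ) : (jac (curveChartAt b)).det = C (-1) * X 2 ^ 1 := by
  rw [Matrix.det_fin_three]
  simp [jac, curveChartAt, Derivation.leibniz, MvPowerSeries.pderiv_X_of_ne]

lemma constantCoeff_pderiv_comp {π : Triple} (hπ : ∀ i, constantCoeff (π i) = 0) {j : Fin 3} 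
    (h : ∀ k, constantCoeff (pderiv ℂ j (π k)) = 0) (f : Ser) :
    constantCoeff (pderiv ℂ j (comp f π)) = 0 := by
  rw [comp_eq_substHom hπ, pderiv_substHom hπ, map_sum]
  refine Finset.sum_eq_zero fun k _ => ?_
  rw [map_mul, h, mul_zero]

lemma constantCoeff_pderiv_pointChartAt (a b : ℂ) (k : Fin 3) :
    constantCoeff (pderiv ℂ 0 (pointChartAt a b k)) = 0 := by
  fin_cases k <;> simp [pointChartAt, Derivation.leibniz, MvPowerSeries.pderiv_X_of_ne]

lemma constantCoeff_pderiv_curveChartAt (b : ℂ) (k : Fin 3) :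
    constantCoeff (pderiv ℂ 0 (curveChartAt b k)) = 0 := by
  fin_cases k <;> simp [curveChartAt, Derivation.leibniz, MvPowerSeries.pderiv_X_of_ne]

/-- The pull-back of a series without constant term is divisible by the equation of the exceptional
divisor. -/
lemma exists_comp_pointChart {f : Ser} (hf : IsConvergent f) (h0 : constantCoeff f = 0) :
    ∃ k, IsConvergent k ∧ comp f pointChart = X 2 * k := by
  obtain ⟨g, hg, hgc, -⟩ := exists_eq_C_add_sum_X_mul f
  have e : comp f pointChart = X 2 * (X 0 * comp (g 0) pointChart + X 1 * comp (g 1) pointChart +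
      comp (g 2) pointChart) := by
    rw [comp_eq_substHom pointChart_centered, substHom_decomp _ hg, h0, Fin.sum_univ_three]
    simp only [← comp_eq_substHom]
    simp [pointChart, x_eq, y_eq, z_eq]
    ring
  refine ⟨_, isConvergent_of_X_mul (j := 2) ?_, e⟩
  rw [← e]
  exact hf.comp isConvergent_pointChart pointChart_centered

/-- The pull-back of a series that vanishes on the center `{y = z = 0}` is divisible by the equation
of the exceptional divisor. -/
lemma exists_comp_curveChart {f : Ser} (hf : IsConvergent f)
    (h0 : compCurve f ![PowerSeries.X, 0, 0] = 0) :
    ∃ k, IsConvergent k ∧ comp f curveChart = X 2 * k := by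
  obtain ⟨g, hg, hgc, hg0⟩ := exists_eq_C_add_sum_X_mul f
  have hax : (![PowerSeries.X, 0, 0] : Curve) = (Pi.single 0 PowerSeries.X : Curve) := by
    funext i; fin_cases i <;> simp
  have hcoef : ∀ k, coeff (Finsupp.single 0 k) f = 0 := by
    intro k
    rw [← coeff_compCurve_single, ← hax, h0, map_zero]
  have hg00 := hg0 hcoef
  have hf0 : constantCoeff f = 0 := by simpa using hcoef 0
  have e : comp f curveChart = X 2 * (X 1 * comp (g 1) curveChart + comp (g 2) curveChart) := by
    rw [comp_eq_substHom curveChart_centered, substHom_decomp _ hg, hf0, Fin.sum_univ_three,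
      hg00]
    simp only [map_zero]
    simp only [← comp_eq_substHom]
    simp [curveChart, x_eq, y_eq, z_eq]
    ring
  refine ⟨_, isConvergent_of_X_mul (j := 2) ?_, e⟩
  rw [← e]
  exact hf.comp isConvergent_curveChart curveChart_centered

/-! ### Stability under blow-ups -/

lemma comp_modelField {n : ℕ} {u f g : Ser} {σ : Triple} (hσ : ∀ i, constantCoeff (σ i) = 0) :
    (fun i => comp (modelField n u f g i) σ) =
      ![σ 1 * comp u σ + σ 2 * comp f σ, σ 2 * comp g σ, σ 2 ^ n] := by
  funext i
  fin_cases i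
  · change comp (X 1 * u + X 2 * f) σ = _
    rw [comp_eq_substHom hσ, map_add, map_mul, map_mul, substHom_X, substHom_X]
    simp only [← comp_eq_substHom]
    rfl
  · change comp (X 2 * g) σ = _
    rw [comp_eq_substHom hσ, map_mul, substHom_X]
    simp only [← comp_eq_substHom]
    rfl
  · change comp (X 2 ^ n) σ = _
    rw [comp_eq_substHom hσ, map_pow, substHom_X]
    rfl

lemma pushTangent_pointChartAt (a b : ℂ) (A B D : Ser) :
    pushTangent (pointChartAt a b) ![A, B, D] =
      ![X 2 * A + (X 0 + C a) * D, X 2 * B + (X 1 + C b) * D, D] := by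
  funext i
  fin_cases i <;>
    simp [pushTangent, Fin.sum_univ_three, pointChartAt, Derivation.leibniz,
      MvPowerSeries.pderiv_X_of_ne]

lemma pushTangent_curveChartAt (b : ℂ) (A B D : Ser) :
    pushTangent (curveChartAt b) ![A, B, D] = ![B, X 2 * A + (X 0 + C b) * D, D] := by
  funext i
  fin_cases i <;>
    simp [pushTangent, Fin.sum_univ_three, curveChartAt, Derivation.leibniz,
      MvPowerSeries.pderiv_X_of_ne]

/-- The transform of a model field by the blow-up of the origin. -/
lemma IsModel.exists_pointTransform {n : ℕ} {u f g : Ser} {ψ : Curve} (hM : IsModel n u f g ψ)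
    (a : ℂ) {b : ℂ} (hb : PowerSeries.coeff 1 (ψ 1) = b * PowerSeries.coeff 1 (ψ 2)) :
    ∃ u' f' g', IsConvergent u' ∧ IsConvergent f' ∧ IsConvergent g' ∧ constantCoeff u' ≠ 0 ∧
      constantCoeff (pderiv ℂ 0 g') ≠ 0 ∧
      ∀ i, pushTangent (pointChartAt a b) (modelField n u' f' g') i =
        comp (modelField n u f g i) (pointChartAt a b) := by
  obtain ⟨m, rfl⟩ : ∃ m, n = m + 2 := ⟨n - 2, by have := hM.two_le; omega⟩
  obtain ⟨hf0, hg0⟩ := hM.linear_relations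
  obtain ⟨σ, hσ⟩ : ∃ σ, σ = pointChartAt a b := ⟨_, rfl⟩
  have hσ0 : ∀ i, constantCoeff (σ i) = 0 := hσ ▸ pointChartAt_centered a b
  have hσc : ∀ i, IsConvergent (σ i) := hσ ▸ isConvergent_pointChartAt a b
  have hs0 : σ 0 = (X 0 + C a) * X 2 := by rw [hσ]; rfl
  have hs1 : σ 1 = (X 1 + C b) * X 2 := by rw [hσ]; rfl
  have hs2 : σ 2 = X 2 := by rw [hσ]; rfl
  -- `W = b u + f` vanishes at the origin, because the curve is invariant
  have hW0 : constantCoeff (C b * u + f) = 0 := by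
    rw [hb] at hf0
    have : PowerSeries.coeff 1 (ψ 2) * (b * constantCoeff u + constantCoeff f) = 0 := by
      linear_combination hf0
    simpa using (mul_eq_zero.1 this).resolve_left hM.transverse
  have hWc : IsConvergent (C b * u + f) := ((isConvergent_C b).mul hM.conv_u).add hM.conv_f
  obtain ⟨W, hW, hWc', -⟩ := exists_eq_C_add_sum_X_mul (C b * u + f)
  obtain ⟨G, hG, hGc, -⟩ := exists_eq_C_add_sum_X_mul g
  have hXa := (isConvergent_X 0).add (isConvergent_C a)
  have hXb := (isConvergent_X 1).add (isConvergent_C b)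
  have hcσ : ∀ {q : Ser}, IsConvergent q → IsConvergent (comp q σ) := fun h => h.comp hσc hσ0
  refine ⟨comp u σ, ((X 0 + C a) * comp (W 0) σ + (X 1 + C b) * comp (W 1) σ + comp (W 2) σ) -
    (X 0 + C a) * X 2 ^ m, ((X 0 + C a) * comp (G 0) σ + (X 1 + C b) * comp (G 1) σ +
    comp (G 2) σ) - (X 1 + C b) * X 2 ^ m, hcσ hM.conv_u,
    (((hXa.mul (hcσ (hWc' hWc 0))).add (hXb.mul (hcσ (hWc' hWc 1)))).add (hcσ (hWc' hWc 2))).sub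
      (hXa.mul ((isConvergent_X 2).pow m)),
    (((hXa.mul (hcσ (hGc hM.conv_g 0))).add (hXb.mul (hcσ (hGc hM.conv_g 1)))).add
      (hcσ (hGc hM.conv_g 2))).sub (hXb.mul ((isConvergent_X 2).pow m)),
    by rw [constantCoeff_comp hσ0]; exact hM.unit_u, ?_, ?_⟩
  · have hd := constantCoeff_pderiv_comp hσ0 (hσ ▸ constantCoeff_pderiv_pointChartAt a b)
    have := hM.lin_g
    rw [← coeff_single_eq, ← constantCoeff_of_eq_C_add_sum_X_mul hG] at this
    simpa [MvPowerSeries.pderiv_X_of_ne, constantCoeff_comp hσ0, hd, Derivation.leibniz,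
      Derivation.leibniz_pow] using this
  · have eW := substHom_decomp hσ0 hW
    have eG := substHom_decomp hσ0 hG
    rw [hW0] at eW
    rw [hg0] at eG
    simp only [Fin.sum_univ_three, map_add, map_mul, substHom_C, ← comp_eq_substHom, map_zero, hs0,
      hs1, hs2] at eW eG
    refine congrFun ?_
    rw [← hσ, comp_modelField hσ0, hs1, hs2, modelField, hσ, pushTangent_pointChartAt, ← hσ,
      y_eq, z_eq]
    congr 1
    · linear_combination (-X 2) * eW
    congr 1
    linear_combination (-X 2) * eG

/-- The transform of a model field by the blow-up of its singular set. -/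
lemma IsModel.exists_curveTransform {n : ℕ} {u f g : Ser} {ψ : Curve} (hM : IsModel n u f g ψ)
    (b : ℂ) : ∃ u' f' g', IsConvergent u' ∧ IsConvergent f' ∧ IsConvergent g' ∧
      constantCoeff u' ≠ 0 ∧ constantCoeff (pderiv ℂ 0 g') ≠ 0 ∧
      ∀ i, pushTangent (curveChartAt b) (modelField n u' f' g') i =
        comp (modelField n u f g i) (curveChartAt b) := by
  obtain ⟨m, rfl⟩ : ∃ m, n = m + 2 := ⟨n - 2, by have := hM.two_le; omega⟩
  obtain ⟨-, hg0⟩ := hM.linear_relations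
  obtain ⟨σ, hσ⟩ : ∃ σ, σ = curveChartAt b := ⟨_, rfl⟩
  have hσ0 : ∀ i, constantCoeff (σ i) = 0 := hσ ▸ curveChartAt_centered b
  have hσc : ∀ i, IsConvergent (σ i) := hσ ▸ isConvergent_curveChartAt b
  have hs0 : σ 0 = X 1 := by rw [hσ]; rfl
  have hs1 : σ 1 = (X 0 + C b) * X 2 := by rw [hσ]; rfl
  have hs2 : σ 2 = X 2 := by rw [hσ]; rfl
  obtain ⟨G, hG, hGc, -⟩ := exists_eq_C_add_sum_X_mul g
  have hXb := (isConvergent_X 0).add (isConvergent_C b)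
  have hcσ : ∀ {q : Ser}, IsConvergent q → IsConvergent (comp q σ) := fun h => h.comp hσc hσ0
  refine ⟨comp (G 0) σ, (X 0 + C b) * comp (G 1) σ + comp (G 2) σ - (X 0 + C b) * X 2 ^ m,
    (X 0 + C b) * comp u σ + comp f σ, hcσ (hGc hM.conv_g 0),
    ((hXb.mul (hcσ (hGc hM.conv_g 1))).add (hcσ (hGc hM.conv_g 2))).sub
      (hXb.mul ((isConvergent_X 2).pow m)),
    (hXb.mul (hcσ hM.conv_u)).add (hcσ hM.conv_f), ?_, ?_, ?_⟩
  · rw [constantCoeff_comp hσ0, constantCoeff_of_eq_C_add_sum_X_mul hG, coeff_single_eq]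
    exact hM.lin_g
  · have hd := constantCoeff_pderiv_comp hσ0 (hσ ▸ constantCoeff_pderiv_curveChartAt b)
    simpa [constantCoeff_comp hσ0, hd, Derivation.leibniz] using hM.unit_u
  · have eG := substHom_decomp hσ0 hG
    rw [hg0] at eG
    simp only [Fin.sum_univ_three, ← comp_eq_substHom, map_zero, hs0, hs1, hs2] at eG
    refine congrFun ?_
    rw [← hσ, comp_modelField hσ0, hs1, hs2, modelField, hσ, pushTangent_curveChartAt, ← hσ,
      y_eq, z_eq]
    congr 1
    · ring
    congr 1
    linear_combination (-X 2) * eG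

lemma coeff_one_compCurve_X_mul {φ : Curve} (hφ : φ.Centered) (i : Fin 3) (k : Ser) :
    PowerSeries.coeff 1 (compCurve (X i * k) φ) =
      constantCoeff k * PowerSeries.coeff 1 (φ i) := by
  rw [compCurve_eq_substHom hφ, map_mul, ← compCurve_eq_substHom,
    ← compCurve_eq_substHom, coeff_one_mul, compCurve_X hφ, constantCoeff_compCurve hφ, hφ i]
  ring

lemma IsModelLike.of_pointBlowup {n : ℕ} {X₀ X' : Triple} {φ φ' : Curve}
    (h : IsModelLike n X₀ φ) (hB : PointBlowup (X₀, φ) (X', φ')) : IsModelLike n X' φ' := by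
  obtain ⟨-, hφ, u, f, g, w, K, hM, hK, hwc, hw, hrel⟩ := h
  obtain ⟨-, H, hH, hT, hφ', hφφ'⟩ := hB
  simp only at hT hφ' hφφ'
  have hpc := pointChart_centered
  have hπ0 : ∀ i, constantCoeff (comp (H i) pointChart) = 0 :=
    fun i => by rw [constantCoeff_comp hpc, hH.2.1]
  -- the map `K` in the coordinates `H`, and its components divided by the exceptional divisor
  set G : Triple := fun i => comp (K i) H with hG
  have hGc : ∀ i, IsConvergent (G i) := fun i => (hK.1 i).comp hH.1 hH.2.1
  have hG0 : ∀ i, constantCoeff (G i) = 0 := fun i => by rw [hG, constantCoeff_comp hH.2.1, hK.2.1]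
  choose k hkc hk using fun i => exists_comp_pointChart (hGc i) (hG0 i)
  have hKG : ∀ i, comp (K i) (fun i => comp (H i) pointChart) = X 2 * k i := fun i => by
    rw [← comp_comp hH.2.1 hpc, ← hk]
  have hψ : ∀ i, mapCurve K φ i = compCurve (X 2 * k i) φ' := fun i => by
    rw [hφφ', ← hKG, compCurve_comp hφ' hπ0]
    rfl
  have hψ1 : ∀ i, PowerSeries.coeff 1 (mapCurve K φ i) =
      constantCoeff (k i) * PowerSeries.coeff 1 (φ' 2) := fun i => by
    rw [hψ, coeff_one_compCurve_X_mul hφ']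
  have hk2 : constantCoeff (k 2) ≠ 0 := fun h0 => hM.transverse (by rw [hψ1, h0, zero_mul])
  set a := constantCoeff (k 0) / constantCoeff (k 2) with ha
  set b := constantCoeff (k 1) / constantCoeff (k 2) with hb
  have hkk : k 2 * (k 2)⁻¹ = 1 := MvPowerSeries.mul_inv_cancel _ hk2
  obtain ⟨u', f', g', hu', hf', hg', hu'0, hg'0, hY⟩ := hM.exists_pointTransform a (b := b)
    (by rw [hψ1, hψ1, hb]; field_simp)
  obtain ⟨K', hK'⟩ : ∃ K' : Triple, K' = ![k 0 * (k 2)⁻¹ - C a, k 1 * (k 2)⁻¹ - C b, X 2 * k 2] :=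
    ⟨_, rfl⟩
  have h0 : K' 0 = k 0 * (k 2)⁻¹ - C a := by rw [hK']; rfl
  have h1 : K' 1 = k 1 * (k 2)⁻¹ - C b := by rw [hK']; rfl
  have h2 : K' 2 = X 2 * k 2 := by rw [hK']; rfl
  have hK'0 : ∀ i, constantCoeff (K' i) = 0 := by
    intro i
    fin_cases i
    · simp [h0, ha, div_eq_mul_inv]
    · simp [h1, hb, div_eq_mul_inv]
    · simp [h2]
  refine IsModelLike.of_lift (π := fun i => comp (H i) pointChart) (e := 2) (hφφ' ▸ hM) hK hrel
    hπ0 (c := comp (jac H).det pointChart) ?_ ?_ hT hφ' (pointChartAt_centered a b) (c' := 1)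
    (by simp) (by rw [det_jac_pointChartAt, one_mul]) rfl (K' := K') ?_ hK'0 hk2 (hkc 2) h2 ?_
    hu' hf' hg' hu'0 hg'0 hY
  · rw [jac_comp hpc, Matrix.det_mul, det_jac_pointChart, ← AlgHom.mapMatrix_apply,
      ← AlgHom.map_det, ← comp_eq_substHom]
  · rw [constantCoeff_comp hpc, constantCoeff_det_jac]
    exact hH.2.2
  · intro i
    fin_cases i
    · exact h0 ▸ ((hkc 0).mul ((hkc 2).inv hk2)).sub (isConvergent_C a)
    · exact h1 ▸ ((hkc 1).mul ((hkc 2).inv hk2)).sub (isConvergent_C b)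
    · exact h2 ▸ (isConvergent_X 2).mul (hkc 2)
  · intro i
    rw [hKG]
    fin_cases i
    · change X 2 * k 0 = comp ((X 0 + C a) * X 2) K'
      rw [comp_eq_substHom hK'0, map_mul, map_add, substHom_X, substHom_X, substHom_C, h0, h2]
      linear_combination (-(X 2 * k 0)) * hkk
    · change X 2 * k 1 = comp ((X 1 + C b) * X 2) K'
      rw [comp_eq_substHom hK'0, map_mul, map_add, substHom_X, substHom_X, substHom_C, h1, h2]
      linear_combination (-(X 2 * k 1)) * hkk
    · change _ = comp (X 2) K'
      rw [comp_X hK'0, h2]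
      rfl

lemma IsModelLike.of_curveBlowup {n : ℕ} {X₀ X' : Triple} {φ φ' : Curve}
    (h : IsModelLike n X₀ φ) (hB : CurveBlowup (X₀, φ) (X', φ')) : IsModelLike n X' φ' := by
  obtain ⟨-, hφ, u, f, g, w, K, hM, hK, hwc, hw, hrel⟩ := h
  obtain ⟨H, hH, hcenter, hT, hφ', hφφ'⟩ := hB
  simp only at hT hφ' hφφ' hcenter
  have hpc := curveChart_centered
  have hπ0 : ∀ i, constantCoeff (comp (H i) curveChart) = 0 :=
    fun i => by rw [constantCoeff_comp hpc, hH.2.1]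
  set G : Triple := fun i => comp (K i) H with hG
  have hGc : ∀ i, IsConvergent (G i) := fun i => (hK.1 i).comp hH.1 hH.2.1
  have hG0 : ∀ i, constantCoeff (G i) = 0 := fun i => by rw [hG, constantCoeff_comp hH.2.1, hK.2.1]
  -- the center of the blow-up is contained in the singular set `{y = z = 0}` of the model field
  have hη : Curve.Centered ![PowerSeries.X, 0, 0] := by
    intro i; fin_cases i <;> simp
  have hηH := centered_mapCurve hη hH.2.1
  have hγ := centered_mapCurve hη hG0
  have hKH : mapCurve K (mapCurve H ![PowerSeries.X, 0, 0]) = mapCurve G ![PowerSeries.X, 0, 0] :=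
    (mapCurve_comp hη hH.2.1).symm
  have hYγ : ∀ i, compCurve (modelField n u f g i) (mapCurve G ![PowerSeries.X, 0, 0]) = 0 := by
    intro i
    have e := congrArg (substHom _ hηH) (hrel i)
    rw [map_mul, ← compCurve_eq_substHom hηH, ← compCurve_eq_substHom hηH,
      ← compCurve_eq_substHom hηH, compCurve_comp hηH hK.2.1, hKH, compCurve_pushTangent hηH] at e
    simp only [hcenter] at e
    have e0 : (fun _ : Fin 3 => (0 : PowerSeries ℂ)) = 0 := rfl
    rw [e0, Matrix.mulVec_zero] at e
    exact (mul_eq_zero.1 e.symm).resolve_left (compCurve_ne_zero hηH hw)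
  have hγ2 : mapCurve G ![PowerSeries.X, 0, 0] 2 = 0 := by
    have e := hYγ 2
    change compCurve (X 2 ^ n) _ = 0 at e
    rw [compCurve_eq_substHom hγ, map_pow, substHom_X_curve hγ] at e
    exact pow_eq_zero_iff (by have := hM.two_le; omega) |>.1 e
  have hγ1 : mapCurve G ![PowerSeries.X, 0, 0] 1 = 0 := by
    have e := hYγ 0
    change compCurve (X 1 * u + X 2 * f) _ = 0 at e
    rw [compCurve_eq_substHom hγ, map_add, map_mul, map_mul, substHom_X_curve hγ,
      substHom_X_curve hγ, hγ2, zero_mul, add_zero, ← compCurve_eq_substHom] at e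
    exact (mul_eq_zero.1 e).resolve_right (compCurve_ne_zero hγ hM.unit_u)
  obtain ⟨k1, hk1c, hk1⟩ := exists_comp_curveChart (hGc 1) hγ1
  obtain ⟨k2, hk2c, hk2⟩ := exists_comp_curveChart (hGc 2) hγ2
  have hKG : ∀ i, comp (K i) (fun i => comp (H i) curveChart) = comp (G i) curveChart := fun i => by
    rw [← comp_comp hH.2.1 hpc]
  have hψ : ∀ i, mapCurve K φ i = compCurve (comp (G i) curveChart) φ' := fun i => by
    rw [hφφ', ← hKG, compCurve_comp hφ' hπ0]
    rfl
  have hk20 : constantCoeff k2 ≠ 0 := fun h0 => hM.transverse (by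
    rw [hψ, hk2, coeff_one_compCurve_X_mul hφ', h0, zero_mul])
  set b := constantCoeff k1 / constantCoeff k2 with hb
  have hkk : k2 * k2⁻¹ = 1 := MvPowerSeries.mul_inv_cancel _ hk20
  obtain ⟨u', f', g', hu', hf', hg', hu'0, hg'0, hY⟩ := hM.exists_curveTransform b
  obtain ⟨K', hK'⟩ : ∃ K' : Triple, K' = ![k1 * k2⁻¹ - C b, comp (G 0) curveChart, X 2 * k2] :=
    ⟨_, rfl⟩
  have h0 : K' 0 = k1 * k2⁻¹ - C b := by rw [hK']; rfl
  have h1 : K' 1 = comp (G 0) curveChart := by rw [hK']; rfl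
  have h2 : K' 2 = X 2 * k2 := by rw [hK']; rfl
  have hK'0 : ∀ i, constantCoeff (K' i) = 0 := by
    intro i
    fin_cases i
    · simp [h0, hb, div_eq_mul_inv]
    · simp [h1, constantCoeff_comp hpc, hG0]
    · simp [h2]
  refine IsModelLike.of_lift (π := fun i => comp (H i) curveChart) (e := 1) (hφφ' ▸ hM) hK hrel
    hπ0 (c := comp (jac H).det curveChart) ?_ ?_ hT hφ' (curveChartAt_centered b) (c' := C (-1))
    (by simp) (det_jac_curveChartAt b) rfl (K' := K') ?_ hK'0 hk20 hk2c h2 ?_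
    hu' hf' hg' hu'0 hg'0 hY
  · rw [jac_comp hpc, Matrix.det_mul, det_jac_curveChart, ← AlgHom.mapMatrix_apply,
      ← AlgHom.map_det, ← comp_eq_substHom]
  · rw [constantCoeff_comp hpc, constantCoeff_det_jac]
    exact hH.2.2
  · intro i
    fin_cases i
    · exact h0 ▸ (hk1c.mul (hk2c.inv hk20)).sub (isConvergent_C b)
    · exact h1 ▸ (hGc 0).comp isConvergent_curveChart hpc
    · exact h2 ▸ (isConvergent_X 2).mul hk2c
  · intro i
    rw [hKG]
    fin_cases i
    · change _ = comp (X 1) K'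
      rw [comp_X hK'0, h1]
      rfl
    · change comp (G 1) curveChart = comp ((X 0 + C b) * X 2) K'
      rw [comp_eq_substHom hK'0, map_mul, map_add, substHom_X, substHom_X, substHom_C, h0, h2, hk1]
      linear_combination (-(X 2 * k1)) * hkk
    · change comp (G 2) curveChart = comp (X 2) K'
      rw [comp_X hK'0, h2, hk2]

lemma IsModelLike.of_reflTransGen {n : ℕ} {X₀ X' : Triple} {φ φ' : Curve}
    (h : IsModelLike n X₀ φ) (hB : Relation.ReflTransGen Blowup (X₀, φ) (X', φ')) :
    IsModelLike n X' φ' := by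
  suffices H : ∀ p : FolCurve, Relation.ReflTransGen Blowup (X₀, φ) p → IsModelLike n p.1 p.2 from
    H (X', φ') hB
  intro p hp
  induction hp with
  | refl => exact h
  | tail _ hstep ih =>
    rcases hstep with hs | hs
    · exact ih.of_pointBlowup hs
    · exact ih.of_curveBlowup hs

lemma IsModelLike.isPersistentNilpotentAlong {n : ℕ} {X₀ : Triple} {φ : Curve}
    (h : IsModelLike n X₀ φ) (hφ : φ.IsIrreducible) : IsPersistentNilpotentAlong X₀ φ := by
  obtain ⟨g, hg, hord⟩ := h.hasMultiplicity
  refine ⟨h.1, h.isNilpotentSingularity, ⟨hφ, fun i j => ?_, ?_⟩, n, fun X' φ' hB => ?_⟩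
  · rw [hg, hg]; ring
  · obtain ⟨i, hi⟩ := hφ.derivative_ne_zero
    refine ⟨i, ?_⟩
    rw [hg]
    refine mul_ne_zero (fun h0 => ?_) hi
    rw [h0, PowerSeries.order_zero] at hord
    exact absurd hord (by simp)
  · exact ⟨(h.of_reflTransGen hB).isNilpotentSingularity, (h.of_reflTransGen hB).hasMultiplicity⟩

lemma normalForm_eq (n : ℕ) (f g : Ser) : normalForm n f g = modelField n 1 f g := by
  rw [normalForm, modelField, mul_one]

/-- A foliation with a normal form is persistently nilpotent along a transverse invariant curve. -/
lemma isPersistentNilpotentAlong_of_normalForm {X₀ : Triple} {φ : Curve} {H : Triple} {n : ℕ}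
    {f g : Ser} {ψ : Curve} (hX : IsFoliation X₀) (hH : IsBiholomorphism H)
    (hfg : IsNormalFormData n f g) (hrep : RepresentedIn H X₀ (normalForm n f g))
    (hφ : φ = mapCurve H ψ) (hψ : ψ.TangentToZAxis) (hS : IsFormalSeparatrix (normalForm n f g) ψ) :
    IsPersistentNilpotentAlong X₀ φ := by
  obtain ⟨hn, hf, hg, -, -, hgx⟩ := hfg
  obtain ⟨hψ0, -, -, hψ2⟩ := hψ
  obtain ⟨w, hwc, hw0, hw⟩ := hrep
  obtain ⟨K, hK, hHK, hKH⟩ := exists_inverse hH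
  have hφ0 : φ.Centered := hφ ▸ centered_mapCurve hψ0 hH.2.1
  have hKφ : mapCurve K φ = ψ := by
    rw [hφ, ← mapCurve_comp hψ0 hH.2.1]
    simp_rw [hKH]
    exact mapCurve_id hψ0
  rw [normalForm_eq] at hw hS
  -- parametrize the separatrix: its last coordinate has an invertible derivative
  have hinv : ∃ h : PowerSeries ℂ, ∀ i,
      compCurve (modelField n 1 f g i) ψ = h * PowerSeries.derivative ℂ (ψ i) := by
    have hu : PowerSeries.constantCoeff (PowerSeries.derivative ℂ (ψ 2)) ≠ 0 := by
      rwa [← coeff_one_eq]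
    have hu' : PowerSeries.derivative ℂ (ψ 2) * (PowerSeries.derivative ℂ (ψ 2))⁻¹ = 1 :=
      PowerSeries.mul_inv_cancel _ hu
    refine ⟨compCurve (modelField n 1 f g 2) ψ * (PowerSeries.derivative ℂ (ψ 2))⁻¹, fun i => ?_⟩
    linear_combination (-(PowerSeries.derivative ℂ (ψ 2))⁻¹) * hS.2.1 i 2 -
      compCurve (modelField n 1 f g i) ψ * hu'
  have hM : IsModel n 1 f g ψ :=
    ⟨hn, isConvergent_one, hf, hg, by simp, hgx, hψ0, hψ2, hinv⟩
  refine IsModelLike.isPersistentNilpotentAlong (n := n)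
    ⟨hX, hφ0, 1, f, g, comp w K, K, hKφ.symm ▸ hM, hK, hwc.comp hK.1 hK.2.1,
      by rwa [constantCoeff_comp hK.2.1], ?_⟩ ?_
  · -- the inverse of the Jacobian matrix of `H` is that of `K`
    have e1 : (jac K) * ((jac H).map (substHom K hK.2.1)) = 1 := by
      rw [mul_eq_one_comm, ← jac_comp hK.2.1]
      simp_rw [hHK]
      ext1 i j
      simp [jac, MvPowerSeries.pderiv_X, Pi.single_apply, Matrix.one_apply]
    have e2 : X₀ = comp w K • ((jac H).map (substHom K hK.2.1)).mulVec
        (fun i => comp (modelField n 1 f g i) K) := by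
      funext i
      have := congrArg (substHom K hK.2.1) (hw i)
      rw [map_mul] at this
      simp only [← comp_eq_substHom] at this
      rw [comp_pushTangent hK.2.1, comp_comp hH.2.1 hK.2.1] at this
      simp_rw [hHK] at this
      rw [comp_id] at this
      exact this.symm
    intro i
    have e3 := congrArg (fun V => (jac K).mulVec V i) e2
    simp only [Matrix.mulVec_smul, Matrix.mulVec_mulVec, e1, Matrix.one_mulVec] at e3
    exact e3
  · refine Curve.IsIrreducible.of_mapCurve (π := K) hφ0 ?_
    rw [hKφ]
    exact hS.1

/-! ### Transforms of persistently nilpotent foliations -/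

lemma exists_saturation {Y : Triple} (hY : ∀ i, IsConvergent (Y i)) {i₀ : Fin 3} (h0 : Y i₀ ≠ 0) :
    ∃ (d : Ser) (Y' : Triple), IsConvergent d ∧ IsFoliation Y' ∧ ∀ i, Y i = d * Y' i := by
  suffices H : ∀ (n : ℕ) (Y : Triple), (∀ i, IsConvergent (Y i)) → Y i₀ ≠ 0 →
      (Y i₀).order ≤ n →
      ∃ (d : Ser) (Y' : Triple), IsConvergent d ∧ IsFoliation Y' ∧ ∀ i, Y i = d * Y' i from
    H _ Y hY h0 (MvPowerSeries.ne_zero_iff_order_finite.1 h0).ge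
  intro n
  induction n with
  | zero =>
    intro Y hY _ hord
    refine ⟨1, Y, isConvergent_one, ⟨hY, fun d _ hd hd0 => ?_⟩, fun i => (one_mul _).symm⟩
    obtain ⟨q, -, hq⟩ := hd i₀
    have : 1 ≤ (Y i₀).order := one_le_order (by rw [hq, map_mul, hd0, zero_mul])
    exact absurd (this.trans hord) (by simp)
  | succ n ih =>
    intro Y hY h0 hord
    by_cases hfol : IsFoliation Y
    · exact ⟨1, Y, isConvergent_one, hfol, fun i => (one_mul _).symm⟩
    · -- divide by a common factor which is not a unit
      have : ∃ d, IsConvergent d ∧ (∀ i, ConvDvd d (Y i)) ∧ constantCoeff d = 0 := by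
        by_contra! hcon
        exact hfol ⟨hY, fun d hd h => hcon d hd h⟩
      obtain ⟨d, hdc, hd, hd0⟩ := this
      choose q hqc hq using hd
      have hq0 : q i₀ ≠ 0 := fun h => h0 (by rw [hq, h, mul_zero])
      have hle : (q i₀).order ≤ n := by
        have h1 := (le_order_mul_add (one_le_order hd0) (le_refl (q i₀).order)).trans
          ((hq i₀) ▸ hord)
        rw [Nat.cast_succ, add_comm] at h1
        exact (ENat.add_le_add_iff_right (by simp)).1 h1
      obtain ⟨d', Y', hd'c, hY', hd'⟩ := ih q hqc hq0 hle
      exact ⟨d * d', Y', hdc.mul hd'c, hY', fun i => by rw [hq, hd', mul_assoc]⟩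

/-- The foliation of `X₀` is persistently nilpotent along `φ`, with multiplicity `m`. -/
def PersistsAlong (m : ℕ) (X₀ : Triple) (φ : Curve) : Prop :=
  IsFoliation X₀ ∧ φ.IsIrreducible ∧ ∀ X' φ', Relation.ReflTransGen Blowup (X₀, φ) (X', φ') →
    IsNilpotentSingularity X' ∧ HasMultiplicity X' φ' m

lemma PersistsAlong.isNilpotentSingularity {m : ℕ} {X₀ : Triple} {φ : Curve}
    (h : PersistsAlong m X₀ φ) : IsNilpotentSingularity X₀ :=
  (h.2.2 X₀ φ Relation.ReflTransGen.refl).1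

lemma PersistsAlong.hasMultiplicity {m : ℕ} {X₀ : Triple} {φ : Curve}
    (h : PersistsAlong m X₀ φ) : HasMultiplicity X₀ φ m :=
  (h.2.2 X₀ φ Relation.ReflTransGen.refl).2

lemma eq_of_mul_derivative_eq {φ : Curve} (hφ : φ.IsIrreducible) {g g' : PowerSeries ℂ}
    (h : ∀ i, g * PowerSeries.derivative ℂ (φ i) = g' * PowerSeries.derivative ℂ (φ i)) :
    g = g' := by
  obtain ⟨i, hi⟩ := hφ.derivative_ne_zero
  exact mul_right_cancel₀ hi (h i)

/-- The pull-back `Y` of a persistently nilpotent foliation by a blow-up has no common factor: its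
saturation has the same multiplicity along the curve, so that the common factor does not vanish at
the point selected by the curve. -/
lemma PersistsAlong.transform {m : ℕ} {X₀ Y π : Triple} {φ φ' : Curve} (hP : PersistsAlong m X₀ φ)
    (hπ : ∀ i, constantCoeff (π i) = 0) (hφ' : φ'.Centered) (hφ : φ = mapCurve π φ')
    (hYc : ∀ i, IsConvergent (Y i)) (hY : ∀ i, pushTangent π Y i = comp (X₀ i) π)
    (hB : ∀ X', IsTransform π X₀ X' → Blowup (X₀, φ) (X', φ')) :
    IsTransform π X₀ Y ∧ PersistsAlong m Y φ' := by
  obtain ⟨hX, hφi, hchain⟩ := hP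
  have hφ'i : φ'.IsIrreducible := Curve.IsIrreducible.of_mapCurve hφ' (hφ ▸ hφi)
  obtain ⟨g, hg, hgm⟩ := (hchain X₀ φ Relation.ReflTransGen.refl).2
  have hg0 : g ≠ 0 := by
    rintro rfl
    rw [PowerSeries.order_zero] at hgm
    exact absurd hgm (by simp)
  have hne : ∃ i, Y i ≠ 0 := by
    by_contra! hcon
    obtain ⟨i, hi⟩ := hφi.derivative_ne_zero
    refine mul_ne_zero hg0 hi ?_
    have h1 : comp (X₀ i) π = 0 := by
      rw [← hY, pushTangent]
      exact Finset.sum_eq_zero fun j _ => by rw [hcon, mul_zero]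
    rw [← hg, hφ, ← compCurve_comp hφ' hπ, h1, compCurve_eq_substHom hφ', map_zero]
  obtain ⟨i₀, hi₀⟩ := hne
  obtain ⟨d, X', hdc, hX', hd⟩ := exists_saturation hYc hi₀
  have hd0 : d ≠ 0 := by
    rintro rfl
    exact hi₀ (by rw [hd, zero_mul])
  have hpush : ∀ i, d * pushTangent π X' i = 1 * comp (X₀ i) π := by
    intro i
    rw [one_mul, ← hY, pushTangent, pushTangent, Finset.mul_sum]
    exact Finset.sum_congr rfl fun j _ => by rw [hd]; ring
  have hT : IsTransform π X₀ X' := ⟨hX', d, 1, hdc, isConvergent_one, hd0, one_ne_zero, hpush⟩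
  obtain ⟨g', hg', hg'm⟩ := (hchain X' φ' (Relation.ReflTransGen.single (hB X' hT))).2
  have h1 : g = compCurve d φ' * g' := by
    refine eq_of_mul_derivative_eq hφi fun i => ?_
    have h2 := compCurve_of_pushTangent hφ' hπ hpush hg' i
    rw [← hφ, hg, compCurve_eq_substHom hφ' 1, map_one, one_mul] at h2
    exact h2
  have h2 := congrArg PowerSeries.order h1
  rw [PowerSeries.order_mul, hgm, hg'm] at h2
  have h3 : (compCurve d φ').order = 0 := by
    generalize (compCurve d φ').order = o at h2 ⊢
    cases o with
    | top => simp at h2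
    | coe o =>
      have h4 : m = o + m := by exact_mod_cast h2
      have h5 : o = 0 := by omega
      exact_mod_cast h5
  rw [order_eq_zero_iff, constantCoeff_compCurve hφ'] at h3
  have hYf : IsFoliation Y := by
    refine ⟨hYc, fun c hc hcY => hX'.2 c hc fun i => ?_⟩
    obtain ⟨q, hqc, hq⟩ := hcY i
    refine ⟨q * d⁻¹, hqc.mul (hdc.inv h3), ?_⟩
    have hdd : d * d⁻¹ = 1 := MvPowerSeries.mul_inv_cancel _ h3
    have := (hd i).symm.trans hq
    linear_combination d⁻¹ * this - X' i * hdd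
  have hTY : IsTransform π X₀ Y :=
    ⟨hYf, 1, 1, isConvergent_one, isConvergent_one, one_ne_zero, one_ne_zero, fun i => by rw [hY]⟩
  exact ⟨hTY, hYf, hφ'i, fun X'' φ'' hc => hchain X'' φ'' (hc.head (hB Y hTY))⟩

/-- A blow-up of the origin, in the chart selected by a permutation of the coordinates and by the
point `(a, b)` of the exceptional divisor. -/
lemma PersistsAlong.exists_pointBlowup {m : ℕ} {X₀ : Triple} {φ φ' : Curve}
    (hP : PersistsAlong m X₀ φ) (e : Equiv.Perm (Fin 3)) {a b : ℂ} (hφ' : φ'.Centered)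
    (hφ : φ = mapCurve (fun i => pointChartAt a b (e i)) φ') :
    ∃ Y : Triple, PointBlowup (X₀, φ) (Y, φ') ∧ PersistsAlong m Y φ' ∧
      ∀ i, pushTangent (fun i => pointChartAt a b (e i)) Y i =
        comp (X₀ i) (fun i => pointChartAt a b (e i)) := by
  -- the coordinates in which the chart is `pointChart`
  obtain ⟨S, hS⟩ : ∃ S : Triple, S = ![X 0 + C a * X 2, X 1 + C b * X 2, X 2] := ⟨_, rfl⟩
  have hSc : ∀ i, IsConvergent (S i) := by
    intro i
    rw [hS]
    fin_cases i
    · exact (isConvergent_X 0).add ((isConvergent_C a).mul (isConvergent_X 2))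
    · exact (isConvergent_X 1).add ((isConvergent_C b).mul (isConvergent_X 2))
    · exact isConvergent_X 2
  have hS0 : ∀ i, constantCoeff (S i) = 0 := by
    intro i; rw [hS]; fin_cases i <;> simp
  have hSdet : (linearPart S).det ≠ 0 := by
    rw [hS, Matrix.det_fin_three]
    simp [linearPart, coeff_single_eq, Derivation.leibniz, MvPowerSeries.pderiv_X_of_ne]
  have hSπ : ∀ i, comp (S i) pointChart = pointChartAt a b i := by
    intro i
    rw [hS]
    have hp := pointChart_centered
    fin_cases i
    · change comp (X 0 + C a * X 2) pointChart = _
      rw [comp_eq_substHom hp, map_add, map_mul, substHom_X, substHom_X, substHom_C]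
      simp [pointChart, pointChartAt, x_eq, z_eq]
      ring
    · change comp (X 1 + C b * X 2) pointChart = _
      rw [comp_eq_substHom hp, map_add, map_mul, substHom_X, substHom_X, substHom_C]
      simp [pointChart, pointChartAt, y_eq, z_eq]
      ring
    · change comp (X 2) pointChart = _
      rw [comp_X hp]
      rfl
  have hH : IsBiholomorphism fun i => S (e i) := by
    refine ⟨fun i => hSc _, fun i => hS0 _, ?_⟩
    have : linearPart (fun i => S (e i)) = (linearPart S).submatrix e id := rfl
    rw [this, Matrix.det_permute]
    exact mul_ne_zero (by simp) hSdet
  have hHπ : (fun i => comp (S (e i)) pointChart) = fun i => pointChartAt a b (e i) :=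
    funext fun i => hSπ _
  obtain ⟨σ, hσ⟩ : ∃ σ : Triple, σ = fun i => pointChartAt a b (e i) := ⟨_, rfl⟩
  have hσ0 : ∀ i, constantCoeff (σ i) = 0 := fun i => by rw [hσ]; exact pointChartAt_centered a b _
  have hσc : ∀ i, IsConvergent (σ i) := fun i => by rw [hσ]; exact isConvergent_pointChartAt a b _
  have hsing := hP.isNilpotentSingularity.1
  -- the pull-back of a singular vector field is divisible by the exceptional divisor
  have hdiv : ∀ i, ∃ k, IsConvergent k ∧ comp (X₀ i) σ = X 2 * k := by
    intro i
    have h1 := exists_comp_pointChart ((hP.1.1 i).comp hH.1 hH.2.1)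
      (by rw [constantCoeff_comp hH.2.1, hsing i])
    rwa [comp_comp hH.2.1 pointChart_centered, hHπ, ← hσ] at h1
  choose k hkc hk using hdiv
  obtain ⟨Y, hY⟩ : ∃ Y : Triple, Y = ![k (e.symm 0) - (X 0 + C a) * k (e.symm 2),
    k (e.symm 1) - (X 1 + C b) * k (e.symm 2), X 2 * k (e.symm 2)] := ⟨_, rfl⟩
  have hYc : ∀ i, IsConvergent (Y i) := by
    intro i
    rw [hY]
    fin_cases i
    · exact (hkc _).sub (((isConvergent_X 0).add (isConvergent_C a)).mul (hkc _))
    · exact (hkc _).sub (((isConvergent_X 1).add (isConvergent_C b)).mul (hkc _))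
    · exact (isConvergent_X 2).mul (hkc _)
  have hpush : ∀ i, pushTangent σ Y i = comp (X₀ i) σ := by
    intro i
    have h1 : pushTangent σ Y i = pushTangent (pointChartAt a b) Y (e i) := by rw [hσ]; rfl
    rw [h1, hk, hY, pushTangent_pointChartAt]
    obtain ⟨j, rfl⟩ : ∃ j, i = e.symm j := ⟨e i, by simp⟩
    rw [Equiv.apply_symm_apply]
    fin_cases j <;> simp <;> ring
  have hB : ∀ X', IsTransform σ X₀ X' → PointBlowup (X₀, φ) (X', φ') := by
    intro X' hT
    refine ⟨hsing, fun i => S (e i), hH, ?_, hφ', ?_⟩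
    · simp only [hHπ]
      rwa [← hσ]
    · simp only [hHπ]
      exact hφ
  obtain ⟨h1, h2⟩ := hP.transform hσ0 hφ' (hσ ▸ hφ) hYc hpush fun X' hT => Or.inl (hB X' hT)
  exact ⟨Y, hB Y h1, h2, hσ ▸ hpush⟩

/-! ### Resolution of the curve -/

lemma dvd_of_order_le {s f : PowerSeries ℂ} (h : s.order ≤ f.order) (hs : s ≠ 0) : s ∣ f := by
  have h1 : (PowerSeries.X : PowerSeries ℂ) ^ s.order.toNat ∣ f := by
    rw [PowerSeries.X_pow_dvd_iff]
    intro k hk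
    refine PowerSeries.coeff_of_lt_order k (lt_of_lt_of_le ?_ h)
    rw [← PowerSeries.coe_toNat_order hs]
    exact_mod_cast hk
  obtain ⟨q, hq⟩ := h1
  have hu : PowerSeries.constantCoeff s.divXPowOrder ≠ 0 := by
    rw [Ne, PowerSeries.constantCoeff_divXPowOrder_eq_zero_iff]
    exact hs
  have huu := PowerSeries.mul_inv_cancel _ hu
  refine ⟨s.divXPowOrder⁻¹ * q, ?_⟩
  have hsX := PowerSeries.X_pow_order_mul_divXPowOrder (f := s)
  calc f = PowerSeries.X ^ s.order.toNat * q * (s.divXPowOrder * s.divXPowOrder⁻¹) := by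
        rw [huu, hq, mul_one]
    _ = PowerSeries.X ^ s.order.toNat * s.divXPowOrder * (s.divXPowOrder⁻¹ * q) := by ring
    _ = _ := by rw [hsX]

lemma constantCoeff_psubst {s : PowerSeries ℂ} (hs : PowerSeries.constantCoeff s = 0)
    (f : PowerSeries ℂ) :
    PowerSeries.constantCoeff (PowerSeries.subst s f) = PowerSeries.constantCoeff f := by
  have hS := PowerSeries.HasSubst.of_constantCoeff_zero' hs
  have h1 : f = PowerSeries.C (PowerSeries.constantCoeff f) + 
      (f - PowerSeries.C (PowerSeries.constantCoeff f)) := by ring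
  have h2 := PowerSeries.constantCoeff_subst_eq_zero (a := s) hs
    (f - PowerSeries.C (PowerSeries.constantCoeff f)) (by simp)
  conv_lhs => rw [h1, PowerSeries.subst_add hS, PowerSeries.subst_C, map_add]
  rw [PowerSeries.constantCoeff_eq (PowerSeries.subst s _), h2, add_zero]
  exact PowerSeries.constantCoeff_C _

/-- The order of a composition with a series of positive order. -/
lemma psubst_eq_pow_mul {s : PowerSeries ℂ} (hs : PowerSeries.constantCoeff s = 0)
    {f : PowerSeries ℂ} (hf : f ≠ 0) :
    ∃ u, PowerSeries.constantCoeff u ≠ 0 ∧ PowerSeries.subst s f = s ^ f.order.toNat * u := by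
  have hS := PowerSeries.HasSubst.of_constantCoeff_zero' hs
  refine ⟨PowerSeries.subst s f.divXPowOrder, ?_, ?_⟩
  · rw [constantCoeff_psubst hs, Ne, PowerSeries.constantCoeff_divXPowOrder_eq_zero_iff]
    exact hf
  · conv_lhs => rw [← PowerSeries.X_pow_order_mul_divXPowOrder (f := f)]
    rw [PowerSeries.subst_mul hS, PowerSeries.subst_pow hS, PowerSeries.subst_X hS]

lemma X_pow_dvd_of_pow_dvd_psubst {s : PowerSeries ℂ} (hs : PowerSeries.constantCoeff s = 0)
    (hs0 : s ≠ 0) {f : PowerSeries ℂ} {N : ℕ}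
    (h : s ^ N ∣ PowerSeries.subst s f) : PowerSeries.X ^ N ∣ f := by
  by_cases hf : f = 0
  · exact hf ▸ dvd_zero _
  obtain ⟨u, hu, hsu⟩ := psubst_eq_pow_mul hs hf
  rw [hsu] at h
  have hle : N ≤ f.order.toNat := by
    by_contra! hlt
    obtain ⟨j, hj⟩ : ∃ j, N = f.order.toNat + (j + 1) := ⟨N - f.order.toNat - 1, by omega⟩
    rw [hj, pow_add, mul_dvd_mul_iff_left (pow_ne_zero _ hs0)] at h
    obtain ⟨q, hq⟩ := h
    apply hu
    rw [hq, map_mul, map_pow, hs]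
    simp
  exact (pow_dvd_pow _ hle).trans PowerSeries.X_pow_order_dvd

lemma pow_dvd_psubst {s : PowerSeries ℂ} (hs : PowerSeries.constantCoeff s = 0)
    {f : PowerSeries ℂ} {N : ℕ} (h : PowerSeries.X ^ N ∣ f) :
    s ^ N ∣ PowerSeries.subst s f := by
  have hS := PowerSeries.HasSubst.of_constantCoeff_zero' hs
  obtain ⟨q, rfl⟩ := h
  rw [PowerSeries.subst_mul hS, PowerSeries.subst_pow hS, PowerSeries.subst_X hS]
  exact ⟨_, rfl⟩

/-- The series in `s` form a closed subring. -/
lemma exists_eq_psubst {s : PowerSeries ℂ} (hs : PowerSeries.constantCoeff s = 0)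
    (hs0 : s ≠ 0) {f : PowerSeries ℂ}
    (h : ∀ N, ∃ P : PowerSeries ℂ, s ^ N ∣ f - PowerSeries.subst s P) :
    ∃ P : PowerSeries ℂ, f = PowerSeries.subst s P := by
  have hS := PowerSeries.HasSubst.of_constantCoeff_zero' hs
  choose P hP using h
  have hcomp : ∀ N k, N ≤ k → PowerSeries.X ^ N ∣ P k - P N := by
    intro N k hk
    refine X_pow_dvd_of_pow_dvd_psubst hs hs0 ?_
    rw [PowerSeries.subst_sub hS]
    have := dvd_sub (hP N) ((pow_dvd_pow s hk).trans (hP k))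
    rwa [sub_sub_sub_cancel_left] at this
  refine ⟨PowerSeries.mk fun k => PowerSeries.coeff k (P (k + 1)), ?_⟩
  have hlim : ∀ N, s ^ N ∣ f - PowerSeries.subst s
      (PowerSeries.mk fun k => PowerSeries.coeff k (P (k + 1))) := by
    intro N
    have h1 : PowerSeries.X ^ N ∣
        P N - PowerSeries.mk fun k => PowerSeries.coeff k (P (k + 1)) := by
      rw [PowerSeries.X_pow_dvd_iff]
      intro k hk
      rw [map_sub, PowerSeries.coeff_mk, ← map_sub]
      exact PowerSeries.X_pow_dvd_iff.1 (hcomp (k + 1) N hk) k k.lt_succ_self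
    have h2 := dvd_add (hP N) (pow_dvd_psubst hs h1)
    rwa [PowerSeries.subst_sub hS, sub_add_sub_cancel] at h2
  rw [← sub_eq_zero]
  ext k
  have h1 : (PowerSeries.X : PowerSeries ℂ) ∣ s := PowerSeries.X_dvd_iff.2 hs
  rw [map_zero]
  exact PowerSeries.X_pow_dvd_iff.1 ((pow_dvd_pow_of_dvd h1 (k + 1)).trans (hlim (k + 1))) k
    k.lt_succ_self

lemma mapCurve_pointChartAt {a b : ℂ} {φ : Curve} (hφ : φ.Centered) (i : Fin 3) :
    compCurve (pointChartAt a b i) φ =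
      (![(φ 0 + PowerSeries.C a) * φ 2, (φ 1 + PowerSeries.C b) * φ 2, φ 2] : Curve) i := by
  rw [compCurve_eq_substHom hφ]
  fin_cases i
  · change substHom φ hφ ((X 0 + C a) * X 2) = _
    rw [map_mul, map_add, substHom_X_curve, substHom_X_curve, substHom_C_curve]
    rfl
  · change substHom φ hφ ((X 1 + C b) * X 2) = _
    rw [map_mul, map_add, substHom_X_curve, substHom_X_curve, substHom_C_curve]
    rfl
  · change substHom φ hφ (X 2) = _
    rw [substHom_X_curve]
    rfl

/-- The transform of a curve by the blow-up of the origin, when the last coordinate (after a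
permutation) has minimal order. -/
lemma exists_lift_pointChartAt {φ : Curve} (e : Equiv.Perm (Fin 3)) (h2 : φ (e.symm 2) ≠ 0)
    (hφ0 : φ.Centered) (hmin : ∀ i, (φ (e.symm 2)).order ≤ (φ i).order) :
    ∃ (a b : ℂ) (φ' : Curve), φ'.Centered ∧ φ = mapCurve (fun i => pointChartAt a b (e i)) φ' ∧
      φ' 2 = φ (e.symm 2) := by
  have hdvd : ∀ i, φ (e.symm 2) ∣ φ i := fun i => dvd_of_order_le (hmin i) h2
  choose q hq using hdvd
  obtain ⟨φ', hφ'⟩ : ∃ φ' : Curve, φ' =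
    ![q (e.symm 0) - PowerSeries.C (PowerSeries.constantCoeff (q (e.symm 0))),
      q (e.symm 1) - PowerSeries.C (PowerSeries.constantCoeff (q (e.symm 1))), φ (e.symm 2)] :=
    ⟨_, rfl⟩
  have hc : φ'.Centered := by
    intro i
    rw [hφ']
    fin_cases i
    · simp
    · simp
    · exact hφ0 _
  refine ⟨PowerSeries.constantCoeff (q (e.symm 0)), PowerSeries.constantCoeff (q (e.symm 1)), φ',
    hc, ?_, by rw [hφ']; rfl⟩
  funext i
  rw [mapCurve, mapCurve_pointChartAt hc]
  obtain ⟨j, rfl⟩ : ∃ j, i = e.symm j := ⟨e i, by simp⟩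
  rw [Equiv.apply_symm_apply, hφ']
  fin_cases j
  · simpa [mul_comm] using hq (e.symm 0)
  · simpa [mul_comm] using hq (e.symm 1)
  · simp

/-- A chain of blow-ups of points leads to a smooth curve, parametrized by its last coordinate. -/
def HasSmoothTransform (m : ℕ) (X₀ : Triple) (φ : Curve) : Prop :=
  ∃ X₁ φ₁, Relation.ReflTransGen PointBlowup (X₀, φ) (X₁, φ₁) ∧ PersistsAlong m X₁ φ₁ ∧
    PowerSeries.coeff 1 (φ₁ 2) ≠ 0

lemma HasSmoothTransform.of_pointBlowup {m : ℕ} {X₀ X' : Triple} {φ φ' : Curve}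
    (h : PointBlowup (X₀, φ) (X', φ')) (h' : HasSmoothTransform m X' φ') :
    HasSmoothTransform m X₀ φ := by
  obtain ⟨X₁, φ₁, h1, h2⟩ := h'
  exact ⟨X₁, φ₁, h1.head h, h2⟩

/-- Blow-ups of points lower the order `μ` of the curve: as long as the order stays the same, all
the coordinates are polynomials in the last coordinate `s` up to higher and higher powers of `s`,
and the parametrization would not be primitive. -/
lemma hasSmoothTransform (μ : ℕ) {m : ℕ} {X₀ : Triple} {φ : Curve} (hP : PersistsAlong m X₀ φ)
    {i : Fin 3} (hi : (φ i).order = μ) : HasSmoothTransform m X₀ φ := by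
  induction μ using Nat.strong_induction_on generalizing X₀ φ i with
  | _ μ IH =>
  -- the case of constant order, `N` bounding the number of blow-ups
  have inner : ∀ (N : ℕ) (X₀ : Triple) (φ : Curve), PersistsAlong m X₀ φ → (φ 2).order = μ →
      (¬ ∀ i, ∃ P : PowerSeries ℂ, φ 2 ^ N ∣ φ i - PowerSeries.subst (φ 2) P) →
      HasSmoothTransform m X₀ φ := by
    intro N
    induction N with
    | zero => intro X₀ φ _ _ h; exact absurd (fun i => ⟨0, by simp⟩) h
    | succ N ih =>
      intro X₀ φ hP h2 h
      have hφ0 := hP.2.1.1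
      by_cases hmin : ∀ i, (φ 2).order ≤ (φ i).order
      · have hne : φ 2 ≠ 0 := by
          intro h0; rw [h0, PowerSeries.order_zero] at h2; exact absurd h2 (by simp)
        obtain ⟨a, b, φ', hφ', hφφ', hφ'2⟩ :=
          exists_lift_pointChartAt (Equiv.refl _) hne hφ0 hmin
        obtain ⟨Y, hY, hPY, -⟩ := hP.exists_pointBlowup (Equiv.refl _) hφ' hφφ'
        simp only [Equiv.refl_symm, Equiv.refl_apply] at hφ'2 hφφ'
        refine HasSmoothTransform.of_pointBlowup hY (ih Y φ' hPY (hφ'2 ▸ h2) fun hall => h ?_)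
        have hS := PowerSeries.HasSubst.of_constantCoeff_zero' (hφ0 2)
        have step : ∀ (c : ℂ) (i j : Fin 3), φ i = (φ' j + PowerSeries.C c) * φ' 2 →
            ∃ P : PowerSeries ℂ, φ 2 ^ (N + 1) ∣ φ i - PowerSeries.subst (φ 2) P := by
          intro c i j hij
          obtain ⟨P, hP⟩ := hall j
          rw [hφ'2] at hP hij
          refine ⟨(P + PowerSeries.C c) * PowerSeries.X, ?_⟩
          rw [PowerSeries.subst_mul hS, PowerSeries.subst_add hS, PowerSeries.subst_X hS,
            PowerSeries.subst_C, hij]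
          have : (φ' j + PowerSeries.C c) * φ 2 - (PowerSeries.subst (φ 2) P + PowerSeries.C c) *
            φ 2 = (φ' j - PowerSeries.subst (φ 2) P) * φ 2 := by ring
          rw [pow_succ]
          exact this ▸ mul_dvd_mul_right hP (φ 2)
        have hφi : ∀ i, φ i = _ := fun i =>
          (congrFun hφφ' i).trans (mapCurve_pointChartAt hφ' i)
        intro i
        fin_cases i
        · exact step a 0 0 (hφi 0)
        · exact step b 1 1 (hφi 1)
        · refine ⟨PowerSeries.X, ?_⟩
          rw [PowerSeries.subst_X hS]
          simp
      · push Not at hmin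
        obtain ⟨j, hj⟩ := hmin
        have hlt : (φ j).order ≠ ⊤ := ne_top_of_lt hj
        obtain ⟨k, hk⟩ := ENat.ne_top_iff_exists.1 hlt
        refine IH k ?_ hP hk.symm
        rw [← hk, h2] at hj
        exact_mod_cast hj
  obtain ⟨j, hj⟩ := Finite.exists_min fun i => (φ i).order
  have hφ0 := hP.2.1.1
  rcases (hj i).lt_or_eq with hlt | heq
  · obtain ⟨k, hk⟩ := ENat.ne_top_iff_exists.1 (ne_top_of_lt hlt)
    refine IH k ?_ hP hk.symm
    rw [hi, ← hk] at hlt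
    exact_mod_cast hlt
  · have hjμ : (φ j).order = μ := heq.trans hi
    have hne : φ j ≠ 0 := by
      intro h0; rw [h0, PowerSeries.order_zero] at hjμ; exact absurd hjμ (by simp)
    have hej : (Equiv.swap j 2).symm 2 = j := by simp
    obtain ⟨a, b, φ', hφ', hφφ', hφ'2⟩ :=
      exists_lift_pointChartAt (Equiv.swap j 2) (by rwa [hej]) hφ0 (by rwa [hej])
    obtain ⟨Y, hY, hPY, -⟩ := hP.exists_pointBlowup (Equiv.swap j 2) hφ' hφφ'
    rw [hej] at hφ'2
    refine HasSmoothTransform.of_pointBlowup hY ?_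
    by_cases h1 : PowerSeries.coeff 1 (φ' 2) = 0
    · suffices h : ∃ N, ¬ ∀ i, ∃ P : PowerSeries ℂ, φ' 2 ^ N ∣ φ' i - PowerSeries.subst (φ' 2) P by
        obtain ⟨N, hN⟩ := h
        exact inner N Y φ' hPY (hφ'2 ▸ hjμ) hN
      by_contra! hcon
      choose P hP' using fun i => exists_eq_psubst (hφ' 2) (hφ'2.symm ▸ hne) fun N => hcon N i
      exact hPY.2.1.2 P (φ' 2) (hφ' 2) hP' h1
    · exact ⟨Y, φ', Relation.ReflTransGen.refl, hPY, h1⟩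

/-! ### Preparation of the vector field -/

lemma coeff_one_compCurve {φ : Curve} (hφ : φ.Centered) (f : Ser) :
    PowerSeries.coeff 1 (compCurve f φ) =
      ∑ k, coeff (Finsupp.single k 1) f * PowerSeries.coeff 1 (φ k) := by
  obtain ⟨g, hg, -, -⟩ := exists_eq_C_add_sum_X_mul f
  have h1 : compCurve f φ = PowerSeries.C (constantCoeff f) + ∑ k, compCurve (X k * g k) φ := by
    rw [compCurve_eq_substHom hφ]
    conv_lhs => rw [hg]
    rw [map_add, map_sum, substHom_C_curve]
    simp_rw [← compCurve_eq_substHom]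
  rw [h1, map_add, map_sum]
  simp_rw [coeff_one_compCurve_X_mul hφ, constantCoeff_of_eq_C_add_sum_X_mul hg]
  simp

/-- The multiplicity along a smooth curve is at least two, and the tangent vector of the curve is in
the kernel of the linear part. -/
lemma PersistsAlong.two_le {m : ℕ} {X₀ : Triple} {φ : Curve} (hP : PersistsAlong m X₀ φ) {j : Fin 3}
    (hj : PowerSeries.coeff 1 (φ j) ≠ 0) :
    2 ≤ m ∧ (linearPart X₀).mulVec (fun k => PowerSeries.coeff 1 (φ k)) = 0 := by
  obtain ⟨hsing, -, p, hp⟩ := hP.isNilpotentSingularity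
  obtain ⟨g, hg, hgm⟩ := hP.hasMultiplicity
  have hφ := hP.2.1.1
  set v : Fin 3 → ℂ := fun k => PowerSeries.coeff 1 (φ k) with hv
  have hg0 : PowerSeries.constantCoeff g = 0 := by
    have h1 := congrArg PowerSeries.constantCoeff (hg j)
    rw [constantCoeff_compCurve hφ, hsing j, map_mul, ← coeff_one_eq] at h1
    exact (mul_eq_zero.1 h1.symm).resolve_right hj
  have hLv : (linearPart X₀).mulVec v = PowerSeries.coeff 1 g • v := by
    funext i
    have h1 := congrArg (PowerSeries.coeff 1) (hg i)
    rw [coeff_one_compCurve hφ, coeff_one_mul, hg0, zero_mul, zero_add, ← coeff_one_eq] at h1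
    rw [Pi.smul_apply, smul_eq_mul, mul_comm]
    exact h1
  have hpow : ∀ k, ((linearPart X₀) ^ k).mulVec v = PowerSeries.coeff 1 g ^ k • v := by
    intro k
    induction k with
    | zero => simp
    | succ k ih =>
      rw [pow_succ, ← Matrix.mulVec_mulVec, hLv, Matrix.mulVec_smul, ih, smul_smul, pow_succ,
        mul_comm]
  have hg1 : PowerSeries.coeff 1 g = 0 := by
    have h1 := congrFun (hpow p) j
    rw [hp, Matrix.zero_mulVec, Pi.smul_apply, Pi.zero_apply, smul_eq_mul] at h1
    exact eq_zero_of_pow_eq_zero ((mul_eq_zero.1 h1.symm).resolve_right hj)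
  refine ⟨?_, by rw [hLv, hg1, zero_smul]⟩
  have : ((2 : ℕ) : ℕ∞) ≤ m := by
    rw [← hgm]
    refine PowerSeries.nat_le_order _ _ fun i hi => ?_
    interval_cases i
    · simpa using hg0
    · exact hg1
  exact_mod_cast this

/-- The blow-up of the origin, when the curve is smooth and transverse to `{z = 0}`. -/
lemma PersistsAlong.exists_pointBlowup_of_transverse {m : ℕ} {X₀ : Triple} {φ : Curve}
    (hP : PersistsAlong m X₀ φ) (h2 : PowerSeries.coeff 1 (φ 2) ≠ 0) :
    ∃ (a b : ℂ) (Y : Triple) (φ' : Curve), PointBlowup (X₀, φ) (Y, φ') ∧ PersistsAlong m Y φ' ∧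
      PowerSeries.coeff 1 (φ' 2) ≠ 0 ∧
      ∀ i, pushTangent (pointChartAt a b) Y i = comp (X₀ i) (pointChartAt a b) := by
  have hφ := hP.2.1.1
  obtain ⟨a, b, φ', hφ', hφφ', hφ'2⟩ := exists_lift_pointChartAt (Equiv.refl _)
    (fun h0 => h2 (by rw [Equiv.refl_symm, Equiv.refl_apply] at h0; rw [h0, map_zero])) hφ
    (fun i => by
      change (φ 2).order ≤ _
      rw [order_eq_one (hφ 2) h2]
      exact PowerSeries.one_le_order_iff_constCoeff_eq_zero.2 (hφ i))
  obtain ⟨Y, hY, hPY, hpush⟩ := hP.exists_pointBlowup (Equiv.refl _) hφ' hφφ'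
  rw [Equiv.refl_symm, Equiv.refl_apply] at hφ'2
  exact ⟨a, b, Y, φ', hY, hPY, hφ'2 ▸ h2, hpush⟩

lemma pushTangent_pointChartAt_apply {a b : ℂ} {Y X₀ : Triple}
    (h : ∀ i, pushTangent (pointChartAt a b) Y i = comp (X₀ i) (pointChartAt a b)) :
    X 2 * Y 0 + (X 0 + C a) * Y 2 = comp (X₀ 0) (pointChartAt a b) ∧
      X 2 * Y 1 + (X 1 + C b) * Y 2 = comp (X₀ 1) (pointChartAt a b) ∧
      Y 2 = comp (X₀ 2) (pointChartAt a b) := by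
  have hY : Y = ![Y 0, Y 1, Y 2] := by funext i; fin_cases i <;> rfl
  have h1 := pushTangent_pointChartAt a b (Y 0) (Y 1) (Y 2)
  rw [← hY] at h1
  refine ⟨?_, ?_, ?_⟩
  · rw [← h, h1]; rfl
  · rw [← h, h1]; rfl
  · rw [← h, h1]; rfl

/-- After `k` blow-ups, the last component of the vector field depends only on `z` up to terms
divisible by `z ^ k`. -/
lemma PersistsAlong.exists_pow_dvd_pderiv {m : ℕ} {X₀ : Triple} {φ : Curve}
    (hP : PersistsAlong m X₀ φ) (h2 : PowerSeries.coeff 1 (φ 2) ≠ 0) (k : ℕ) :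
    ∃ X₁ φ₁, Relation.ReflTransGen PointBlowup (X₀, φ) (X₁, φ₁) ∧ PersistsAlong m X₁ φ₁ ∧
      PowerSeries.coeff 1 (φ₁ 2) ≠ 0 ∧ X 2 ^ k ∣ pderiv ℂ 0 (X₁ 2) ∧
      X 2 ^ k ∣ pderiv ℂ 1 (X₁ 2) := by
  induction k with
  | zero => exact ⟨X₀, φ, Relation.ReflTransGen.refl, hP, h2, by simp, by simp⟩
  | succ k ih =>
    obtain ⟨X₁, φ₁, hc, hP₁, h₁, hd0, hd1⟩ := ih
    obtain ⟨a, b, Y, φ', hY, hPY, hφ', hpush⟩ := hP₁.exists_pointBlowup_of_transverse h₁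
    obtain ⟨-, -, hY2⟩ := pushTangent_pointChartAt_apply hpush
    refine ⟨Y, φ', hc.tail hY, hPY, hφ', ?_, ?_⟩
    all_goals
      rw [hY2, comp_eq_substHom (pointChartAt_centered a b),
        pderiv_substHom (pointChartAt_centered a b), Fin.sum_univ_three]
    · obtain ⟨q, hq⟩ := hd0
      rw [hq, map_mul, map_pow, substHom_X]
      refine ⟨substHom _ (pointChartAt_centered a b) q, ?_⟩
      simp [pointChartAt, Derivation.leibniz, MvPowerSeries.pderiv_X_of_ne]
      ring
    · obtain ⟨q, hq⟩ := hd1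
      rw [hq, map_mul, map_pow, substHom_X]
      refine ⟨substHom _ (pointChartAt_centered a b) q, ?_⟩
      simp [pointChartAt, Derivation.leibniz, MvPowerSeries.pderiv_X_of_ne]
      ring

lemma order_compCurve_X_pow_mul {φ : Curve} (hφ : φ.Centered)
    (h2 : PowerSeries.coeff 1 (φ 2) ≠ 0) (j : ℕ) (q : Ser) :
    (compCurve (X 2 ^ j * q) φ).order = j + (compCurve q φ).order := by
  rw [compCurve_eq_substHom hφ, map_mul, map_pow, substHom_X_curve, PowerSeries.order_mul,
    PowerSeries.order_pow, order_eq_one (hφ 2) h2, ← compCurve_eq_substHom]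
  simp

/-- A series which depends only on `z` up to high powers of `z` is a power of `z` up to a unit; the
exponent is read off the restriction to a transverse curve. -/
lemma exists_eq_X_pow_mul {c : Ser} {φ : Curve} {m : ℕ} (hφ : φ.Centered)
    (h2 : PowerSeries.coeff 1 (φ 2) ≠ 0) (hm : (compCurve c φ).order = m)
    (hd0 : X 2 ^ (m + 1) ∣ pderiv ℂ 0 c) (hd1 : X 2 ^ (m + 1) ∣ pderiv ℂ 1 c) :
    ∃ u, c = X 2 ^ m * u ∧ constantCoeff u ≠ 0 := by
  have hcoef : ∀ i : Fin 3, X 2 ^ (m + 1) ∣ pderiv ℂ i c →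
      ∀ n : Fin 3 →₀ ℕ, n i ≠ 0 → n 2 < m + 1 → coeff n c = 0 := by
    intro i hdi n hi hn
    have hle : Finsupp.single i 1 ≤ n := by rw [Finsupp.single_le_iff]; omega
    have h1 := MvPowerSeries.X_pow_dvd_iff.1 hdi (n - Finsupp.single i 1)
      (by rw [Finsupp.tsub_apply]; omega)
    rw [MvPowerSeries.coeff_pderiv, tsub_add_cancel_of_le hle] at h1
    refine (mul_eq_zero.1 h1).resolve_right ?_
    exact Nat.cast_add_one_ne_zero _
  have hpow : ∀ j ≤ m, X 2 ^ j ∣ c := by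
    intro j
    induction j with
    | zero => intro _; simp
    | succ j ih =>
      intro hj
      obtain ⟨q, hq⟩ := ih (by omega)
      have hq0 : constantCoeff q = 0 := by
        by_contra hq0
        have h1 := order_compCurve_X_pow_mul hφ h2 j q
        rw [← hq, hm, order_eq_zero_iff.2 (by rwa [constantCoeff_compCurve hφ]), add_zero] at h1
        have h2 : m = j := by exact_mod_cast h1
        omega
      have hX : X 2 ∣ q := by
        rw [MvPowerSeries.X_dvd_iff]
        intro n hn
        have e : coeff n q = coeff (Finsupp.single 2 j + n) c := by
          rw [hq, MvPowerSeries.X_pow_eq, MvPowerSeries.coeff_add_monomial_mul, one_mul]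
        by_cases h0 : n 0 = 0
        · by_cases h1 : n 1 = 0
          · have : n = 0 := by ext i; fin_cases i <;> simp [h0, h1, hn]
            simpa [this] using hq0
          · rw [e]
            exact hcoef 1 hd1 _ (by simp [h1]) (by simp [hn]; omega)
        · rw [e]
          exact hcoef 0 hd0 _ (by simp [h0]) (by simp [hn]; omega)
      obtain ⟨q', rfl⟩ := hX
      exact ⟨q', by rw [hq]; ring⟩
  obtain ⟨u, hu⟩ := hpow m le_rfl
  refine ⟨u, hu, ?_⟩
  have h1 := order_compCurve_X_pow_mul hφ h2 m u
  rw [← hu, hm] at h1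
  rw [← constantCoeff_compCurve hφ, ← order_eq_zero_iff]
  generalize (compCurve u φ).order = o at h1 ⊢
  cases o with
  | top => simp at h1
  | coe o =>
    have h4 : m = m + o := by exact_mod_cast h1
    have h5 : o = 0 := by omega
    exact_mod_cast h5

/-- The vector field `X₀` is linear in `x, y` modulo `z` in the first two components, the linear forms
being `α i x + β i y`, and is `z ^ m` times a unit in the last component, the unit being equal to the
constant `c` on `{z = 0}`. -/
structure IsPrepared (m : ℕ) (X₀ : Triple) (α β : Fin 2 → ℂ) (c : ℂ) (q : Triple) : Prop where
  two_le : 2 ≤ m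
  ne_zero : c ≠ 0
  conv : ∀ i, IsConvergent (q i)
  eq_zero : X₀ 0 = C (α 0) * X 0 + C (β 0) * X 1 + X 2 * q 0
  eq_one : X₀ 1 = C (α 1) * X 0 + C (β 1) * X 1 + X 2 * q 1
  eq_two : X₀ 2 = X 2 ^ m * (C c + X 2 * q 2)

lemma exists_comp_pointChartAt (a b : ℂ) {f : Ser} (hf : IsConvergent f) :
    ∃ k, IsConvergent k ∧ comp f (pointChartAt a b) = C (constantCoeff f) + X 2 * k := by
  have h0 := pointChartAt_centered a b
  have hc := isConvergent_pointChartAt a b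
  obtain ⟨g, hg, hgc, -⟩ := exists_eq_C_add_sum_X_mul f
  have hXa := (isConvergent_X 0).add (isConvergent_C a)
  have hXb := (isConvergent_X 1).add (isConvergent_C b)
  refine ⟨(X 0 + C a) * comp (g 0) (pointChartAt a b) +
    (X 1 + C b) * comp (g 1) (pointChartAt a b) + comp (g 2) (pointChartAt a b),
    ((hXa.mul ((hgc hf 0).comp hc h0)).add (hXb.mul ((hgc hf 1).comp hc h0))).add
      ((hgc hf 2).comp hc h0), ?_⟩
  rw [comp_eq_substHom h0, substHom_decomp h0 hg, Fin.sum_univ_three]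
  simp only [← comp_eq_substHom]
  have e0 : pointChartAt a b 0 = (X 0 + C a) * X 2 := rfl
  have e1 : pointChartAt a b 1 = (X 1 + C b) * X 2 := rfl
  have e2 : pointChartAt a b 2 = X 2 := rfl
  rw [e0, e1, e2]
  ring

/-- Once the curve is smooth and the last component is `z ^ m` up to a unit, one more blow-up prepares
the vector field: the substitution `(x z, y z, z)` makes everything affine in `x, y` modulo `z`. -/
lemma PersistsAlong.exists_isPrepared {m : ℕ} {X₀ : Triple} {φ : Curve}
    (hP : PersistsAlong m X₀ φ) :
    ∃ X₁ φ₁ α β c q, Relation.ReflTransGen PointBlowup (X₀, φ) (X₁, φ₁) ∧ PersistsAlong m X₁ φ₁ ∧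
      PowerSeries.coeff 1 (φ₁ 2) ≠ 0 ∧ IsPrepared m X₁ α β c q := by
  obtain ⟨i, hi⟩ := hP.2.1.ne_zero
  obtain ⟨μ, hμ⟩ := ENat.ne_top_iff_exists.1 (mt PowerSeries.order_eq_top.1 hi)
  obtain ⟨X₁, φ₁, hc₁, hP₁, h₁⟩ := hasSmoothTransform μ hP hμ.symm
  obtain ⟨X₂, φ₂, hc₂, hP₂, h₂, hd0, hd1⟩ := hP₁.exists_pow_dvd_pderiv h₁ (m + 1)
  obtain ⟨a, b, Y, φ', hY, hPY, hφ', hpush⟩ := hP₂.exists_pointBlowup_of_transverse h₂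
  have hφ₂ := hP₂.2.1.1
  obtain ⟨g, hg, hgm⟩ := hP₂.hasMultiplicity
  have hm : (compCurve (X₂ 2) φ₂).order = m := by
    have h0 : (PowerSeries.derivative ℂ (φ₂ 2)).order = 0 :=
      order_eq_zero_iff.2 (by rwa [← coeff_one_eq])
    rw [hg, PowerSeries.order_mul, hgm, h0, add_zero]
  obtain ⟨u, hu, hu0⟩ := exists_eq_X_pow_mul hφ₂ h₂ hm hd0 hd1
  have huc : IsConvergent u := isConvergent_of_X_pow_mul (hu ▸ hP₂.1.1 2)
  obtain ⟨hY0, hY1, hY2⟩ := pushTangent_pointChartAt_apply hpush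
  have hm2 := (hPY.two_le hφ').1
  obtain ⟨u', hu'c, hu'⟩ := exists_comp_pointChartAt a b huc
  have hY2' : Y 2 = X 2 ^ m * (C (constantCoeff u) + X 2 * u') := by
    rw [hY2, hu, ← hu', comp_eq_substHom (pointChartAt_centered a b), map_mul, map_pow, substHom_X,
      ← comp_eq_substHom]
    rfl
  obtain ⟨l, rfl⟩ : ∃ l, m = l + 2 := ⟨m - 2, by omega⟩
  -- the first two components are affine in `x, y` modulo `z`, and vanish at the origin
  have key : ∀ (i i' : Fin 3) (d : ℂ), X 2 * Y i + (X i' + C d) * Y 2 =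
      comp (X₂ i) (pointChartAt a b) → ∃ (α β : ℂ) (q : Ser), IsConvergent q ∧
      Y i = C α * X 0 + C β * X 1 + X 2 * q := by
    intro i i' d hYi
    have hsing := hP₂.isNilpotentSingularity.1 i
    have hXc := hP₂.1.1 i
    obtain ⟨A, hA, hAc, -⟩ := exists_eq_C_add_sum_X_mul (X₂ i)
    choose k hkc hk using fun j => exists_comp_pointChartAt a b (hAc hXc j)
    set A0 := fun j => constantCoeff (A j) with hA0
    have e0 : pointChartAt a b 0 = (X 0 + C a) * X 2 := rfl
    have e1 : pointChartAt a b 1 = (X 1 + C b) * X 2 := rfl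
    have e2 : pointChartAt a b 2 = X 2 := rfl
    have h1 := substHom_decomp (pointChartAt_centered a b) hA
    simp only [← comp_eq_substHom, Fin.sum_univ_three, hsing, map_zero, hk, e0, e1, e2] at h1
    have hw : X 2 * Y i = X 2 * (C (A0 0) * X 0 + C (A0 1) * X 1 + X 2 * ((X 0 + C a) * k 0 +
        (X 1 + C b) * k 1 + k 2 - (X i' + C d) * (X 2 ^ l * (C (constantCoeff u) + X 2 * u'))) +
        C (A0 0 * a + A0 1 * b + A0 2)) := by
      simp only [map_add, map_mul]
      linear_combination hYi + h1 - (X i' + C d) * hY2'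
    have hw2 := mul_left_cancel₀ (X_ne_zero 2) hw
    have hz : A0 0 * a + A0 1 * b + A0 2 = 0 := by
      have h3 := congrArg constantCoeff hw2
      rw [hPY.isNilpotentSingularity.1 i] at h3
      simpa using h3.symm
    rw [hz, map_zero, add_zero] at hw2
    refine ⟨A0 0, A0 1, _, ?_, hw2⟩
    have hX := fun j => isConvergent_X j
    have hC := fun c => isConvergent_C c
    exact (((((hX 0).add (hC a)).mul (hkc 0)).add (((hX 1).add (hC b)).mul (hkc 1))).add
      (hkc 2)).sub (((hX i').add (hC d)).mul (((hX 2).pow l).mul ((hC _).add ((hX 2).mul hu'c))))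
  obtain ⟨α0, β0, q0, hq0, hYq0⟩ := key 0 0 a hY0
  obtain ⟨α1, β1, q1, hq1, hYq1⟩ := key 1 1 b hY1
  refine ⟨Y, φ', ![α0, α1], ![β0, β1], constantCoeff u, ![q0, q1, u'],
    (hc₁.trans hc₂).tail hY, hPY, hφ', hm2, hu0, ?_, hYq0, hYq1, hY2'⟩
  intro i
  fin_cases i
  exacts [hq0, hq1, hu'c]

/-! ### The normal form -/

lemma le_order_iff_X_pow_dvd {f : PowerSeries ℂ} {n : ℕ} :
    (n : ℕ∞) ≤ f.order ↔ PowerSeries.X ^ n ∣ f := by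
  rw [PowerSeries.X_pow_dvd_iff]
  refine ⟨fun h k hk => PowerSeries.coeff_of_lt_order k (lt_of_lt_of_le ?_ h),
    fun h => PowerSeries.nat_le_order _ _ h⟩
  exact_mod_cast hk

lemma X_pow_dvd_compCurve_sub {φ ψ : Curve} (hφ : φ.Centered) (hψ : ψ.Centered) {n : ℕ}
    (h : ∀ i, PowerSeries.X ^ n ∣ φ i - ψ i) (f : Ser) :
    PowerSeries.X ^ n ∣ compCurve f φ - compCurve f ψ := by
  rw [← le_order_iff_X_pow_dvd, compCurve_eq_substHom hφ, compCurve_eq_substHom hψ,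
    PowerSeries.order_eq_order]
  refine le_order_substHom_sub hφ hψ (fun i => ?_) f
  rw [← PowerSeries.order_eq_order, le_order_iff_X_pow_dvd]
  exact h i

/-- The restriction of `f` to the `z`-axis is determined, up to high order, by the restriction of `f`
to a curve with high contact with the `z`-axis. -/
lemma X_pow_dvd_compCurve_zAxis {ψ : Curve} (hψ : ψ.Centered)
    (h2 : PowerSeries.coeff 1 (ψ 2) ≠ 0) {n : ℕ} (h0 : PowerSeries.X ^ n ∣ ψ 0)
    (h1 : PowerSeries.X ^ n ∣ ψ 1) {f : Ser} (hf : PowerSeries.X ^ n ∣ compCurve f ψ) :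
    PowerSeries.X ^ n ∣ compCurve f zAxis := by
  have hS := PowerSeries.HasSubst.of_constantCoeff_zero' (hψ 2)
  have hax : (fun i => PowerSeries.subst (ψ 2) (zAxis i)) = (![0, 0, ψ 2] : Curve) := by
    funext i
    fin_cases i
    · simp [zAxis, ← PowerSeries.coe_substAlgHom hS]
    · simp [zAxis, ← PowerSeries.coe_substAlgHom hS]
    · simp [zAxis, PowerSeries.subst_X hS]
  have hz0 : zAxis.Centered := fun i => by fin_cases i <;> simp [zAxis]
  have hψ2 : Curve.Centered ![0, 0, ψ 2] := fun i => by fin_cases i <;> simp [hψ 2]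
  have hcomp : PowerSeries.subst (ψ 2) (compCurve f zAxis) = compCurve f ![0, 0, ψ 2] := by
    rw [← hax]
    exact MvPowerSeries.subst_comp_subst_apply (hasSubst_of_zero hz0) hS.const f
  have h3 : PowerSeries.X ^ n ∣ compCurve f ψ - compCurve f ![0, 0, ψ 2] :=
    X_pow_dvd_compCurve_sub hψ hψ2 (fun i => by fin_cases i <;> simp [h0, h1]) f
  have hψ0 : ψ 2 ≠ 0 := fun h => h2 (by simp [h])
  refine X_pow_dvd_of_pow_dvd_psubst (hψ 2) hψ0 (dvd_trans ?_ (hcomp ▸ (dvd_sub_right hf).1 h3))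
  refine pow_dvd_pow_of_dvd (dvd_of_order_le ?_ hψ0) n
  rw [order_eq_one (hψ 2) h2, PowerSeries.order_X]

/-- A series without constant term is approximated by polynomials in any series of order one. -/
lemma exists_polynomial_approx {s f : PowerSeries ℂ} (hs : PowerSeries.constantCoeff s = 0)
    (hs1 : PowerSeries.coeff 1 s ≠ 0) (hf : PowerSeries.constantCoeff f = 0) (n : ℕ) :
    ∃ P : Polynomial ℂ, PowerSeries.X ^ (n + 1) ∣ f - s * Polynomial.aeval s P := by
  obtain ⟨t, rfl⟩ := PowerSeries.X_dvd_iff.2 hs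
  have ht : PowerSeries.constantCoeff t ≠ 0 := by simpa [coeff_one_mul] using hs1
  induction n with
  | zero => exact ⟨0, by simpa using PowerSeries.X_dvd_iff.2 hf⟩
  | succ n ih =>
    obtain ⟨P, r, hr⟩ := ih
    set d := PowerSeries.constantCoeff r / PowerSeries.constantCoeff t ^ (n + 1) with hd
    refine ⟨P + Polynomial.C d * Polynomial.X ^ n, ?_⟩
    have hC : algebraMap ℂ (PowerSeries ℂ) d = PowerSeries.C d := rfl
    have h1 : f - PowerSeries.X * t * Polynomial.aeval (PowerSeries.X * t)
        (P + Polynomial.C d * Polynomial.X ^ n) =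
        PowerSeries.X ^ (n + 1) * (r - PowerSeries.C d * t ^ (n + 1)) := by
      rw [map_add, map_mul, map_pow, Polynomial.aeval_X, Polynomial.aeval_C, hC]
      linear_combination hr
    rw [h1, pow_succ _ (n + 1)]
    refine mul_dvd_mul_left _ (PowerSeries.X_dvd_iff.2 ?_)
    have : PowerSeries.constantCoeff t ^ (n + 1) ≠ 0 := pow_ne_zero _ ht
    simp [hd, this]

/-- A linear change of the coordinates `x, y` which puts the part `α x + β y` of a prepared foliation
in the form `(c y, 0)`. -/
lemma IsPrepared.exists_matrix {m : ℕ} {X₀ : Triple} {φ : Curve} {α β : Fin 2 → ℂ} {c : ℂ}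
    {q : Triple} (h : IsPrepared m X₀ α β c q) (hP : PersistsAlong m X₀ φ)
    (h2 : PowerSeries.coeff 1 (φ 2) ≠ 0) :
    ∃ p₁₁ p₁₂ p₂₁ p₂₂ : ℂ, p₁₁ * p₂₂ - p₁₂ * p₂₁ ≠ 0 ∧
      α 0 * p₁₁ + β 0 * p₂₁ = 0 ∧ α 1 * p₁₁ + β 1 * p₂₁ = 0 ∧
      α 0 * p₁₂ + β 0 * p₂₂ = c * p₁₁ ∧ α 1 * p₁₂ + β 1 * p₂₂ = c * p₂₁ := by
  obtain ⟨hm, hker⟩ := hP.two_le h2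
  obtain ⟨-, hne, hnil⟩ := hP.isNilpotentSingularity
  obtain ⟨l, rfl⟩ : ∃ l, m = l + 2 := ⟨m - 2, by omega⟩
  have hL : linearPart X₀ = !![α 0, β 0, constantCoeff (q 0); α 1, β 1, constantCoeff (q 1);
      0, 0, 0] := by
    ext i j
    simp only [linearPart, Matrix.of_apply, coeff_single_eq]
    fin_cases i <;> fin_cases j <;>
      simp [h.eq_zero, h.eq_one, h.eq_two, Derivation.leibniz, Derivation.leibniz_pow,
        MvPowerSeries.pderiv_X_of_ne, pow_succ]
  rw [hL] at hker hne hnil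
  have ht1 := (Matrix.isNilpotent_trace_of_isNilpotent hnil).eq_zero
  have ht2 := (Matrix.isNilpotent_trace_of_isNilpotent (hnil.pow_succ 1)).eq_zero
  simp [Matrix.trace_fin_three, pow_two] at ht1 ht2
  have hk0 := congrFun hker 0
  have hk1 := congrFun hker 1
  simp [Matrix.mulVec, dotProduct, Fin.sum_univ_three] at hk0 hk1
  have hβ1 : β 1 = -α 0 := by linear_combination ht1
  rw [hβ1] at ht2 hk1
  have hdet : α 0 ^ 2 + β 0 * α 1 = 0 := by linear_combination ht2 / 2
  have hc := h.ne_zero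
  by_cases hα1 : α 1 = 0
  · have hα0 : α 0 = 0 := by simpa [hα1] using hdet
    have hβ0 : β 0 ≠ 0 := by
      intro hβ0
      apply hne
      have e0 : constantCoeff (q 0) = 0 := by simpa [hα0, hβ0, h2] using hk0
      have e1 : constantCoeff (q 1) = 0 := by simpa [hα0, hα1, h2] using hk1
      ext i j
      fin_cases i <;> fin_cases j <;> simp [hα0, hα1, hβ0, hβ1, e0, e1]
    exact ⟨β 0, 0, 0, c, by simp [hβ0, hc], by simp [hα0], by simp [hα1], by ring,
      by simp [hβ1, hα0]⟩
  · refine ⟨α 0, c, α 1, 0, by simp [hα1, hc], by linear_combination hdet, ?_, by ring, by ring⟩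
    rw [hβ1]; ring

lemma isConvergent_aeval_X (P : Polynomial ℂ) (j : Fin 3) :
    IsConvergent (Polynomial.aeval (X j : Ser) P) := by
  rw [Polynomial.aeval_eq_sum_range]
  refine IsConvergent.sum fun i _ => ?_
  rw [MvPowerSeries.smul_eq_C_mul]
  exact (isConvergent_C _).mul ((isConvergent_X j).pow i)

lemma compCurve_aeval_X {φ : Curve} (hφ : φ.Centered) (P : Polynomial ℂ) (j : Fin 3) :
    compCurve (Polynomial.aeval (X j : Ser) P) φ = Polynomial.aeval (φ j) P := by
  rw [compCurve_eq_substHom hφ, ← Polynomial.aeval_algHom_apply, substHom_X_curve]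

/-- The coordinate change `(x, y, z) ↦ (p₁₁ x + p₁₂ y + z P(z), p₂₁ x + p₂₂ y + z Q(z), z)`. -/
def shear (p₁₁ p₁₂ p₂₁ p₂₂ : ℂ) (P Q : Polynomial ℂ) : Triple :=
  ![C p₁₁ * X 0 + C p₁₂ * X 1 + X 2 * Polynomial.aeval (X 2 : Ser) P,
    C p₂₁ * X 0 + C p₂₂ * X 1 + X 2 * Polynomial.aeval (X 2 : Ser) Q, X 2]

section
variable (p₁₁ p₁₂ p₂₁ p₂₂ : ℂ) (P Q : Polynomial ℂ)

lemma isBiholomorphism_shear (hdet : p₁₁ * p₂₂ - p₁₂ * p₂₁ ≠ 0) :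
    IsBiholomorphism (shear p₁₁ p₁₂ p₂₁ p₂₂ P Q) := by
  have hX := fun j => isConvergent_X j
  have hC := fun c => isConvergent_C c
  have hA := fun P => isConvergent_aeval_X P 2
  refine ⟨fun i => ?_, fun i => ?_, ?_⟩
  · fin_cases i
    exacts [(((hC _).mul (hX 0)).add ((hC _).mul (hX 1))).add ((hX 2).mul (hA P)),
      (((hC _).mul (hX 0)).add ((hC _).mul (hX 1))).add ((hX 2).mul (hA Q)), hX 2]
  · fin_cases i <;> simp [shear]
  · rw [Matrix.det_fin_three]
    simp only [linearPart, Matrix.of_apply, coeff_single_eq]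
    simpa [shear, Derivation.leibniz, MvPowerSeries.pderiv_X_of_ne] using hdet

lemma pushTangent_shear : ∃ p q, IsConvergent p ∧ IsConvergent q ∧ ∀ A B D,
    pushTangent (shear p₁₁ p₁₂ p₂₁ p₂₂ P Q) ![A, B, D] =
      ![C p₁₁ * A + C p₁₂ * B + p * D, C p₂₁ * A + C p₂₂ * B + q * D, D] := by
  refine ⟨pderiv ℂ 2 (X 2 * Polynomial.aeval (X 2 : Ser) P),
    pderiv ℂ 2 (X 2 * Polynomial.aeval (X 2 : Ser) Q),
    ((isConvergent_X 2).mul (isConvergent_aeval_X P 2)).pderiv 2,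
    ((isConvergent_X 2).mul (isConvergent_aeval_X Q 2)).pderiv 2, fun A B D => ?_⟩
  funext i
  fin_cases i <;>
    simp [pushTangent, Fin.sum_univ_three, shear, Derivation.leibniz,
      MvPowerSeries.pderiv_X_of_ne]

/-- After a shear which puts its linear part in normal form, a prepared foliation is in normal form;
`w` is the invertible factor. -/
lemma IsPrepared.exists_normalForm {m : ℕ} {X₀ : Triple} {α β : Fin 2 → ℂ} {c : ℂ} {q : Triple}
    (h : IsPrepared m X₀ α β c q) (hdet : p₁₁ * p₂₂ - p₁₂ * p₂₁ ≠ 0)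
    (h1 : α 0 * p₁₁ + β 0 * p₂₁ = 0) (h2 : α 1 * p₁₁ + β 1 * p₂₁ = 0)
    (h3 : α 0 * p₁₂ + β 0 * p₂₂ = c * p₁₁) (h4 : α 1 * p₁₂ + β 1 * p₂₂ = c * p₂₁) :
    ∃ f g w, IsConvergent f ∧ IsConvergent g ∧ IsConvergent w ∧ constantCoeff w ≠ 0 ∧
      ∀ i, w * pushTangent (shear p₁₁ p₁₂ p₂₁ p₂₂ P Q) (normalForm m f g) i =
        comp (X₀ i) (shear p₁₁ p₁₂ p₂₁ p₂₂ P Q) := by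
  obtain ⟨hHc, hH0, -⟩ := isBiholomorphism_shear p₁₁ p₁₂ p₂₁ p₂₂ P Q hdet
  set H := shear p₁₁ p₁₂ p₂₁ p₂₂ P Q with hH
  have e0 : H 0 = C p₁₁ * X 0 + C p₁₂ * X 1 + X 2 * Polynomial.aeval (X 2 : Ser) P := rfl
  have e1 : H 1 = C p₂₁ * X 0 + C p₂₂ * X 1 + X 2 * Polynomial.aeval (X 2 : Ser) Q := rfl
  have e2 : H 2 = X 2 := rfl
  have hqc := fun i => (h.conv i).comp hHc hH0
  have hX := fun j => isConvergent_X j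
  have hC := fun c => isConvergent_C c
  have hP := isConvergent_aeval_X P 2
  have hQ := isConvergent_aeval_X Q 2
  obtain ⟨l, rfl⟩ : ∃ l, m = l + 2 := ⟨m - 2, by have := h.two_le; omega⟩
  -- both components are of the form `c pᵢ₁ y + z Aᵢ`
  have key : ∀ (i : Fin 3) (a b p : ℂ), a * p₁₁ + b * p₂₁ = 0 → a * p₁₂ + b * p₂₂ = c * p →
      X₀ i = C a * X 0 + C b * X 1 + X 2 * q i →
      ∃ A, IsConvergent A ∧ comp (X₀ i) H = C c * C p * X 1 + X 2 * A := by
    intro i a b p ha hb hi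
    refine ⟨C a * Polynomial.aeval (X 2 : Ser) P + C b * Polynomial.aeval (X 2 : Ser) Q +
      comp (q i) H, (((hC a).mul hP).add ((hC b).mul hQ)).add (hqc i), ?_⟩
    have ha' := congrArg (C (σ := Fin 3) (R := ℂ)) ha
    have hb' := congrArg (C (σ := Fin 3) (R := ℂ)) hb
    simp only [map_add, map_mul, map_zero] at ha' hb'
    rw [hi, comp_eq_substHom hH0]
    simp only [map_add, map_mul, substHom_X, substHom_C, ← comp_eq_substHom, e0, e1, e2]
    linear_combination X 0 * ha' + X 1 * hb'
  obtain ⟨A₀, hA₀c, hA₀⟩ := key 0 _ _ _ h1 h3 h.eq_zero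
  obtain ⟨A₁, hA₁c, hA₁⟩ := key 1 _ _ _ h2 h4 h.eq_one
  set w := C c + X 2 * comp (q 2) H with hw
  have hwc : IsConvergent w := (hC c).add ((hX 2).mul (hqc 2))
  have hw0 : constantCoeff w ≠ 0 := by simpa [hw] using h.ne_zero
  have hwi : w * w⁻¹ = 1 := MvPowerSeries.mul_inv_cancel _ hw0
  have hA₂ : comp (X₀ 2) H = w * X 2 ^ (l + 2) := by
    rw [h.eq_two, comp_eq_substHom hH0, map_mul, map_pow, map_add, map_mul, substHom_X, substHom_C,
      ← comp_eq_substHom, hw, e2]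
    ring
  obtain ⟨p, q', hpc, hqc', hpush⟩ := pushTangent_shear p₁₁ p₁₂ p₂₁ p₂₂ P Q
  set B₀ := A₀ - w * p * X 2 ^ (l + 1) - comp (q 2) H * C p₁₁ * X 1 with hB₀
  set B₁ := A₁ - w * q' * X 2 ^ (l + 1) - comp (q 2) H * C p₂₁ * X 1 with hB₁
  have hB₀c : IsConvergent B₀ :=
    (hA₀c.sub ((hwc.mul hpc).mul ((hX 2).pow _))).sub (((hqc 2).mul (hC _)).mul (hX 1))
  have hB₁c : IsConvergent B₁ :=
    (hA₁c.sub ((hwc.mul hqc').mul ((hX 2).pow _))).sub (((hqc 2).mul (hC _)).mul (hX 1))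
  set d := (p₁₁ * p₂₂ - p₁₂ * p₂₁)⁻¹ with hd
  have hdd : (C p₁₁ * C p₂₂ - C p₁₂ * C p₂₁) * (C d : Ser) = 1 := by
    rw [← map_mul, ← map_mul, ← map_sub, ← map_mul, mul_inv_cancel₀ hdet, map_one]
  have hwic := hwc.inv hw0
  -- Cramer's rule
  refine ⟨w⁻¹ * C d * (C p₂₂ * B₀ - C p₁₂ * B₁), w⁻¹ * C d * (C p₁₁ * B₁ - C p₂₁ * B₀), w,
    (hwic.mul (hC d)).mul (((hC _).mul hB₀c).sub ((hC _).mul hB₁c)),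
    (hwic.mul (hC d)).mul (((hC _).mul hB₁c).sub ((hC _).mul hB₀c)), hwc, hw0, fun i => ?_⟩
  rw [normalForm, hpush, y_eq, z_eq]
  fin_cases i
  · change w * (C p₁₁ * (X 1 + X 2 * _) + C p₁₂ * (X 2 * _) + p * X 2 ^ (l + 2)) = comp (X₀ 0) H
    rw [hA₀]
    linear_combination C p₁₁ * X 1 * hw + X 2 * hB₀ + X 2 * B₀ * hdd + X 2 * B₀ * hwi *
      ((C p₁₁ * C p₂₂ - C p₁₂ * C p₂₁) * C d)
  · change w * (C p₂₁ * (X 1 + X 2 * _) + C p₂₂ * (X 2 * _) + q' * X 2 ^ (l + 2)) = comp (X₀ 1) H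
    rw [hA₁]
    linear_combination C p₂₁ * X 1 * hw + X 2 * hB₁ + X 2 * B₁ * hdd + X 2 * B₁ * hwi *
      ((C p₁₁ * C p₂₂ - C p₁₂ * C p₂₁) * C d)
  · exact hA₂.symm

end

/-- The coordinates `ψ` of a transverse curve after a shear can be given any contact with the
`z`-axis. -/
lemma exists_shear_contact {φ : Curve} (hφ : φ.Centered) (h2 : PowerSeries.coeff 1 (φ 2) ≠ 0)
    {p₁₁ p₁₂ p₂₁ p₂₂ : ℂ} (hdet : p₁₁ * p₂₂ - p₁₂ * p₂₁ ≠ 0) (n : ℕ) :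
    ∃ (P Q : Polynomial ℂ) (ψ : Curve), ψ.Centered ∧ ψ 2 = φ 2 ∧
      φ = mapCurve (shear p₁₁ p₁₂ p₂₁ p₂₂ P Q) ψ ∧
      PowerSeries.X ^ (n + 1) ∣ ψ 0 ∧ PowerSeries.X ^ (n + 1) ∣ ψ 1 := by
  obtain ⟨P, r, hP⟩ := exists_polynomial_approx (hφ 2) h2 (hφ 0) n
  obtain ⟨Q, s, hQ⟩ := exists_polynomial_approx (hφ 2) h2 (hφ 1) n
  set d := (p₁₁ * p₂₂ - p₁₂ * p₂₁)⁻¹ with hd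
  have hdd : (PowerSeries.C p₁₁ * PowerSeries.C p₂₂ - PowerSeries.C p₁₂ * PowerSeries.C p₂₁) *
      PowerSeries.C d = 1 := by
    rw [← map_mul, ← map_mul, ← map_sub, ← map_mul, mul_inv_cancel₀ hdet, map_one]
  set ψ : Curve := ![PowerSeries.X ^ (n + 1) *
      (PowerSeries.C d * (PowerSeries.C p₂₂ * r - PowerSeries.C p₁₂ * s)),
    PowerSeries.X ^ (n + 1) *
      (PowerSeries.C d * (PowerSeries.C p₁₁ * s - PowerSeries.C p₂₁ * r)), φ 2] with hψ
  have hψ0 : ψ.Centered := fun i => by fin_cases i <;> simp [hψ, hφ 2]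
  refine ⟨P, Q, ψ, hψ0, rfl, ?_, ⟨_, rfl⟩, ⟨_, rfl⟩⟩
  have hcomp : ∀ (a b : ℂ) (R : Polynomial ℂ), compCurve (C a * X 0 + C b * X 1 +
      X 2 * Polynomial.aeval (X 2 : Ser) R) ψ = PowerSeries.C a * ψ 0 + PowerSeries.C b * ψ 1 +
      φ 2 * Polynomial.aeval (φ 2) R := by
    intro a b R
    rw [compCurve_eq_substHom hψ0]
    simp only [map_add, map_mul, substHom_C_curve, substHom_X_curve]
    rw [← compCurve_eq_substHom, compCurve_aeval_X hψ0]
    rfl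
  have e0 : ψ 0 = PowerSeries.X ^ (n + 1) *
      (PowerSeries.C d * (PowerSeries.C p₂₂ * r - PowerSeries.C p₁₂ * s)) := rfl
  have e1 : ψ 1 = PowerSeries.X ^ (n + 1) *
      (PowerSeries.C d * (PowerSeries.C p₁₁ * s - PowerSeries.C p₂₁ * r)) := rfl
  funext i
  fin_cases i
  · refine Eq.trans ?_ (hcomp p₁₁ p₁₂ P).symm
    simp only [Fin.zero_eta, e0, e1]
    linear_combination hP - PowerSeries.X ^ (n + 1) * r * hdd
  · refine Eq.trans ?_ (hcomp p₂₁ p₂₂ Q).symm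
    simp only [Fin.mk_one, e0, e1]
    linear_combination hQ - PowerSeries.X ^ (n + 1) * s * hdd
  · exact (compCurve_X hψ0 2).symm

/-- If `∂g/∂x(0) = 0`, blowing up the `x`-axis produces a singular point with zero linear part. -/
lemma PersistsAlong.constantCoeff_pderiv_ne_zero {m : ℕ} {X₀ H : Triple} {φ ψ : Curve} {f g w : Ser}
    (hP : PersistsAlong m X₀ φ) (hm : 2 ≤ m) (hH : IsBiholomorphism H) (hf : IsConvergent f)
    (hg : IsConvergent g) (hw : IsConvergent w)
    (hf0 : constantCoeff f = 0) (hg0 : constantCoeff g = 0)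
    (hg2 : coeff (Finsupp.single 2 1) g = 0)
    (hrep : ∀ i, w * pushTangent H (normalForm m f g) i = comp (X₀ i) H)
    (hψ : ψ.Centered) (hψ2 : PowerSeries.coeff 1 (ψ 2) ≠ 0) (hψ1 : PowerSeries.X ^ 2 ∣ ψ 1)
    (hφ : φ = mapCurve H ψ) : constantCoeff (pderiv ℂ 0 g) ≠ 0 := by
  intro hgx
  obtain ⟨hHc, hH0, hHd⟩ := hH
  have hρ := curveChart_centered
  have hρc := isConvergent_curveChart
  obtain ⟨l, rfl⟩ : ∃ l, m = l + 2 := ⟨m - 2, by omega⟩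
  have hX := fun j => isConvergent_X j
  set F := comp f curveChart with hF
  set G := comp g curveChart with hG
  have hFc : IsConvergent F := hf.comp hρc hρ
  have hGc : IsConvergent G := hg.comp hρc hρ
  -- the transform of the normal form by the blow-up
  set V : Triple := ![X 2 * (X 1 + F), G - X 1 * X 2 ^ (l + 1), X 2 ^ (l + 2)] with hV
  have hVc : ∀ i, IsConvergent (V i) := by
    intro i
    fin_cases i
    exacts [(hX 2).mul ((hX 1).add hFc), hGc.sub ((hX 1).mul ((hX 2).pow _)), (hX 2).pow _]
  have hNF : ∀ i, 1 * pushTangent curveChart V i =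
      1 * comp (normalForm (l + 2) f g i) curveChart := by
    intro i
    rw [one_mul, one_mul, normalForm_eq]
    refine Eq.trans ?_ (congrFun (comp_modelField hρ) i).symm
    have e1 : comp 1 curveChart = 1 := by rw [comp_eq_substHom hρ, map_one]
    rw [e1, ← hF, ← hG]
    fin_cases i <;>
      simp [pushTangent, Fin.sum_univ_three, curveChart, x_eq, y_eq, z_eq, hV, Derivation.leibniz,
        MvPowerSeries.pderiv_X_of_ne] <;> ring
  have hpush : ∀ i, pushTangent (fun i => comp (H i) curveChart) (fun i => comp w curveChart * V i) i
      = comp (X₀ i) (fun i => comp (H i) curveChart) := by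
    intro i
    have h1 := pushTangent_comp_eq hH0 hρ hNF (a' := w) (b' := 1)
      (fun i => by rw [one_mul]; exact hrep i) i
    have e1 : comp 1 curveChart = 1 := by rw [comp_eq_substHom hρ, map_one]
    rw [one_mul, e1, one_mul, one_mul] at h1
    rw [← h1]
    simp only [pushTangent, Finset.mul_sum]
    exact Finset.sum_congr rfl fun j _ => by ring
  -- the lift of the curve
  obtain ⟨s, hs⟩ : ψ 2 ∣ ψ 1 := by
    have hne : ψ 2 ≠ 0 := fun h => hψ2 (by simp [h])
    refine dvd_of_order_le ?_ hne
    rw [order_eq_one (hψ 2) hψ2]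
    have : ((2 : ℕ) : ℕ∞) ≤ (ψ 1).order := le_order_iff_X_pow_dvd.2 hψ1
    exact le_trans (by norm_num) this
  have hs0 : PowerSeries.constantCoeff s = 0 := by
    have h1 : PowerSeries.coeff 1 (ψ 1) = 0 := PowerSeries.X_pow_dvd_iff.1 hψ1 1 (by norm_num)
    rw [hs, coeff_one_mul, hψ 2, zero_mul, zero_add] at h1
    exact (mul_eq_zero.1 h1).resolve_right hψ2
  have hφ'0 : Curve.Centered ![ψ 0, s, ψ 2] := fun i => by
    fin_cases i
    exacts [hψ 0, hs0, hψ 2]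
  have hlift : ψ = mapCurve curveChart ![ψ 0, s, ψ 2] := by
    funext i
    rw [mapCurve, compCurve_eq_substHom hφ'0]
    fin_cases i <;> simp [curveChart, x_eq, y_eq, z_eq, substHom_X_curve, hs, mul_comm]
  have hφ' : φ = mapCurve (fun i => comp (H i) curveChart) ![ψ 0, s, ψ 2] := by
    rw [mapCurve_comp hφ'0 hρ, ← hlift, hφ]
  -- the center is contained in the singular set
  have hT : Curve.Centered ![PowerSeries.X, 0, 0] := fun i => by fin_cases i <;> simp
  have hcenter : ∀ i, compCurve (X₀ i) (mapCurve H ![PowerSeries.X, 0, 0]) = 0 := by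
    intro i
    rw [← compCurve_comp hT hH0, ← hrep, compCurve_eq_substHom hT, map_mul, ← compCurve_eq_substHom,
      ← compCurve_eq_substHom, compCurve_pushTangent hT]
    have : (fun k => compCurve (normalForm (l + 2) f g k) ![PowerSeries.X, 0, 0]) = 0 := by
      funext k
      rw [compCurve_eq_substHom hT]
      fin_cases k <;> simp [normalForm, y_eq, z_eq, substHom_X_curve]
    rw [this, Matrix.mulVec_zero, Pi.zero_apply, mul_zero]
  have hπ0 : ∀ i, constantCoeff (comp (H i) curveChart) = 0 := fun i => by
    rw [constantCoeff_comp hρ, hH0]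
  obtain ⟨-, hP'⟩ := hP.transform hπ0 hφ'0 hφ' (fun i => (hw.comp hρc hρ).mul (hVc i)) hpush
    fun X' hX' => Or.inr ⟨H, ⟨hHc, hH0, hHd⟩, hcenter, hX', hφ'0, hφ'⟩
  -- every linear term of the transform vanishes
  refine hP'.isNilpotentSingularity.2.1 ?_
  have hF0 : constantCoeff F = 0 := by rw [hF, constantCoeff_comp hρ, hf0]
  have hG0 : constantCoeff G = 0 := by rw [hG, constantCoeff_comp hρ, hg0]
  have hGj : ∀ j, constantCoeff (pderiv ℂ j G) = 0 := by
    intro j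
    rw [coeff_single_eq] at hg2
    rw [hG, comp_eq_substHom hρ, pderiv_substHom, map_sum, Fin.sum_univ_three]
    simp only [map_mul, constantCoeff_substHom, hgx, hg2, zero_mul, zero_add, add_zero]
    fin_cases j <;> simp [curveChart, y_eq, z_eq, Derivation.leibniz, MvPowerSeries.pderiv_X_of_ne]
  ext i j
  rw [linearPart, Matrix.of_apply, coeff_single_eq, Derivation.leibniz]
  fin_cases i <;> fin_cases j <;>
    simp [hV, Derivation.leibniz, Derivation.leibniz_pow, MvPowerSeries.pderiv_X_of_ne, hF0, hG0,
      hGj, pow_succ]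

/-- The normal form of a prepared foliation. The orders of `f` and `g` on the `z`-axis come from the
contact of the curve with the axis: the restriction of `y + z f` and `z g` to the curve is a multiple
of the derivatives of its first two coordinates. -/
lemma PersistsAlong.exists_coordinates {m : ℕ} {X₀ : Triple} {φ : Curve} {α β : Fin 2 → ℂ} {c : ℂ}
    {q : Triple} (hP : PersistsAlong m X₀ φ) (h2 : PowerSeries.coeff 1 (φ 2) ≠ 0)
    (hprep : IsPrepared m X₀ α β c q) (N : ℕ) :
    ∃ (H : Triple) (f g : Ser) (ψ : Curve),
      IsBiholomorphism H ∧ IsNormalFormData m f g ∧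
      RepresentedIn H X₀ (normalForm m f g) ∧ φ = mapCurve H ψ ∧
      ψ.TangentToZAxis ∧ (N : ℕ∞) ≤ ψ.contactZAxis ∧
      (N : ℕ∞) ≤ (compCurve f zAxis).order ∧ (N : ℕ∞) ≤ (compCurve g zAxis).order := by
  have hm := hprep.two_le
  obtain ⟨p₁₁, p₁₂, p₂₁, p₂₂, hdet, h11, h21, h12, h22⟩ := hprep.exists_matrix hP h2
  obtain ⟨P, Q, ψ, hψ, hψφ, hφ, hψ0, hψ1⟩ :=
    -- one order is lost by differentiation, one by the division by `z`, and order at least two on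
    -- the `z`-axis is needed to get `∂g/∂z(0) = 0`
    exists_shear_contact hP.2.1.1 h2 hdet (N + 3)
  have hH := isBiholomorphism_shear p₁₁ p₁₂ p₂₁ p₂₂ P Q hdet
  obtain ⟨f, g, w, hf, hg, hw, hw0, hrep⟩ :=
    hprep.exists_normalForm p₁₁ p₁₂ p₂₁ p₂₂ P Q hdet h11 h21 h12 h22
  set H := shear p₁₁ p₁₂ p₂₁ p₂₂ P Q with hHdef
  have hψ2 : PowerSeries.coeff 1 (ψ 2) ≠ 0 := hψφ ▸ h2
  have hψ2ne : ψ 2 ≠ 0 := fun h => hψ2 (by simp [h])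
  -- the restriction of the normal form to the curve
  obtain ⟨k, hk, -⟩ := hP.hasMultiplicity
  have hwi : w⁻¹ * w = 1 := MvPowerSeries.inv_mul_cancel _ hw0
  obtain ⟨h, hh⟩ : ∃ h, ∀ i, compCurve (normalForm m f g i) ψ =
      h * PowerSeries.derivative ℂ (ψ i) := by
    refine ⟨compCurve w⁻¹ ψ * k, compCurve_of_mapCurve hψ hH.2.1 (fun h0 => hH.2.2 ?_)
      (fun i => by rw [← hrep, ← mul_assoc, hwi, one_mul]) (fun i => by rw [← hφ]; exact hk i)⟩
    rw [← constantCoeff_det_jac, ← constantCoeff_compCurve hψ, h0, map_zero]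
  have hord : ∀ a : Ser, PowerSeries.X ^ (N + 3) ∣ ψ 2 * compCurve a ψ →
      PowerSeries.X ^ (N + 2) ∣ compCurve a zAxis := by
    intro a ha
    refine X_pow_dvd_compCurve_zAxis hψ hψ2 ((pow_dvd_pow _ (by omega)).trans hψ0)
      ((pow_dvd_pow _ (by omega)).trans hψ1) ?_
    have hX2 : ψ 2 ∣ PowerSeries.X :=
      dvd_of_order_le (by rw [order_eq_one (hψ 2) hψ2, PowerSeries.order_X]) hψ2ne
    rw [pow_succ'] at ha
    have h1 : ψ 2 * PowerSeries.X ^ (N + 2) ∣ ψ 2 * compCurve a ψ :=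
      (mul_dvd_mul_right hX2 _).trans ha
    exact (mul_dvd_mul_iff_left hψ2ne).1 h1
  have hder : ∀ i, PowerSeries.X ^ (N + 4) ∣ ψ i →
      PowerSeries.X ^ (N + 3) ∣ PowerSeries.derivative ℂ (ψ i) := by
    intro i hi
    rw [PowerSeries.X_pow_dvd_iff] at hi ⊢
    intro j hj
    rw [PowerSeries.coeff_derivative, hi _ (by omega), zero_mul]
  have hf' : PowerSeries.X ^ (N + 2) ∣ compCurve f zAxis := by
    refine hord f ?_
    have h1 := hh 0
    have h3 : compCurve (normalForm m f g 0) ψ = ψ 1 + ψ 2 * compCurve f ψ := by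
      rw [compCurve_eq_substHom hψ, compCurve_eq_substHom hψ]
      simp [normalForm, y_eq, z_eq, substHom_X_curve]
    rw [h3] at h1
    refine (dvd_add_right ((pow_dvd_pow _ (by omega)).trans hψ1)).1 ?_
    rw [h1]
    exact (hder 0 hψ0).mul_left _
  have hg' : PowerSeries.X ^ (N + 2) ∣ compCurve g zAxis := by
    refine hord g ?_
    have h1 := hh 1
    have h3 : compCurve (normalForm m f g 1) ψ = ψ 2 * compCurve g ψ := by
      rw [compCurve_eq_substHom hψ, compCurve_eq_substHom hψ]
      simp [normalForm, z_eq, substHom_X_curve]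
    rw [← h3, h1]
    exact (hder 1 hψ1).mul_left _
  have hax : zAxis = (Pi.single 2 PowerSeries.X : Curve) := by
    funext i
    fin_cases i <;> simp [zAxis]
  have hcf : ∀ a, PowerSeries.X ^ (N + 2) ∣ compCurve a zAxis → ∀ j < 2,
      coeff (Finsupp.single 2 j) a = 0 := by
    intro a ha j hj
    rw [← coeff_compCurve_single, ← hax]
    exact PowerSeries.X_pow_dvd_iff.1 ha j (by omega)
  have hf0 : constantCoeff f = 0 := by simpa using hcf f hf' 0 (by norm_num)
  have hg0 : constantCoeff g = 0 := by simpa using hcf g hg' 0 (by norm_num)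
  have hgx := hP.constantCoeff_pderiv_ne_zero hm hH hf hg hw hf0 hg0
    (hcf g hg' 1 (by norm_num)) hrep hψ hψ2 ((pow_dvd_pow _ (by omega)).trans hψ1) hφ
  have h1 := fun i (hi : PowerSeries.X ^ (N + 4) ∣ ψ i) =>
    PowerSeries.X_pow_dvd_iff.1 hi 1 (by omega)
  exact ⟨H, f, g, ψ, hH, ⟨hm, hf, hg, hf0, hg0, hgx⟩, ⟨w, hw, hw0, hrep⟩, hφ,
    ⟨hψ, h1 0 hψ0, h1 1 hψ1, hψ2⟩,
    le_min (le_order_iff_X_pow_dvd.2 ((pow_dvd_pow _ (by omega)).trans hψ0))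
      (le_order_iff_X_pow_dvd.2 ((pow_dvd_pow _ (by omega)).trans hψ1)),
    le_order_iff_X_pow_dvd.2 ((pow_dvd_pow _ (by omega)).trans hf'),
    le_order_iff_X_pow_dvd.2 ((pow_dvd_pow _ (by omega)).trans hg')⟩

end NilpotentFoliation

end

theorem mainTheorem3 :
    (∀ (X : Triple) (φ : Curve), IsPersistentNilpotentAlong X φ →
      ∃ (X₁ : Triple) (φ₁ : Curve), Relation.ReflTransGen PointBlowup (X, φ) (X₁, φ₁) ∧
        ∃ n : ℕ, ∀ N : ℕ, ∃ (H : Triple) (f g : Ser) (ψ : Curve),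
          IsBiholomorphism H ∧ IsNormalFormData n f g ∧
          RepresentedIn H X₁ (normalForm n f g) ∧ φ₁ = mapCurve H ψ ∧
          ψ.TangentToZAxis ∧ (N : ℕ∞) ≤ ψ.contactZAxis ∧
          (N : ℕ∞) ≤ (compCurve f zAxis).order ∧ (N : ℕ∞) ≤ (compCurve g zAxis).order) ∧
    (∀ (X : Triple) (φ : Curve) (H : Triple) (n : ℕ) (f g : Ser) (ψ : Curve),
      IsFoliation X → IsBiholomorphism H → IsNormalFormData n f g →
      RepresentedIn H X (normalForm n f g) → φ = mapCurve H ψ →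
      ψ.TangentToZAxis → IsFormalSeparatrix (normalForm n f g) ψ →
      IsPersistentNilpotentAlong X φ ∧ IsPersistentNilpotent X) := by
  refine ⟨fun X φ hX => ?_, fun X φ H n f g ψ hX hH hfg hrep hφ hψ hS => ?_⟩
  · obtain ⟨hF, -, hsep, m, hm⟩ := hX
    have hP : PersistsAlong m X φ := ⟨hF, hsep.1, hm⟩
    obtain ⟨X₁, φ₁, α, β, c, q, hchain, hP₁, h2, hprep⟩ := hP.exists_isPrepared
    exact ⟨X₁, φ₁, hchain, m, fun N => hP₁.exists_coordinates h2 hprep N⟩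
  · have h := isPersistentNilpotentAlong_of_normalForm hX hH hfg hrep hφ hψ hS
    exact ⟨h, φ, h⟩
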